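/- **Setting.** Let $\Omega>0$, $\gamma>0$, $\Delta\in\mathbb R$, and for $J>0$ let $\omega_0(J)=\dfrac{\pi\Omega}{\pi-\arctan\frac{J}{2\Omega\Delta}}$ if $\Delta>0$, $\omega_0(J)=-\dfrac{\pi\Omega}{\arctan\frac{J}{2\Omega\Delta}}$ if $\Delta<0$, and $\omega_0(J)=2\Omega$ if $\Delta=0$ (the frequency of the oscillator $\ddot x+\Omega^2x=0$ with an elastic limiter at $x=\Delta$, as a function of the impulse $J$). Put $\Omega_0=\Omega/\omega_0(J)$ and let $\kappa(\psi,J)$ be the $2\pi$-periodic continuation in $\psi$ of $$\kappa(\psi,J)=\frac{\cos(\Omega_0(\psi-\pi))}{2\Omega\sin(\pi\Omega_0)},\qquad 0\le\psi<2\pi .$$ Let $f$ be a biharmonic force of one of two types: $f(t,\tau)=a_1\sin\nu t+a_2\sin(\nu t+\Gamma\tau)$ with $a_1,a_2,\nu,\Gamma>0$, $a_1\ne a_2$; or $f(t,\tau)=A\sin(\nu t+\theta)+B\sin\Gamma\tau$ with real $A,B,\nu,\Gamma,\theta$. Let $p\neq 0$, $q$ be relatively prime integers and let $J_{pq}>0$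 be a resonance point, $\omega_0(J_{pq})=\frac qp\nu$. Put $$F(t,\tau,\varphi,J)=-4\omega_0(J)\bigl[f(t,\tau)+\gamma J\omega_0(J)\kappa_\psi\bigr]\kappa_\psi,\qquad G(t,\tau,\varphi,J)=-4\omega_0(J)J^{-1}\bigl[f(t,\tau)+\gamma J\omega_0(J)\kappa_\psi\bigr](-J\kappa)_J,$$ where $\kappa,\kappa_\psi$ and $(-J\kappa)_J$ are taken at $(\varphi+\frac qp\nu t,\,J)$, and let $$f_0(\eta,\tau)=\frac{\nu}{2\pi p}\int_0^{2\pi p/\nu}F(t,\tau,\eta,J_{pq})\,dt$$ be the mean value of $F$ in $t$ at the resonance point. With $\mu=\sqrt\varepsilon$, $\tau=\varepsilon t$ and $J=J_{pq}+\mu z$, the perturbed impact oscillator $\ddot x+\Omega^2x+\Phi_0(x,\dot x)=\varepsilon[f(t,\tau)-\gamma\dot x]$ ($\Phi_0$ being the impact force) becomes, in impulse–phase variables near the resonance, the system $$\frac{dz}{dt}=\mu F(t,\mu^2t,\varphi,J_{pq}+\mu z),\qquad \frac{d\varphi}{dt}=\omega_0(J_{pq}+\mu z)-\frac qp\nu+\mu^2G(t,\mu^2t,\varphi,J_{pq}+\mu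 z).\tag{$*$}$$ Its right-hand side has jumps at the impacts $\varphi+\frac qp\nu t\in2\pi\mathbb Z$; solutions (with $J_{pq}+\mu z>0$) are understood in the sense of Carathéodory, that is, in integrated form. **Theorem.** Assume that $\omega_0'(J_{pq})\neq0$ and that there is a continuous periodic function $\eta_0(\tau)$ with $0<\eta_0(\tau)<2\pi$ such that $f_0(\eta_0(\tau),\tau)=0$ and, for some constant $\sigma_0$, $$\omega_0'(J_{pq})\,f_{0\eta}(\eta_0(\tau),\tau)>\sigma_0>0\qquad\text{for all }\tau\in\mathbb R .$$ Then for all sufficiently small $\mu>0$ the system $(*)$ has a unique almost periodic (in the sense of Bohr) solution near $(z,\varphi)=(0,\eta_0(\tau))$, and this solution is unstable. Precisely: there is $r_0>0$ such that for every $r\in(0,r_0]$ there is $\mu_0>0$ such that for every $\mu\in(0,\mu_0)$ there is exactly one almost periodic solution $(z,\varphi)$ of $(*)$ on $\mathbb R$ with $|z(t)|<r$ and $|\varphi(t)-\eta_0(\mu^2t)|<r$ for all $t$; and it is Lyapunov unstable as $t\to+\infty$: for every $t_0$ there is $\epsilon>0$ such that for every $\delta>0$ some solution starting at time $t_0$ at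 distance less than $\delta$ from it is at distance at least $\epsilon$ from it at some later time. -/

import Mathlib

open Real Set

noncomputable section

namespace ImpactOscillator

/-- Frequency `ω₀(J)` of the conservative impact oscillator `x'' + Ω² x = 0` with an elastic
limiter at `x = Δ`, as a function of the impulse `J > 0`. -/
def omega0 (Ω Δ J : ℝ) : ℝ :=
  if 0 < Δ then π * Ω / (π - arctan (J / (2 * Ω * Δ)))
  else if Δ < 0 then -(π * Ω) / arctan (J / (2 * Ω * Δ))
  else 2 * Ω

/-- The periodic Green's function `κ(ψ, J)`: the `2π`-periodic continuation in `ψ` of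
`cos (Ω₀ (ψ - π)) / (2 Ω sin (π Ω₀))`, `0 ≤ ψ < 2π`, where `Ω₀ = Ω / ω₀(J)`. -/
def kappa (Ω Δ ψ J : ℝ) : ℝ :=
  cos (Ω / omega0 Ω Δ J * (toIcoMod two_pi_pos 0 ψ - π)) /
    (2 * Ω * sin (π * (Ω / omega0 Ω Δ J)))

/-- `κ_ψ(ψ, J)`. It has jumps exactly at the impacts `ψ ∈ 2πℤ`. -/
def kappaPsi (Ω Δ ψ J : ℝ) : ℝ :=
  deriv (fun s => kappa Ω Δ s J) ψ

/-- Sum of two periodic forces with close frequencies. -/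
def closeForce (a₁ a₂ ν Γ t τ : ℝ) : ℝ :=
  a₁ * sin (ν * t) + a₂ * sin (ν * t + Γ * τ)

/-- Sum of two periodic forces with very different frequencies. -/
def distantForce (A B ν Γ θ t τ : ℝ) : ℝ :=
  A * sin (ν * t + θ) + B * sin (Γ * τ)

/-- `f(t, τ)` is a biharmonic force, of one of the two types, with fast frequency `ν`. -/
def IsBiharmonicForce (ν : ℝ) (f : ℝ → ℝ → ℝ) : Prop :=
  (∃ a₁ a₂ Γ : ℝ, 0 < a₁ ∧ 0 < a₂ ∧ a₁ ≠ a₂ ∧ 0 < ν ∧ 0 < Γ ∧ f = closeForce a₁ a₂ ν Γ) ∨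
  (∃ A B Γ θ : ℝ, f = distantForce A B ν Γ θ)

/-- `F(t, τ, φ, J) = -4 ω₀(J) [f + γ J ω₀(J) κ_ψ] κ_ψ`, with `κ_ψ` taken at `(φ + k t, J)`;
here `k` is the resonant frequency `(q/p) ν`. -/
def impulseRate (Ω Δ γ k : ℝ) (f : ℝ → ℝ → ℝ) (t τ φ J : ℝ) : ℝ :=
  -4 * omega0 Ω Δ J * (f t τ + γ * J * omega0 Ω Δ J * kappaPsi Ω Δ (φ + k * t) J) *
    kappaPsi Ω Δ (φ + k * t) J

/-- `G(t, τ, φ, J) = -4 ω₀(J) J⁻¹ [f + γ J ω₀(J) κ_ψ] (-J κ)_J`, with `κ` and its derivatives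
taken at `(φ + k t, J)`. -/
def phaseRate (Ω Δ γ k : ℝ) (f : ℝ → ℝ → ℝ) (t τ φ J : ℝ) : ℝ :=
  -4 * omega0 Ω Δ J * J⁻¹ * (f t τ + γ * J * omega0 Ω Δ J * kappaPsi Ω Δ (φ + k * t) J) *
    deriv (fun K => -K * kappa Ω Δ (φ + k * t) K) J

/-- `f₀(η, τ)`: mean value in `t` of `F(t, τ, η, J)` at the resonance point, over the common
period `2πp/ν` of `f(·, τ)` and of `t ↦ κ_ψ(η + (q/p) ν t, J)`. -/
def averagedImpulseRate (Ω Δ γ ν : ℝ) (p q : ℤ) (f : ℝ → ℝ → ℝ) (Jpq η τ : ℝ) : ℝ :=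
  (2 * π * p / ν)⁻¹ *
    ∫ t in (0 : ℝ)..(2 * π * p / ν), impulseRate Ω Δ γ (q / p * ν) f t τ η Jpq

/-- Right-hand side of the near-resonance system in the variables `(z, φ)`, where
`J = Jpq + μ z`, `ε = μ²`, `τ = ε t`:
`z' = μ F(t, τ, φ, J)`, `φ' = ω₀(J) - k + μ² G(t, τ, φ, J)`. -/
def resonanceField (Ω Δ γ k : ℝ) (f : ℝ → ℝ → ℝ) (Jpq μ t : ℝ) (x : ℝ × ℝ) : ℝ × ℝ :=
  (μ * impulseRate Ω Δ γ k f t (μ ^ 2 * t) x.2 (Jpq + μ * x.1),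
    omega0 Ω Δ (Jpq + μ * x.1) - k +
      μ ^ 2 * phaseRate Ω Δ γ k f t (μ ^ 2 * t) x.2 (Jpq + μ * x.1))

/-- `x = (z, φ)` is a (Carathéodory) solution of the near-resonance system on the set `I` of times
(an interval), with positive impulse: the right-hand side is discontinuous at the impacts, so the
system is understood in integrated form. -/
def IsSolutionOn (Ω Δ γ k : ℝ) (f : ℝ → ℝ → ℝ) (Jpq μ : ℝ) (I : Set ℝ) (x : ℝ → ℝ × ℝ) : Prop :=
  (∀ t ∈ I, 0 < Jpq + μ * (x t).1) ∧
  ∀ s ∈ I, ∀ t ∈ I,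
    IntervalIntegrable (fun u => resonanceField Ω Δ γ k f Jpq μ u (x u)) MeasureTheory.volume s t ∧
    x t - x s = ∫ u in s..t, resonanceField Ω Δ γ k f Jpq μ u (x u)

/-- Almost periodicity in the sense of Bohr. -/
def IsAlmostPeriodic (x : ℝ → ℝ × ℝ) : Prop :=
  Continuous x ∧ ∀ ε > 0, ∃ L > 0, ∀ a : ℝ, ∃ T ∈ Icc a (a + L), ∀ t, dist (x (t + T)) (x t) < ε

/-- Lyapunov instability (as `t → +∞`) of the solution `x`, at every initial time: arbitrarily
close to `x t₀` there start solutions that later reach a fixed distance from `x`. -/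
def IsUnstable (Ω Δ γ k : ℝ) (f : ℝ → ℝ → ℝ) (Jpq μ : ℝ) (x : ℝ → ℝ × ℝ) : Prop :=
  ∀ t₀ : ℝ, ∃ ε > 0, ∀ δ > 0, ∃ t₁ ≥ t₀, ∃ y : ℝ → ℝ × ℝ,
    IsSolutionOn Ω Δ γ k f Jpq μ (Icc t₀ t₁) y ∧ dist (y t₀) (x t₀) < δ ∧ ε ≤ dist (y t₁) (x t₁)

/-- `x = (z, φ)` stays within `r` of `(0, η₀(τ))`, `τ = μ² t`, for all times. -/
def StaysNear (η₀ : ℝ → ℝ) (μ r : ℝ) (x : ℝ → ℝ × ℝ) : Prop :=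
  ∀ t, |(x t).1| < r ∧ |(x t).2 - η₀ (μ ^ 2 * t)| < r

end ImpactOscillator

end

namespace ImpactOscillator

open MeasureTheory Filter Topology BoundedContinuousFunction

section IntegralEquation

variable {E : Type*} [NormedAddCommGroup E]

/-- A field that is bounded by `B`, Lipschitz with constant `K`, and measurable along continuous
curves. -/
structure IsCaratheodory (H : ℝ → E → E) (B K : ℝ) : Prop where
  meas : ∀ X : ℝ → E, Continuous X → AEStronglyMeasurable (fun s => H s (X s)) volume
  bound : ∀ s x, ‖H s x‖ ≤ B
  lip : ∀ s x y, ‖H s x - H s y‖ ≤ K * ‖x - y‖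

theorem IsCaratheodory.intervalIntegrable {H : ℝ → E → E} {B K : ℝ} (hH : IsCaratheodory H B K)
    {X : ℝ → E} (hX : Continuous X) (a b : ℝ) :
    IntervalIntegrable (fun s => H s (X s)) volume a b :=
  (intervalIntegrable_const (c := B)).mono_fun (hH.meas X hX).restrict
    (Eventually.of_forall fun s => (hH.bound s _).trans (le_abs_self B))

theorem IsCaratheodory.shift {H : ℝ → E → E} {B K : ℝ} (hH : IsCaratheodory H B K) (a : ℝ) :
    IsCaratheodory (fun s => H (s + a)) B K where
  meas X hX := by
    have h := hH.meas (fun s => X (s - a)) (hX.comp (continuous_id.sub continuous_const))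
    have := h.comp_measurePreserving (measurePreserving_add_right volume a)
    simpa [Function.comp_def] using this
  bound s x := hH.bound _ x
  lip s x y := hH.lip _ x y

variable [NormedSpace ℝ E]

/-- `X` solves `X' = H(s, X)` on the whole line in integrated form. -/
def IsIntegralSolution (H : ℝ → E → E) (X : ℝ → E) : Prop :=
  Continuous X ∧ ∀ a b, X b - X a = ∫ s in a..b, H s (X s)

theorem IsIntegralSolution.shift {H : ℝ → E → E} {X : ℝ → E} (hX : IsIntegralSolution H X)
    (a : ℝ) : IsIntegralSolution (fun s => H (s + a)) (fun s => X (s + a)) := by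
  refine ⟨hX.1.comp (continuous_id.add continuous_const), fun b c => ?_⟩
  rw [hX.2, intervalIntegral.integral_comp_add_right (fun s => H s (X s))]

theorem abs_integral_exp_abs_le {c : ℝ} (hc : 0 < c) (t : ℝ) :
    |∫ s in (0 : ℝ)..t, exp (c * |s|)| ≤ exp (c * |t|) / c := by
  have key : ∀ t : ℝ, 0 ≤ t → |∫ s in (0 : ℝ)..t, exp (c * |s|)| ≤ exp (c * |t|) / c := by
    intro t ht
    have h1 : ∫ s in (0 : ℝ)..t, exp (c * |s|) = ∫ s in (0 : ℝ)..t, exp (c * s) := by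
      refine intervalIntegral.integral_congr fun s hs => ?_
      rw [uIcc_of_le ht] at hs
      simp only [abs_of_nonneg hs.1]
    rw [h1, intervalIntegral.integral_comp_mul_left (fun s => exp s) hc.ne', integral_exp,
      abs_of_nonneg ht]
    have h2 : (1 : ℝ) ≤ exp (c * t) := one_le_exp (by positivity)
    simp only [smul_eq_mul, mul_zero, exp_zero]
    rw [abs_of_nonneg (mul_nonneg (by positivity) (by linarith)), div_eq_inv_mul]
    gcongr
    linarith
  rcases le_total 0 t with ht | ht
  · exact key t ht
  · have h1 : ∫ s in (0 : ℝ)..t, exp (c * |s|) = -∫ s in (0 : ℝ)..(-t), exp (c * |s|) := by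
      have := intervalIntegral.integral_comp_neg (a := 0) (b := -t) (fun s => exp (c * |s|))
      simp only [abs_neg, neg_neg, neg_zero] at this
      rw [this, intervalIntegral.integral_symm]
    rw [h1, abs_neg]
    simpa using key (-t) (by linarith)

theorem IsCaratheodory.exists_solution_zero [CompleteSpace E] {H : ℝ → E → E} {B K : ℝ}
    (hH : IsCaratheodory H B K) (hK : 0 ≤ K) (x₀ : E) :
    ∃ X, IsIntegralSolution H X ∧ X 0 = x₀ := by
  have hB : 0 ≤ B := (norm_nonneg _).trans (hH.bound 0 x₀)
  set c : ℝ := 2 * K + 1 with hc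
  have hc0 : 0 < c := by positivity
  have hcurve : ∀ Y : ℝ →ᵇ E, Continuous fun s => x₀ + exp (c * |s|) • Y s := fun Y => by
    have := Y.continuous
    fun_prop
  have hcont : ∀ Y : ℝ →ᵇ E, Continuous fun t =>
      exp (-(c * |t|)) • ∫ s in (0 : ℝ)..t, H s (x₀ + exp (c * |s|) • Y s) := fun Y => by
    have h1 : Continuous fun t => ∫ s in (0 : ℝ)..t, H s (x₀ + exp (c * |s|) • Y s) :=
      intervalIntegral.continuous_primitive (fun a b => hH.intervalIntegrable (hcurve Y) a b) 0
    fun_prop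
  have hbd : ∀ Y : ℝ →ᵇ E, ∀ t,
      ‖exp (-(c * |t|)) • ∫ s in (0 : ℝ)..t, H s (x₀ + exp (c * |s|) • Y s)‖ ≤ B / c := by
    intro Y t
    have h1 : ‖∫ s in (0 : ℝ)..t, H s (x₀ + exp (c * |s|) • Y s)‖ ≤ B * |t - 0| :=
      intervalIntegral.norm_integral_le_of_norm_le_const fun s _ => hH.bound s _
    rw [sub_zero] at h1
    rw [norm_smul, norm_of_nonneg (exp_pos _).le, exp_neg, inv_mul_le_iff₀ (exp_pos _)]
    have h2 : c * |t| ≤ exp (c * |t|) := by linarith [add_one_le_exp (c * |t|)]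
    calc _ ≤ B * |t| := h1
      _ = B / c * (c * |t|) := by field_simp
      _ ≤ B / c * exp (c * |t|) := by gcongr
      _ = _ := mul_comm _ _
  let T : (ℝ →ᵇ E) → (ℝ →ᵇ E) := fun Y =>
    BoundedContinuousFunction.ofNormedAddCommGroup _ (hcont Y) (B / c) (hbd Y)
  have hT : ∀ Y t, T Y t =
      exp (-(c * |t|)) • ∫ s in (0 : ℝ)..t, H s (x₀ + exp (c * |s|) • Y s) := fun _ _ => rfl
  have hlip : LipschitzWith (1 / 2) T := by
    refine LipschitzWith.of_dist_le_mul fun Y Z => ?_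
    have h0 : (0 : ℝ) ≤ ((1 / 2 : NNReal) : ℝ) * dist Y Z := by positivity
    refine (BoundedContinuousFunction.dist_le h0).2 fun t => ?_
    rw [hT, hT, dist_eq_norm, ← smul_sub, ← intervalIntegral.integral_sub
      (hH.intervalIntegrable (hcurve Y) _ _) (hH.intervalIntegrable (hcurve Z) _ _), norm_smul,
      norm_of_nonneg (exp_pos _).le, exp_neg, inv_mul_le_iff₀ (exp_pos _)]
    have h1 : ∀ s, ‖H s (x₀ + exp (c * |s|) • Y s) - H s (x₀ + exp (c * |s|) • Z s)‖ ≤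
        K * dist Y Z * exp (c * |s|) := by
      intro s
      refine (hH.lip s _ _).trans ?_
      rw [add_sub_add_left_eq_sub, ← smul_sub, norm_smul, norm_of_nonneg (exp_pos _).le,
        ← dist_eq_norm]
      have := BoundedContinuousFunction.dist_coe_le_dist (f := Y) (g := Z) s
      calc K * (exp (c * |s|) * dist (Y s) (Z s)) ≤ K * (exp (c * |s|) * dist Y Z) := by gcongr
        _ = _ := by ring
    have h2 : ‖∫ s in (0 : ℝ)..t, (H s (x₀ + exp (c * |s|) • Y s) -
        H s (x₀ + exp (c * |s|) • Z s))‖ ≤ |∫ s in (0 : ℝ)..t, K * dist Y Z * exp (c * |s|)| :=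
      intervalIntegral.norm_integral_le_abs_of_norm_le (Eventually.of_forall fun s => h1 s)
        (Continuous.intervalIntegrable (by fun_prop) _ _)
    rw [intervalIntegral.integral_const_mul, abs_mul,
      abs_of_nonneg (mul_nonneg hK dist_nonneg)] at h2
    refine h2.trans ?_
    have h3 := abs_integral_exp_abs_le hc0 t
    calc K * dist Y Z * |∫ s in (0 : ℝ)..t, exp (c * |s|)|
        ≤ K * dist Y Z * (exp (c * |t|) / c) := by gcongr
      _ = exp (c * |t|) * (K / c * dist Y Z) := by ring
      _ ≤ _ := by
        gcongr
        rw [div_le_iff₀ hc0]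
        push_cast
        linarith
  have hcontr : ContractingWith (1 / 2) T := ⟨by
    rw [← NNReal.coe_lt_coe]; norm_num, hlip⟩
  set Y := ContractingWith.fixedPoint T hcontr with hY
  have hfix : T Y = Y := hcontr.fixedPoint_isFixedPt
  have hval : ∀ t, x₀ + exp (c * |t|) • Y t =
      x₀ + ∫ s in (0 : ℝ)..t, H s (x₀ + exp (c * |s|) • Y s) := by
    intro t
    conv_lhs => rw [← hfix, hT]
    rw [smul_smul, ← exp_add, add_neg_cancel, exp_zero, one_smul]
  refine ⟨fun t => x₀ + exp (c * |t|) • Y t, ⟨hcurve Y, fun a b => ?_⟩, ?_⟩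
  · have hi := fun a b => hH.intervalIntegrable (hcurve Y) a b
    beta_reduce
    rw [hval a, hval b, add_sub_add_left_eq_sub,
      intervalIntegral.integral_interval_sub_left (hi _ _) (hi _ _)]
  · have := hval 0
    simpa using this

theorem IsCaratheodory.exists_solution [CompleteSpace E] {H : ℝ → E → E} {B K : ℝ}
    (hH : IsCaratheodory H B K) (hK : 0 ≤ K) (a : ℝ) (x₀ : E) :
    ∃ X, IsIntegralSolution H X ∧ X a = x₀ := by
  obtain ⟨X, hX, hX0⟩ := (hH.shift a).exists_solution_zero hK x₀
  refine ⟨fun s => X (s + -a), ?_, by simpa using hX0⟩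
  simpa using hX.shift (-a)

theorem IsIntegralSolution.norm_sub_le {H : ℝ → E → E} {B K : ℝ} (hH : IsCaratheodory H B K)
    {X : ℝ → E} (hX : IsIntegralSolution H X) (a b : ℝ) : ‖X b - X a‖ ≤ B * |b - a| := by
  rw [hX.2]
  exact intervalIntegral.norm_integral_le_of_norm_le_const fun s _ => hH.bound s _

/-- Comparison of solutions of two close fields over a time that is short with respect to the
Lipschitz constant. -/
theorem IsIntegralSolution.norm_sub_le_of_close {H H' : ℝ → E → E} {B K B' K' L e : ℝ}
    (hH : IsCaratheodory H B K) (hH' : IsCaratheodory H' B' K') (hK : 0 ≤ K) (hL : 0 ≤ L)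
    (hKL : K * L ≤ 1 / 2) (he : ∀ s x, ‖H s x - H' s x‖ ≤ e) {X Y : ℝ → E}
    (hX : IsIntegralSolution H X) (hY : IsIntegralSolution H' Y) {a s : ℝ} (hs : |s - a| ≤ L) :
    ‖X s - Y s‖ ≤ 2 * (‖X a - Y a‖ + L * e) := by
  have he0 : 0 ≤ e := (norm_nonneg _).trans (he 0 (X 0))
  have hcont : Continuous fun u => ‖X u - Y u‖ := (hX.1.sub hY.1).norm
  obtain ⟨m, hm, hmax⟩ := (isCompact_Icc (a := a - L) (b := a + L)).exists_isMaxOn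
    ⟨a, by constructor <;> linarith⟩ hcont.continuousOn
  have hsm : ∀ u, |u - a| ≤ L → ‖X u - Y u‖ ≤ ‖X m - Y m‖ := fun u hu => by
    rw [abs_le] at hu
    exact hmax ⟨by linarith [hu.1], by linarith [hu.2]⟩
  have hma : |m - a| ≤ L := abs_le.2 ⟨by linarith [hm.1], by linarith [hm.2]⟩
  have hintg : ‖∫ u in a..m, (H u (X u) - H' u (Y u))‖ ≤ (e + K * ‖X m - Y m‖) * |m - a| := by
    refine intervalIntegral.norm_integral_le_of_norm_le_const fun u hu => ?_
    have hu' : |u - a| ≤ L :=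
      (abs_sub_left_of_mem_uIcc (uIoc_subset_uIcc hu)).trans hma
    calc ‖H u (X u) - H' u (Y u)‖
        = ‖(H u (Y u) - H' u (Y u)) + (H u (X u) - H u (Y u))‖ := by congr 1; abel
      _ ≤ e + K * ‖X u - Y u‖ := (norm_add_le _ _).trans (add_le_add (he _ _) (hH.lip _ _ _))
      _ ≤ _ := by gcongr; exact hsm u hu'
  have heq : X m - Y m = (X a - Y a) + ∫ u in a..m, (H u (X u) - H' u (Y u)) := by
    rw [intervalIntegral.integral_sub (hH.intervalIntegrable hX.1 _ _)
      (hH'.intervalIntegrable hY.1 _ _), ← hX.2, ← hY.2]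
    abel
  have h1 : ‖X m - Y m‖ ≤ ‖X a - Y a‖ + (e + K * ‖X m - Y m‖) * L := by
    calc ‖X m - Y m‖ ≤ ‖X a - Y a‖ + ‖∫ u in a..m, (H u (X u) - H' u (Y u))‖ := by
          conv_lhs => rw [heq]
          exact norm_add_le _ _
      _ ≤ ‖X a - Y a‖ + (e + K * ‖X m - Y m‖) * |m - a| := by gcongr
      _ ≤ _ := by gcongr
  have h2 := hsm s hs
  have h3 : K * ‖X m - Y m‖ * L ≤ 1 / 2 * ‖X m - Y m‖ := by
    calc K * ‖X m - Y m‖ * L = K * L * ‖X m - Y m‖ := by ring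
      _ ≤ _ := by gcongr
  nlinarith

theorem IsIntegralSolution.norm_sub_le_two_mul {H : ℝ → E → E} {B K L : ℝ}
    (hH : IsCaratheodory H B K) (hK : 0 ≤ K) (hL : 0 ≤ L) (hKL : K * L ≤ 1 / 2) {X Y : ℝ → E}
    (hX : IsIntegralSolution H X) (hY : IsIntegralSolution H Y) {a s : ℝ} (hs : |s - a| ≤ L) :
    ‖X s - Y s‖ ≤ 2 * ‖X a - Y a‖ := by
  simpa using hX.norm_sub_le_of_close hH hH hK hL hKL (e := 0) (by simp) hY hs

/-- First-order averaging over one period, with an error that is small together with its Lipschitz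
constant. -/
theorem IsIntegralSolution.averaging {H A R : ℝ → E → E} {μ C L : ℝ} {S : Set E}
    (hμ : 0 ≤ μ) (hC : 0 ≤ C) (hL : 0 ≤ L) (hμL : μ * C * L ≤ 1 / 2)
    (hH : IsCaratheodory H (μ * C) (μ * C))
    (hHS : ∀ s ∈ Icc 0 L, ∀ x ∈ S, H s x = μ • A s x + μ ^ 2 • R s x)
    (hAi : ∀ x, IntervalIntegrable (fun s => A s x) volume 0 L)
    (hA : ∀ s x y, ‖A s x - A s y‖ ≤ C * ‖x - y‖)
    (hA' : ∀ s x y ξ ζ, ‖A s (x + ξ) - A s x - (A s (y + ζ) - A s y)‖ ≤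
      C * ‖ξ - ζ‖ + C * ‖ξ‖ * ‖x - y‖)
    (hRb : ∀ s ∈ Icc 0 L, ∀ x, ‖R s x‖ ≤ C)
    (hR : ∀ s ∈ Icc 0 L, ∀ x y, ‖R s x - R s y‖ ≤ C * ‖x - y‖)
    {X Y : ℝ → E} (hX : IsIntegralSolution H X) (hY : IsIntegralSolution H Y)
    (hXS : ∀ s ∈ Icc 0 L, X s ∈ S) (hYS : ∀ s ∈ Icc 0 L, Y s ∈ S) :
    ‖X L - X 0 - μ • ∫ s in (0 : ℝ)..L, A s (X 0)‖ ≤ μ ^ 2 * (L * (C + C * C * L)) ∧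
    ‖(X L - X 0 - μ • ∫ s in (0 : ℝ)..L, A s (X 0)) -
      (Y L - Y 0 - μ • ∫ s in (0 : ℝ)..L, A s (Y 0))‖ ≤
      μ ^ 2 * (L * (3 * C * C * L + 2 * C)) * ‖X 0 - Y 0‖ := by
  have hAμ : ∀ x, IntervalIntegrable (fun s => μ • A s x) volume 0 L := fun x => (hAi x).smul μ
  have hintg : ∀ Z : ℝ → E, IsIntegralSolution H Z →
      Z L - Z 0 - μ • ∫ s in (0 : ℝ)..L, A s (Z 0) =
        ∫ s in (0 : ℝ)..L, (H s (Z s) - μ • A s (Z 0)) := fun Z hZ => by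
    rw [intervalIntegral.integral_sub (hH.intervalIntegrable hZ.1 _ _) (hAμ _), ← hZ.2,
      intervalIntegral.integral_smul]
  have hii : ∀ Z : ℝ → E, IsIntegralSolution H Z →
      IntervalIntegrable (fun s => H s (Z s) - μ • A s (Z 0)) volume 0 L := fun Z hZ =>
    (hH.intervalIntegrable hZ.1 _ _).sub (hAμ _)
  have hmem : ∀ s ∈ uIoc 0 L, s ∈ Icc 0 L := fun s hs => by
    rw [uIoc_of_le hL] at hs
    exact Ioc_subset_Icc_self hs
  have hsL : ∀ s ∈ Icc 0 L, |s - 0| ≤ L := fun s hs => by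
    rw [sub_zero, abs_of_nonneg hs.1]; exact hs.2
  have hdisp : ∀ s ∈ Icc 0 L, ‖X s - X 0‖ ≤ μ * C * L := fun s hs =>
    (hX.norm_sub_le hH 0 s).trans (by gcongr; exact hsL s hs)
  have hL0 : |L - 0| = L := by rw [sub_zero, abs_of_nonneg hL]
  constructor
  · rw [hintg X hX]
    have : ‖∫ s in (0 : ℝ)..L, (H s (X s) - μ • A s (X 0))‖ ≤
        (μ ^ 2 * (C + C * C * L)) * |L - 0| := by
      refine intervalIntegral.norm_integral_le_of_norm_le_const fun s hs => ?_
      have hs' := hmem s hs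
      rw [hHS s hs' _ (hXS s hs')]
      calc ‖μ • A s (X s) + μ ^ 2 • R s (X s) - μ • A s (X 0)‖
          = ‖μ • (A s (X s) - A s (X 0)) + μ ^ 2 • R s (X s)‖ := by
            congr 1; rw [smul_sub]; abel
        _ ≤ μ * (C * (μ * C * L)) + μ ^ 2 * C := by
            refine (norm_add_le _ _).trans (add_le_add ?_ ?_)
            · rw [norm_smul, norm_of_nonneg hμ]
              gcongr
              exact (hA _ _ _).trans (by gcongr; exact hdisp s hs')
            · rw [norm_smul, norm_of_nonneg (by positivity)]
              gcongr
              exact hRb s hs' _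
        _ = _ := by ring
    rw [hL0] at this
    linarith
  · rw [hintg X hX, hintg Y hY, ← intervalIntegral.integral_sub (hii X hX) (hii Y hY)]
    have : ‖∫ s in (0 : ℝ)..L, (H s (X s) - μ • A s (X 0) - (H s (Y s) - μ • A s (Y 0)))‖ ≤
        (μ ^ 2 * (3 * C * C * L + 2 * C) * ‖X 0 - Y 0‖) * |L - 0| := by
      refine intervalIntegral.norm_integral_le_of_norm_le_const fun s hs => ?_
      have hs' := hmem s hs
      have htwo : ∀ u ∈ Icc 0 L, ‖X u - Y u‖ ≤ 2 * ‖X 0 - Y 0‖ := fun u hu =>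
        hX.norm_sub_le_two_mul hH (by positivity) hL hμL hY (hsL u hu)
      have hdiff : ‖(X s - X 0) - (Y s - Y 0)‖ ≤ 2 * (μ * C * L) * ‖X 0 - Y 0‖ := by
        rw [hX.2, hY.2, ← intervalIntegral.integral_sub (hH.intervalIntegrable hX.1 _ _)
          (hH.intervalIntegrable hY.1 _ _)]
        have : ‖∫ u in (0 : ℝ)..s, (H u (X u) - H u (Y u))‖ ≤
            (μ * C * (2 * ‖X 0 - Y 0‖)) * |s - 0| := by
          refine intervalIntegral.norm_integral_le_of_norm_le_const fun u hu => ?_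
          rw [uIoc_of_le hs'.1] at hu
          refine (hH.lip _ _ _).trans ?_
          gcongr
          exact htwo u ⟨hu.1.le, hu.2.trans hs'.2⟩
        refine this.trans ?_
        calc _ ≤ μ * C * (2 * ‖X 0 - Y 0‖) * L := by gcongr; exact hsL s hs'
          _ = _ := by ring
      rw [hHS s hs' _ (hXS s hs'), hHS s hs' _ (hYS s hs')]
      have h4 := hA' s (X 0) (Y 0) (X s - X 0) (Y s - Y 0)
      rw [add_sub_cancel, add_sub_cancel] at h4
      calc ‖μ • A s (X s) + μ ^ 2 • R s (X s) - μ • A s (X 0) -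
            (μ • A s (Y s) + μ ^ 2 • R s (Y s) - μ • A s (Y 0))‖
          = ‖μ • (A s (X s) - A s (X 0) - (A s (Y s) - A s (Y 0))) +
              μ ^ 2 • (R s (X s) - R s (Y s))‖ := by
            congr 1; simp only [smul_sub]; abel
        _ ≤ μ * (C * (2 * (μ * C * L) * ‖X 0 - Y 0‖) + C * (μ * C * L) * ‖X 0 - Y 0‖) +
              μ ^ 2 * (C * (2 * ‖X 0 - Y 0‖)) := by
            refine (norm_add_le _ _).trans (add_le_add ?_ ?_)
            · rw [norm_smul, norm_of_nonneg hμ]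
              gcongr
              refine h4.trans ?_
              gcongr
              exact hdisp s hs'
            · rw [norm_smul, norm_of_nonneg (by positivity)]
              gcongr
              exact (hR s hs' _ _).trans (by gcongr; exact htwo s hs')
        _ = _ := by ring
    rw [hL0] at this
    linarith

end IntegralEquation

end ImpactOscillator

namespace ImpactOscillator

open MeasureTheory Filter Topology BoundedContinuousFunction

noncomputable section Saddle

/-- A sequence of planar maps `P n` that, near the points `(0, c n)`, differ from the identity by
`μ` times a saddle, up to errors of order `μ²`. -/
structure IsSaddleSequence (P : ℤ → ℝ × ℝ → ℝ × ℝ) (c : ℤ → ℝ) (ς μ m M K ρ : ℝ) : Prop where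
  sign : ς = 1 ∨ ς = -1
  pos : 0 < μ
  m_pos : 0 < m
  small : μ * M ≤ 1
  small' : 4 * K * μ ≤ m
  K_nonneg : 0 ≤ K
  center : ∀ n, |(P n (0, c n)).1| + |(P n (0, c n)).2 - c (n + 1)| ≤ K * μ ^ 2
  step : ∀ n, ∀ x y : ℝ × ℝ, |x.1| ≤ ρ → |x.2 - c n| ≤ ρ → |y.1| ≤ ρ → |y.2 - c n| ≤ ρ →
    ∃ b ∈ Icc m M, ∃ w ∈ Icc m M,
      |ς * ((P n x).1 - (P n y).1) - ς * (x.1 - y.1) - μ * b * (x.2 - y.2)| ≤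
        K * μ ^ 2 * (|x.1 - y.1| + |x.2 - y.2|) ∧
      |((P n x).2 - (P n y).2) - (x.2 - y.2) - μ * w * (ς * (x.1 - y.1))| ≤
        K * μ ^ 2 * (|x.1 - y.1| + |x.2 - y.2|)

theorem abs_sub_saddle_le {μ m M b w u v D : ℝ} (hμ : 0 ≤ μ) (hM : μ * M ≤ 1)
    (hb : b ∈ Icc m M) (hw : w ∈ Icc m M) (hu : |u| ≤ D) (hv : |v| ≤ D) :
    |u - μ * ((b + w) / 2 * u + (w - b) / 2 * v)| ≤ (1 - μ * m) * D := by
  obtain ⟨hb1, hb2⟩ := hb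
  obtain ⟨hw1, hw2⟩ := hw
  have hD : 0 ≤ D := (abs_nonneg _).trans hu
  have h1 : 0 ≤ 1 - μ * ((b + w) / 2) := by nlinarith
  have h2 : |(w - b) / 2| ≤ (b + w) / 2 - m := abs_le.2 ⟨by linarith, by linarith⟩
  calc |u - μ * ((b + w) / 2 * u + (w - b) / 2 * v)|
      = |(1 - μ * ((b + w) / 2)) * u - μ * ((w - b) / 2) * v| := by congr 1; ring
    _ ≤ |(1 - μ * ((b + w) / 2)) * u| + |μ * ((w - b) / 2) * v| := abs_sub _ _
    _ = (1 - μ * ((b + w) / 2)) * |u| + μ * |(w - b) / 2| * |v| := by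
        rw [abs_mul, abs_mul, abs_mul, abs_of_nonneg h1, abs_of_nonneg hμ]
    _ ≤ (1 - μ * ((b + w) / 2)) * D + μ * ((b + w) / 2 - m) * D := by
        have : 0 ≤ (b + w) / 2 - m := by linarith
        gcongr
    _ = _ := by ring

variable {P : ℤ → ℝ × ℝ → ℝ × ℝ} {c : ℤ → ℝ} {ς μ m M K ρ : ℝ}

/-- Unstable and stable coordinates of a vector. -/
def saddleU (ς : ℝ) (x : ℝ × ℝ) : ℝ := ς * x.1 + x.2

/-- See `saddleU`. -/
def saddleV (ς : ℝ) (x : ℝ × ℝ) : ℝ := ς * x.1 - x.2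

theorem IsSaddleSequence.abs_saddle_le (h : IsSaddleSequence P c ς μ m M K ρ) {n : ℤ}
    {x y : ℝ × ℝ} (hx : |x.1| ≤ ρ) (hx' : |x.2 - c n| ≤ ρ) (hy : |y.1| ≤ ρ)
    (hy' : |y.2 - c n| ≤ ρ) {D : ℝ} (hU : |saddleU ς (x - y)| ≤ D) (hV : |saddleV ς (x - y)| ≤ D) :
    |saddleV ς (P n x - P n y)| ≤ (1 - μ * m / 2) * D ∧
    |2 * saddleU ς (x - y) - saddleU ς (P n x - P n y)| ≤ (1 - μ * m / 2) * D := by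
  obtain ⟨b, hb, w, hw, h1, h2⟩ := h.step n x y hx hx' hy hy'
  have hμ := h.pos
  simp only [saddleU, saddleV, Prod.fst_sub, Prod.snd_sub] at *
  set dz := x.1 - y.1
  set dp := x.2 - y.2
  set ez := (P n x).1 - (P n y).1
  set ep := (P n x).2 - (P n y).2
  have hs : |dz| = |ς * dz| := by rcases h.sign with rfl | rfl <;> simp
  have hN : |dz| + |dp| ≤ D := by
    rw [hs]
    rcases abs_cases (ς * dz) with h3 | h3 <;> rcases abs_cases dp with h4 | h4 <;>
      rcases abs_le.1 hU with ⟨h5, h6⟩ <;> rcases abs_le.1 hV with ⟨h7, h8⟩ <;> linarith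
  have hD : 0 ≤ D := (abs_nonneg _).trans hU
  have hK := h.K_nonneg
  have hE : K * μ ^ 2 * (|dz| + |dp|) ≤ μ * m / 4 * D := by
    calc K * μ ^ 2 * (|dz| + |dp|) ≤ K * μ ^ 2 * D := by gcongr
      _ = μ * (4 * K * μ) / 4 * D := by ring
      _ ≤ _ := by gcongr; exact h.small'
  have h3 := abs_sub_saddle_le hμ.le h.small hb hw hV hU
  have h4 := abs_sub_saddle_le hμ.le h.small hb hw hU hV
  rw [abs_le] at h1 h2 h3 h4
  constructor <;> rw [abs_le] <;> constructor <;>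
    linarith [h1.1, h1.2, h2.1, h2.2, h3.1, h3.2, h4.1, h4.2]

/-- Growth in the unstable cone. -/
theorem IsSaddleSequence.cone (h : IsSaddleSequence P c ς μ m M K ρ) {n : ℤ}
    {x y : ℝ × ℝ} (hx : |x.1| ≤ ρ) (hx' : |x.2 - c n| ≤ ρ) (hy : |y.1| ≤ ρ)
    (hy' : |y.2 - c n| ≤ ρ) (hUV : |saddleV ς (x - y)| ≤ |saddleU ς (x - y)|) :
    |saddleV ς (P n x - P n y)| ≤ |saddleU ς (P n x - P n y)| ∧
    (1 + μ * m / 2) * |saddleU ς (x - y)| ≤ |saddleU ς (P n x - P n y)| := by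
  obtain ⟨h1, h2⟩ := h.abs_saddle_le hx hx' hy hy' le_rfl hUV
  have h3 : 2 * |saddleU ς (x - y)| - |saddleU ς (P n x - P n y)| ≤
      (1 - μ * m / 2) * |saddleU ς (x - y)| := by
    refine le_trans ?_ h2
    have := abs_sub_abs_le_abs_sub (2 * saddleU ς (x - y)) (saddleU ς (P n x - P n y))
    rwa [abs_mul, abs_two] at this
  have h4 : 0 ≤ μ * m * |saddleU ς (x - y)| :=
    mul_nonneg (mul_nonneg h.pos.le h.m_pos.le) (abs_nonneg _)
  constructor <;> linarith

/-- The point with given unstable and stable coordinates relative to `(0, c)`. -/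
def saddlePoint (ς c : ℝ) (w : ℝ × ℝ) : ℝ × ℝ := (ς * ((w.1 + w.2) / 2), c + (w.1 - w.2) / 2)

/-- Operator whose fixed points are the orbits of `P`. -/
def saddleOperator (P : ℤ → ℝ × ℝ → ℝ × ℝ) (c : ℤ → ℝ) (ς : ℝ) (w : ℤ → ℝ × ℝ) (n : ℤ) : ℝ × ℝ :=
  ((w n).1 + ((w (n + 1)).1 + c (n + 1) - saddleU ς (P n (saddlePoint ς (c n) (w n)))) / 2,
    saddleV ς (P (n - 1) (saddlePoint ς (c (n - 1)) (w (n - 1)))) + c n)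

theorem saddleU_sub (ς : ℝ) (x y : ℝ × ℝ) : saddleU ς (x - y) = saddleU ς x - saddleU ς y := by
  simp [saddleU]; ring

theorem saddleV_sub (ς : ℝ) (x y : ℝ × ℝ) : saddleV ς (x - y) = saddleV ς x - saddleV ς y := by
  simp [saddleV]; ring

theorem saddleU_saddlePoint (hς : ς = 1 ∨ ς = -1) (d : ℝ) (w : ℝ × ℝ) :
    saddleU ς (saddlePoint ς d w) = w.1 + d := by
  rcases hς with rfl | rfl <;> simp [saddleU, saddlePoint] <;> ring

theorem saddleV_saddlePoint (hς : ς = 1 ∨ ς = -1) (d : ℝ) (w : ℝ × ℝ) :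
    saddleV ς (saddlePoint ς d w) = w.2 - d := by
  rcases hς with rfl | rfl <;> simp [saddleV, saddlePoint] <;> ring

theorem norm_prod_le_iff {w : ℝ × ℝ} {r : ℝ} : ‖w‖ ≤ r ↔ |w.1| ≤ r ∧ |w.2| ≤ r := by
  rw [Prod.norm_def, max_le_iff]; rfl

theorem saddlePoint_mem (hς : ς = 1 ∨ ς = -1) {d r : ℝ} {w : ℝ × ℝ} (hw : ‖w‖ ≤ r) :
    |(saddlePoint ς d w).1| ≤ r ∧ |(saddlePoint ς d w).2 - d| ≤ r := by
  rw [norm_prod_le_iff, abs_le, abs_le] at hw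
  obtain ⟨⟨h1, h2⟩, h3, h4⟩ := hw
  simp only [saddlePoint]
  rcases hς with rfl | rfl <;> constructor <;> rw [abs_le] <;> constructor <;> linarith

theorem IsSaddleSequence.contraction (h : IsSaddleSequence P c ς μ m M K ρ)
    {w w' : ℤ → ℝ × ℝ} (hw : ∀ n, ‖w n‖ ≤ ρ) (hw' : ∀ n, ‖w' n‖ ≤ ρ) {D : ℝ}
    (hD : ∀ n, ‖w n - w' n‖ ≤ D) (n : ℤ) :
    ‖saddleOperator P c ς w n - saddleOperator P c ς w' n‖ ≤ (1 - μ * m / 4) * D := by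
  have key : ∀ n, |saddleV ς (P n (saddlePoint ς (c n) (w n)) - P n (saddlePoint ς (c n) (w' n)))| ≤
      (1 - μ * m / 2) * D ∧
      |2 * ((w n).1 - (w' n).1) -
        saddleU ς (P n (saddlePoint ς (c n) (w n)) - P n (saddlePoint ς (c n) (w' n)))| ≤
      (1 - μ * m / 2) * D := by
    intro n
    obtain ⟨h1, h2⟩ := saddlePoint_mem h.sign (d := c n) (hw n)
    obtain ⟨h3, h4⟩ := saddlePoint_mem h.sign (d := c n) (hw' n)
    have hd := norm_prod_le_iff.1 (hD n)
    have hU : saddleU ς (saddlePoint ς (c n) (w n) - saddlePoint ς (c n) (w' n)) =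
        (w n).1 - (w' n).1 := by
      rw [saddleU_sub, saddleU_saddlePoint h.sign, saddleU_saddlePoint h.sign]; ring
    have hV : saddleV ς (saddlePoint ς (c n) (w n) - saddlePoint ς (c n) (w' n)) =
        (w n).2 - (w' n).2 := by
      rw [saddleV_sub, saddleV_saddlePoint h.sign, saddleV_saddlePoint h.sign]; ring
    have := h.abs_saddle_le h1 h2 h3 h4 (D := D) (by rw [hU]; exact hd.1) (by rw [hV]; exact hd.2)
    rwa [hU] at this
  have hD0 : 0 ≤ D := (norm_nonneg _).trans (hD 0)
  have hmD : 0 ≤ μ * m * D := mul_nonneg (mul_nonneg h.pos.le h.m_pos.le) hD0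
  rw [norm_prod_le_iff]
  simp only [saddleOperator, Prod.fst_sub, Prod.snd_sub]
  constructor
  · have h1 := (key n).2
    have h2 := (norm_prod_le_iff.1 (hD (n + 1))).1
    rw [saddleU_sub] at h1
    rw [Prod.fst_sub] at h2
    rw [abs_le] at *
    constructor <;> linarith [h1.1, h1.2, h2.1, h2.2]
  · have h1 := (key (n - 1)).1
    rw [saddleV_sub] at h1
    rw [abs_le] at *
    constructor <;> linarith [h1.1, h1.2]

theorem IsSaddleSequence.norm_operator_zero_le (h : IsSaddleSequence P c ς μ m M K ρ) (n : ℤ) :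
    ‖saddleOperator P c ς 0 n‖ ≤ K * μ ^ 2 := by
  have h1 := h.center n
  have h2 := h.center (n - 1)
  rw [sub_add_cancel] at h2
  have hp : ∀ d, saddlePoint ς d 0 = (0, d) := fun d => by simp [saddlePoint]
  rw [norm_prod_le_iff]
  simp only [saddleOperator, Pi.zero_apply, hp, saddleU, saddleV, Prod.fst_zero]
  have hs : ∀ a : ℝ, |ς * a| = |a| := fun a => by rcases h.sign with rfl | rfl <;> simp
  rw [← hs] at h1 h2
  constructor <;> rw [abs_le] <;>
    constructor <;>
    linarith [neg_abs_le (ς * (P n (0, c n)).1), le_abs_self (ς * (P n (0, c n)).1),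
      neg_abs_le ((P n (0, c n)).2 - c (n + 1)), le_abs_self ((P n (0, c n)).2 - c (n + 1)),
      neg_abs_le (ς * (P (n - 1) (0, c (n - 1))).1), le_abs_self (ς * (P (n - 1) (0, c (n - 1))).1),
      neg_abs_le ((P (n - 1) (0, c (n - 1))).2 - c n),
      le_abs_self ((P (n - 1) (0, c (n - 1))).2 - c n),
      abs_nonneg (ς * (P n (0, c n)).1), abs_nonneg ((P n (0, c n)).2 - c (n + 1))]

/-- Existence of an orbit near the centres. -/
theorem IsSaddleSequence.exists_orbit (h : IsSaddleSequence P c ς μ m M K ρ) {r : ℝ}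
    (hr : r ≤ ρ) (hr' : 4 * K * μ ≤ m * r) :
    ∃ x : ℤ → ℝ × ℝ, (∀ n, x (n + 1) = P n (x n)) ∧ ∀ n, |(x n).1| ≤ r ∧ |(x n).2 - c n| ≤ r := by
  have hμm : 0 < μ * m := mul_pos h.pos h.m_pos
  have hK := h.K_nonneg
  have hμ := h.pos
  have hr0 : 0 ≤ r := by
    have : 0 ≤ m * r := le_trans (by positivity) hr'
    exact nonneg_of_mul_nonneg_right this h.m_pos
  have h1m : 0 ≤ 1 - μ * m / 4 := by
    obtain ⟨b, hb, -⟩ := h.step 0 (0, c 0) (0, c 0) (by simpa using hr0.trans hr)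
      (by simpa using hr0.trans hr) (by simpa using hr0.trans hr) (by simpa using hr0.trans hr)
    have := h.small
    nlinarith [hb.1, hb.2]
  let B := Metric.closedBall (0 : ℝ × ℝ) r
  have hB : ∀ x : B, ‖(x : ℝ × ℝ)‖ ≤ r := fun x => mem_closedBall_zero_iff.1 x.2
  have hmaps : ∀ w : ℤ → B, ∀ n, saddleOperator P c ς (fun n => (w n : ℝ × ℝ)) n ∈ B := by
    intro w n
    rw [mem_closedBall_zero_iff]
    have h1 := h.contraction (w := fun n => (w n : ℝ × ℝ)) (w' := 0) (fun n => (hB _).trans hr)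
      (fun n => by simpa using hr0.trans hr) (D := r) (fun n => by simpa using hB (w n)) n
    have h2 := h.norm_operator_zero_le n
    have h3 := norm_add_le (saddleOperator P c ς (fun n => (w n : ℝ × ℝ)) n -
      saddleOperator P c ς 0 n) (saddleOperator P c ς 0 n)
    rw [sub_add_cancel] at h3
    have : K * μ ^ 2 ≤ μ * m / 4 * r := by
      calc K * μ ^ 2 = μ / 4 * (4 * K * μ) := by ring
        _ ≤ μ / 4 * (m * r) := by gcongr
        _ = _ := by ring
    linarith
  have hbdd : ∀ x y : B, dist x y ≤ 2 * r := fun x y => by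
    rw [Subtype.dist_eq, dist_eq_norm]
    linarith [norm_sub_le (x : ℝ × ℝ) y, hB x, hB y]
  let T : (ℤ →ᵇ B) → (ℤ →ᵇ B) := fun w =>
    BoundedContinuousFunction.mkOfBound ⟨fun n => ⟨_, hmaps w n⟩, continuous_of_discreteTopology⟩
      (2 * r) fun x y => hbdd _ _
  have hT : ∀ w n, (T w n : ℝ × ℝ) = saddleOperator P c ς (fun n => (w n : ℝ × ℝ)) n :=
    fun w n => rfl
  have hlip : LipschitzWith (1 - μ * m / 4).toNNReal T := by
    refine LipschitzWith.of_dist_le_mul fun w w' => ?_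
    rw [Real.coe_toNNReal _ h1m]
    have h0 : 0 ≤ (1 - μ * m / 4) * dist w w' := mul_nonneg h1m dist_nonneg
    refine (BoundedContinuousFunction.dist_le h0).2 fun n => ?_
    rw [Subtype.dist_eq, dist_eq_norm, hT, hT]
    refine h.contraction (fun n => (hB _).trans hr) (fun n => (hB _).trans hr) (fun n => ?_) n
    rw [← dist_eq_norm, ← Subtype.dist_eq]
    exact BoundedContinuousFunction.dist_coe_le_dist n
  have hcontr : ContractingWith (1 - μ * m / 4).toNNReal T := ⟨by
    rw [Real.toNNReal_lt_one]; linarith, hlip⟩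
  have : CompleteSpace B := Metric.isClosed_closedBall.completeSpace_coe
  have : Nonempty (ℤ →ᵇ B) :=
    ⟨BoundedContinuousFunction.const ℤ ⟨0, by simpa [B] using hr0⟩⟩
  set w := ContractingWith.fixedPoint T hcontr
  have hfix : T w = w := hcontr.fixedPoint_isFixedPt
  have hw : ∀ n, saddleOperator P c ς (fun n => (w n : ℝ × ℝ)) n = w n := fun n => by
    rw [← hT, hfix]
  refine ⟨fun n => saddlePoint ς (c n) (w n), fun n => ?_, fun n => saddlePoint_mem h.sign (hB _)⟩
  have h1 := congrArg Prod.fst (hw n)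
  have h2 := congrArg Prod.snd (hw (n + 1))
  simp only [saddleOperator, add_sub_cancel_right] at h1 h2
  set y := P n (saddlePoint ς (c n) (w n))
  have hs : ς * ς = 1 := by rcases h.sign with rfl | rfl <;> simp
  simp only [saddleU, saddleV] at h1 h2
  refine Prod.ext ?_ ?_
  · simp only [saddlePoint]
    have : ((w (n + 1) : ℝ × ℝ).1 + (w (n + 1) : ℝ × ℝ).2) / 2 = ς * y.1 := by linarith
    rw [this, ← mul_assoc, hs, one_mul]
  · simp only [saddlePoint]
    linarith

theorem le_div_of_improving {g : ℤ → ℝ} {D₀ q e : ℝ} (hD₀ : ∀ n, g n ≤ D₀) (hq : q < 1)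
    (h : ∀ D, (∀ n, g n ≤ D) → ∀ n, g n ≤ q * D + e) (n : ℤ) : g n ≤ e / (1 - q) := by
  have hb : BddAbove (range g) := ⟨D₀, by rintro _ ⟨n, rfl⟩; exact hD₀ n⟩
  have h1 := ciSup_le (h (⨆ n, g n) fun n => le_ciSup hb n)
  rw [le_div_iff₀ (by linarith)]
  have := le_ciSup hb n
  nlinarith

/-- Two approximate orbits near the centres are close to each other. -/
theorem IsSaddleSequence.norm_sub_le_of_pseudoOrbit (h : IsSaddleSequence P c ς μ m M K ρ)
    {x y : ℤ → ℝ × ℝ} {e : ℝ} (hx : ∀ n, ‖x (n + 1) - P n (x n)‖ ≤ e)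
    (hy : ∀ n, ‖y (n + 1) - P n (y n)‖ ≤ e)
    (hxρ : ∀ n, |(x n).1| ≤ ρ / 2 ∧ |(x n).2 - c n| ≤ ρ / 2)
    (hyρ : ∀ n, |(y n).1| ≤ ρ / 2 ∧ |(y n).2 - c n| ≤ ρ / 2) (n : ℤ) :
    ‖x n - y n‖ ≤ 16 * e / (μ * m) := by
  have he : 0 ≤ e := (norm_nonneg _).trans (hx 0)
  have hμm : 0 < μ * m := mul_pos h.pos h.m_pos
  let W : (ℤ → ℝ × ℝ) → ℤ → ℝ × ℝ := fun x n => (saddleU ς (x n) - c n, saddleV ς (x n) + c n)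
  have hWp : ∀ x n, saddlePoint ς (c n) (W x n) = x n := fun x n => by
    refine Prod.ext ?_ ?_ <;> rcases h.sign with hs | hs <;>
      simp only [W, saddlePoint, saddleU, saddleV, hs] <;> ring
  have habs : ∀ z : ℝ × ℝ, |saddleU ς z| ≤ |z.1| + |z.2| ∧ |saddleV ς z| ≤ |z.1| + |z.2| :=
    fun z => by
      have hs : |ς * z.1| = |z.1| := by rcases h.sign with rfl | rfl <;> simp
      rw [← hs]
      exact ⟨abs_add_le _ _, abs_sub _ _⟩
  have habs2 : ∀ z : ℝ × ℝ, |saddleU ς z| ≤ 2 * ‖z‖ ∧ |saddleV ς z| ≤ 2 * ‖z‖ := fun z => by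
    have h1 := habs z
    have h2 := norm_prod_le_iff.1 (le_refl ‖z‖)
    constructor <;> linarith [h1.1, h1.2, h2.1, h2.2]
  have hWρ : ∀ x : ℤ → ℝ × ℝ, (∀ n, |(x n).1| ≤ ρ / 2 ∧ |(x n).2 - c n| ≤ ρ / 2) →
      ∀ n, ‖W x n‖ ≤ ρ := fun x hx n => by
    have h1 := habs ((x n).1, (x n).2 - c n)
    simp only [saddleU, saddleV] at h1
    rw [norm_prod_le_iff]
    simp only [W, saddleU, saddleV]
    have e1 : ς * (x n).1 + (x n).2 - c n = ς * (x n).1 + ((x n).2 - c n) := by ring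
    have e2 : ς * (x n).1 - (x n).2 + c n = ς * (x n).1 - ((x n).2 - c n) := by ring
    rw [e1, e2]
    constructor <;> linarith [h1.1, h1.2, (hx n).1, (hx n).2]
  have hWfix : ∀ x : ℤ → ℝ × ℝ, (∀ n, ‖x (n + 1) - P n (x n)‖ ≤ e) →
      ∀ n, ‖saddleOperator P c ς (W x) n - W x n‖ ≤ 2 * e := fun x hx n => by
    have h1 := (habs2 (x (n + 1) - P n (x n))).1
    have h2 := (habs2 (x (n - 1 + 1) - P (n - 1) (x (n - 1)))).2
    have h3 := hx n
    have h4 := hx (n - 1)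
    rw [saddleU_sub, abs_le] at h1
    rw [saddleV_sub, abs_le] at h2
    rw [sub_add_cancel] at h2 h4
    rw [norm_prod_le_iff]
    simp only [saddleOperator, hWp, Prod.fst_sub, Prod.snd_sub]
    simp only [W]
    constructor <;> rw [abs_le] <;> constructor <;> linarith [h1.1, h1.2, h2.1, h2.2]
  have hmain : ∀ n, ‖W x n - W y n‖ ≤ 4 * e / (1 - (1 - μ * m / 4)) := by
    refine le_div_of_improving (D₀ := 2 * ρ) (fun n => ?_) (by linarith) fun D hD n => ?_
    · linarith [norm_sub_le (W x n) (W y n), hWρ x hxρ n, hWρ y hyρ n]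
    · have h1 := h.contraction (hWρ x hxρ) (hWρ y hyρ) hD n
      have h2 := hWfix x hx n
      have h3 := hWfix y hy n
      calc ‖W x n - W y n‖ = ‖(saddleOperator P c ς (W x) n - saddleOperator P c ς (W y) n) -
            (saddleOperator P c ς (W x) n - W x n) +
            (saddleOperator P c ς (W y) n - W y n)‖ := by congr 1; abel
        _ ≤ (1 - μ * m / 4) * D + 2 * e + 2 * e :=
            (norm_add_le _ _).trans (add_le_add ((norm_sub_le _ _).trans (add_le_add h1 h2)) h3)
        _ = _ := by ring
  have h1 := hmain n
  have h2 : 4 * e / (1 - (1 - μ * m / 4)) = 16 * e / (μ * m) := by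
    field_simp; ring
  rw [h2, norm_prod_le_iff] at h1
  rw [norm_prod_le_iff]
  simp only [W, saddleU, saddleV, Prod.fst_sub, Prod.snd_sub] at h1 ⊢
  have hs : |(x n).1 - (y n).1| = |ς * ((x n).1 - (y n).1)| := by
    rcases h.sign with rfl | rfl <;> simp [abs_sub_comm]
  rw [hs]
  rw [abs_le, abs_le] at h1
  constructor <;> rw [abs_le] <;> constructor <;> linarith [h1.1.1, h1.1.2, h1.2.1, h1.2.2]

end Saddle

end ImpactOscillator

namespace ImpactOscillator

open MeasureTheory Filter Topology

section UniformlyLipschitz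

variable {ι E : Type*} [PseudoMetricSpace E] {I : Set ι}

/-- A family of real functions, indexed by `I`, with common bound and Lipschitz constant. -/
def IsUniformlyLipschitz (I : Set ι) (g : ι → E → ℝ) : Prop :=
  ∃ C, ∀ i ∈ I, ∀ x y, |g i x| ≤ C ∧ |g i x - g i y| ≤ C * dist x y

namespace IsUniformlyLipschitz

theorem intro {g : ι → E → ℝ} {B C : ℝ} (hB : ∀ i ∈ I, ∀ x, |g i x| ≤ B)
    (hC : ∀ i ∈ I, ∀ x y, |g i x - g i y| ≤ C * dist x y) : IsUniformlyLipschitz I g :=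
  ⟨max B C, fun i hi x y => ⟨(hB i hi x).trans (le_max_left _ _), (hC i hi x y).trans
    (mul_le_mul_of_nonneg_right (le_max_right _ _) dist_nonneg)⟩⟩

theorem const {a : ι → ℝ} {C : ℝ} (h : ∀ i ∈ I, |a i| ≤ C) :
    IsUniformlyLipschitz I fun i (_ : E) => a i :=
  intro (B := C) (C := 0) (fun i hi _ => h i hi) (by simp)

theorem mono {g : ι → E → ℝ} {I' : Set ι} (hg : IsUniformlyLipschitz I g) (h : I' ⊆ I) :
    IsUniformlyLipschitz I' g := by
  obtain ⟨C, hC⟩ := hg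
  exact ⟨C, fun i hi => hC i (h hi)⟩

theorem congr {g h : ι → E → ℝ} (hg : IsUniformlyLipschitz I g) (he : ∀ i ∈ I, ∀ x, h i x = g i x) :
    IsUniformlyLipschitz I h := by
  obtain ⟨C, hC⟩ := hg
  exact ⟨C, fun i hi x y => by rw [he i hi, he i hi]; exact hC i hi x y⟩

theorem add {g h : ι → E → ℝ} (hg : IsUniformlyLipschitz I g) (hh : IsUniformlyLipschitz I h) :
    IsUniformlyLipschitz I fun i x => g i x + h i x := by
  obtain ⟨C, hC⟩ := hg
  obtain ⟨D, hD⟩ := hh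
  refine ⟨C + D, fun i hi x y => ⟨?_, ?_⟩⟩
  · exact (abs_add_le _ _).trans (add_le_add (hC i hi x y).1 (hD i hi x y).1)
  · rw [add_sub_add_comm, add_mul]
    exact (abs_add_le _ _).trans (add_le_add (hC i hi x y).2 (hD i hi x y).2)

theorem mul {g h : ι → E → ℝ} (hg : IsUniformlyLipschitz I g) (hh : IsUniformlyLipschitz I h) :
    IsUniformlyLipschitz I fun i x => g i x * h i x := by
  obtain ⟨C, hC⟩ := hg
  obtain ⟨D, hD⟩ := hh
  refine intro (B := C * D) (C := C * D + C * D) (fun i hi x => ?_) fun i hi x y => ?_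
  · rw [abs_mul]
    exact mul_le_mul (hC i hi x x).1 (hD i hi x x).1 (abs_nonneg _)
      ((abs_nonneg _).trans (hC i hi x x).1)
  · have e : g i x * h i x - g i y * h i y =
        (g i x - g i y) * h i x + g i y * (h i x - h i y) := by ring
    rw [e]
    refine (abs_add_le _ _).trans ?_
    rw [abs_mul, abs_mul]
    have hC0 : 0 ≤ C := (abs_nonneg _).trans (hC i hi x x).1
    calc _ ≤ C * dist x y * D + C * (D * dist x y) := by
          gcongr
          · exact (hC i hi x y).2
          · exact (hD i hi x y).1
          · exact (hC i hi y x).1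
          · exact (hD i hi x y).2
      _ = _ := by ring

theorem const_mul {g : ι → E → ℝ} (a : ℝ) (hg : IsUniformlyLipschitz I g) :
    IsUniformlyLipschitz I fun i x => a * g i x :=
  mul (const (C := |a|) fun _ _ => le_rfl) hg

theorem sub {g h : ι → E → ℝ} (hg : IsUniformlyLipschitz I g) (hh : IsUniformlyLipschitz I h) :
    IsUniformlyLipschitz I fun i x => g i x - h i x :=
  (hg.add (hh.const_mul (-1))).congr fun i _ x => by ring

theorem inv {g : ι → E → ℝ} {δ : ℝ} (hδ : 0 < δ) (hg : IsUniformlyLipschitz I g)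
    (h : ∀ i ∈ I, ∀ x, δ ≤ g i x) : IsUniformlyLipschitz I fun i x => (g i x)⁻¹ := by
  obtain ⟨C, hC⟩ := hg
  refine intro (B := δ⁻¹) (C := C / δ ^ 2) (fun i hi x => ?_) fun i hi x y => ?_
  · have := h i hi x
    rw [abs_inv, abs_of_pos (hδ.trans_le this)]
    gcongr
  · have hx := h i hi x
    have hy := h i hi y
    have hx0 := hδ.trans_le hx
    have hy0 := hδ.trans_le hy
    have e : (g i x)⁻¹ - (g i y)⁻¹ = -(g i x - g i y) / (g i x * g i y) := by
      field_simp; ring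
    rw [e, abs_div, abs_neg, abs_of_pos (mul_pos hx0 hy0)]
    calc |g i x - g i y| / (g i x * g i y) ≤ C * dist x y / (δ * δ) := by
          have h0 := (abs_nonneg _).trans (hC i hi x y).2
          gcongr
          exact (hC i hi x y).2
      _ = _ := by ring

end IsUniformlyLipschitz

end UniformlyLipschitz

/-- Truncation of a real number to `[-r, r]`. -/
def truncate (r x : ℝ) : ℝ := max (min r x) (-r)

theorem abs_truncate_le {r : ℝ} (hr : 0 ≤ r) (x : ℝ) : |truncate r x| ≤ r :=
  abs_le.2 ⟨le_max_right _ _, max_le (min_le_left _ _) (by linarith)⟩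

theorem abs_truncate_sub_le (r x y : ℝ) : |truncate r x - truncate r y| ≤ |x - y| :=
  (abs_max_sub_max_le_abs _ _ _).trans (by
    have := abs_min_sub_min_le_max r x r y
    simpa using this)

theorem truncate_eq_self {r x : ℝ} (h : |x| ≤ r) : truncate r x = x := by
  rw [abs_le] at h
  rw [truncate, min_eq_right h.2, max_eq_left h.1]

theorem continuous_truncate (r : ℝ) : Continuous (truncate r) := by
  unfold truncate; fun_prop

/-- Truncation of `(z, φ)` to the box `|z| ≤ 1`, `|φ| ≤ 8`. -/
def truncateBox (x : ℝ × ℝ) : ℝ × ℝ := (truncate 1 x.1, truncate 8 x.2)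

theorem truncateBox_eq_self {x : ℝ × ℝ} (h₁ : |x.1| ≤ 1) (h₂ : |x.2| ≤ 8) : truncateBox x = x := by
  rw [truncateBox, truncate_eq_self h₁, truncate_eq_self h₂]

/-- The ingredients of the near-resonance system: frequency `W`, the functions `κ_ψ` and
`(-Jκ)_J` on `[0, 2π]`, the force, and the constants. -/
structure PhaseModel where
  W : ℝ → ℝ
  K₁ : ℝ → ℝ → ℝ
  K₂ : ℝ → ℝ → ℝ
  f : ℝ → ℝ → ℝ
  k : ℝ
  γ : ℝ
  J₀ : ℝ
  w : ℝ
  L : ℝ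

namespace PhaseModel

noncomputable section

variable (S : PhaseModel)

/-- The regularity used for averaging. -/
structure IsRegular (C : ℝ) : Prop where
  k_pos : 0 < S.k
  J₀_pos : 0 < S.J₀
  L_pos : 0 < S.L
  L_eq : ∃ N : ℤ, S.L = N * (2 * π)
  W_J₀ : S.W S.J₀ = S.k
  W_lip : ∀ J ∈ Icc (S.J₀ / 2) (3 * S.J₀ / 2), ∀ J' ∈ Icc (S.J₀ / 2) (3 * S.J₀ / 2),
    |S.W J - S.W J'| ≤ C * |J - J'|
  W_taylor : ∀ J ∈ Icc (S.J₀ / 2) (3 * S.J₀ / 2), ∀ J' ∈ Icc (S.J₀ / 2) (3 * S.J₀ / 2),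
    |S.W J - S.W J' - S.w * (J - J')| ≤ C * (|J - S.J₀| + |J' - S.J₀|) * |J - J'|
  K₁_bound : ∀ θ ∈ Icc 0 (2 * π), ∀ J ∈ Icc (S.J₀ / 2) (3 * S.J₀ / 2), |S.K₁ θ J| ≤ C
  K₁_lip : ∀ θ ∈ Icc 0 (2 * π), ∀ J ∈ Icc (S.J₀ / 2) (3 * S.J₀ / 2),
    ∀ J' ∈ Icc (S.J₀ / 2) (3 * S.J₀ / 2), |S.K₁ θ J - S.K₁ θ J'| ≤ C * |J - J'|
  K₂_bound : ∀ θ ∈ Icc 0 (2 * π), ∀ J ∈ Icc (S.J₀ / 2) (3 * S.J₀ / 2), |S.K₂ θ J| ≤ C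
  K₂_lip : ∀ θ ∈ Icc 0 (2 * π), ∀ J ∈ Icc (S.J₀ / 2) (3 * S.J₀ / 2),
    ∀ J' ∈ Icc (S.J₀ / 2) (3 * S.J₀ / 2), |S.K₂ θ J - S.K₂ θ J'| ≤ C * |J - J'|
  W_cont : ContinuousOn S.W (Ioi 0)
  K₁_cont : ContinuousOn (fun y : ℝ × ℝ => S.K₁ y.1 y.2) (univ ×ˢ Ioi 0)
  K₂_cont : ContinuousOn (fun y : ℝ × ℝ => S.K₂ y.1 y.2) (univ ×ˢ Ioi 0)
  f_bound : ∀ t τ, |S.f t τ| ≤ C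
  f_diff : ∀ t τ t' τ' a b a' b', |S.f (t + a) (τ + b) - S.f t τ - (S.f (t' + a') (τ' + b') -
    S.f t' τ')| ≤ C * (|a - a'| + |b - b'|) + C * (|a| + |b|) * (|t - t'| + |τ - τ'|)
  f_periodic : ∀ t τ, S.f (t + S.L / S.k) τ = S.f t τ

/-- The impulse `J₀ + μ z`. -/
def impulse (μ : ℝ) (x : ℝ × ℝ) : ℝ := S.J₀ + μ * x.1

/-- The force as a function of the phase `ψ = φ + k t`. -/
def force (μ τ ψ : ℝ) (x : ℝ × ℝ) : ℝ :=
  S.f ((ψ - x.2) / S.k) (τ + μ ^ 2 * ((ψ - x.2) / S.k))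

/-- The phase reduced to `[0, 2π)`. -/
def angle (ψ : ℝ) : ℝ := toIcoMod two_pi_pos 0 ψ

/-- The force together with the damping. -/
def damped (μ τ ψ : ℝ) (x : ℝ × ℝ) : ℝ :=
  S.force μ τ ψ x + S.γ * S.impulse μ x * S.W (S.impulse μ x) * S.K₁ (angle ψ) (S.impulse μ x)

/-- The correction to the frequency. -/
def correction (μ τ ψ : ℝ) (x : ℝ × ℝ) : ℝ :=
  -4 * S.W (S.impulse μ x) * (S.impulse μ x)⁻¹ * S.damped μ τ ψ x *
    S.K₂ (angle ψ) (S.impulse μ x)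

/-- The velocity `dψ/dt`. -/
def phaseSpeed (μ τ ψ : ℝ) (x : ℝ × ℝ) : ℝ :=
  S.W (S.impulse μ x) + μ ^ 2 * S.correction μ τ ψ x

/-- The system with `ψ` as independent variable. -/
def field (μ τ ψ : ℝ) (x : ℝ × ℝ) : ℝ × ℝ :=
  (μ * (-4 * S.W (S.impulse μ x) * S.damped μ τ ψ x * S.K₁ (angle ψ) (S.impulse μ x)) /
      S.phaseSpeed μ τ ψ x,
    (S.phaseSpeed μ τ ψ x - S.k) / S.phaseSpeed μ τ ψ x)

/-- The field with truncated argument. -/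
def truncField (μ τ ψ : ℝ) (x : ℝ × ℝ) : ℝ × ℝ := S.field μ τ ψ (truncateBox x)

/-- First component of the leading term of the field. -/
def leadZ (τ ψ φ : ℝ) : ℝ :=
  -4 * (S.f ((ψ - φ) / S.k) τ + S.γ * S.J₀ * S.k * S.K₁ (angle ψ) S.J₀) * S.K₁ (angle ψ) S.J₀

/-- The leading term of the field. -/
def lead (τ ψ : ℝ) (x : ℝ × ℝ) : ℝ × ℝ := (S.leadZ τ ψ x.2, S.w / S.k * x.1)

variable {S} {C : ℝ}

theorem angle_mem (ψ : ℝ) : angle ψ ∈ Icc 0 (2 * π) := by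
  have h := toIcoMod_mem_Ico two_pi_pos 0 ψ
  rw [zero_add] at h
  exact ⟨h.1, h.2.le⟩

theorem angle_add_int (ψ : ℝ) (n : ℤ) : angle (ψ + n * (2 * π)) = angle ψ := by
  have := toIcoMod_add_zsmul two_pi_pos 0 ψ n
  rwa [zsmul_eq_mul] at this

theorem IsRegular.f_periodic_int (hS : S.IsRegular C) (t τ : ℝ) (n : ℤ) :
    S.f (t + n * (S.L / S.k)) τ = S.f t τ := by
  have h : Function.Periodic (fun t => S.f t τ) (S.L / S.k) := fun t => hS.f_periodic t τ
  exact (h.int_mul n) t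

theorem IsRegular.f_lip (hS : S.IsRegular C) (t τ t' τ' : ℝ) :
    |S.f t τ - S.f t' τ'| ≤ C * (|t - t'| + |τ - τ'|) := by
  have := hS.f_diff t' τ' t' τ' (t - t') (τ - τ') 0 0
  simpa using this

theorem IsRegular.nonneg (hS : S.IsRegular C) : 0 ≤ C := (abs_nonneg _).trans (hS.f_bound 0 0)

theorem IsRegular.angle_add (hS : S.IsRegular C) (ψ : ℝ) (n : ℤ) :
    angle (ψ + n * S.L) = angle ψ := by
  obtain ⟨N, hN⟩ := hS.L_eq
  rw [hN, ← mul_assoc, ← Int.cast_mul, angle_add_int]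

theorem IsRegular.force_add (hS : S.IsRegular C) (μ τ ψ : ℝ) (x : ℝ × ℝ) (n : ℤ) :
    S.force μ τ (ψ + n * S.L) x = S.force μ (τ + μ ^ 2 * (n * (S.L / S.k))) ψ x := by
  unfold force
  have : (ψ + n * S.L - x.2) / S.k = (ψ - x.2) / S.k + n * (S.L / S.k) := by ring
  rw [this, hS.f_periodic_int]
  congr 1
  ring

theorem IsRegular.phaseSpeed_add (hS : S.IsRegular C) (μ τ ψ : ℝ) (x : ℝ × ℝ) (n : ℤ) :
    S.phaseSpeed μ τ (ψ + n * S.L) x = S.phaseSpeed μ (τ + μ ^ 2 * (n * (S.L / S.k))) ψ x := by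
  simp only [phaseSpeed, correction, damped, hS.force_add, hS.angle_add]

theorem IsRegular.field_add (hS : S.IsRegular C) (μ τ ψ : ℝ) (x : ℝ × ℝ) (n : ℤ) :
    S.field μ τ (ψ + n * S.L) x = S.field μ (τ + μ ^ 2 * (n * (S.L / S.k))) ψ x := by
  simp only [field, hS.phaseSpeed_add, damped, hS.force_add, hS.angle_add]

theorem IsRegular.truncField_add (hS : S.IsRegular C) (μ τ ψ : ℝ) (x : ℝ × ℝ) (n : ℤ) :
    S.truncField μ τ (ψ + n * S.L) x = S.truncField μ (τ + μ ^ 2 * (n * (S.L / S.k))) ψ x :=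
  hS.field_add _ _ _ _ _

/-- Parameters `(μ, ψ)` with `0 < μ ≤ μ₁` and `ψ` in the basic period. -/
def params (S : PhaseModel) (μ₁ : ℝ) : Set (ℝ × ℝ) := {i | 0 < i.1 ∧ i.1 ≤ μ₁ ∧ i.2 ∈ Icc 0 S.L}

section Uniform

open IsUniformlyLipschitz

variable {μ₁ : ℝ}

theorem impulse_mem (hJ : 0 < S.J₀) {μ : ℝ} (h0 : 0 < μ) (h1 : μ ≤ S.J₀ / 2) {x : ℝ × ℝ}
    (hx : |x.1| ≤ 1) : S.impulse μ x ∈ Icc (S.J₀ / 2) (3 * S.J₀ / 2) := by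
  have : |μ * x.1| ≤ S.J₀ / 2 := by
    rw [abs_mul, abs_of_pos h0]
    calc μ * |x.1| ≤ S.J₀ / 2 * 1 := by gcongr
      _ = _ := mul_one _
  rw [abs_le] at this
  unfold impulse
  constructor <;> linarith [this.1, this.2]

theorem abs_truncateBox_fst (x : ℝ × ℝ) : |(truncateBox x).1| ≤ 1 := abs_truncate_le zero_le_one _

theorem abs_truncateBox_snd (x : ℝ × ℝ) : |(truncateBox x).2| ≤ 8 :=
  abs_truncate_le (by norm_num) _

theorem abs_truncateBox_fst_sub (x y : ℝ × (ℝ × ℝ)) :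
    |(truncateBox x.2).1 - (truncateBox y.2).1| ≤ dist x y :=
  (abs_truncate_sub_le _ _ _).trans
    ((le_max_left _ _).trans (le_max_right (dist x.1 y.1) (dist x.2 y.2)))

theorem abs_truncateBox_snd_sub (x y : ℝ × (ℝ × ℝ)) :
    |(truncateBox x.2).2 - (truncateBox y.2).2| ≤ dist x y :=
  (abs_truncate_sub_le _ _ _).trans
    ((le_max_right _ _).trans (le_max_right (dist x.1 y.1) (dist x.2 y.2)))

theorem abs_fst_sub_le (x y : ℝ × (ℝ × ℝ)) : |x.1 - y.1| ≤ dist x y := le_max_left _ _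

theorem abs_impulse_sub {μ : ℝ} (h0 : 0 < μ) (x y : ℝ × (ℝ × ℝ)) :
    |S.impulse μ (truncateBox x.2) - S.impulse μ (truncateBox y.2)| ≤ μ * dist x y := by
  unfold impulse
  rw [add_sub_add_left_eq_sub, ← mul_sub, abs_mul, abs_of_pos h0]
  gcongr
  exact abs_truncateBox_fst_sub x y

theorem abs_impulse_sub_J₀ {μ : ℝ} (h0 : 0 < μ) (x : ℝ × ℝ) :
    |S.impulse μ (truncateBox x) - S.J₀| ≤ μ := by
  unfold impulse
  rw [add_sub_cancel_left, abs_mul, abs_of_pos h0]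
  exact mul_le_of_le_one_right h0.le (abs_truncateBox_fst x)

theorem uniform_z : IsUniformlyLipschitz (S.params μ₁)
    fun _ (e : ℝ × (ℝ × ℝ)) => (truncateBox e.2).1 :=
  intro (B := 1) (C := 1) (fun _ _ _ => abs_truncateBox_fst _) fun _ _ x y => by
    rw [one_mul]; exact abs_truncateBox_fst_sub x y

theorem uniform_μ : IsUniformlyLipschitz (S.params μ₁) fun i (_ : ℝ × (ℝ × ℝ)) => i.1 :=
  const (C := μ₁) fun i hi => by rw [abs_of_pos hi.1]; exact hi.2.1

/-- Composition of a function of the impulse with the truncated impulse. -/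
theorem uniform_comp_impulse (hJ : 0 < S.J₀) (h1 : μ₁ ≤ S.J₀ / 2) (h2 : μ₁ ≤ 1)
    {g : ℝ → ℝ → ℝ} {B C : ℝ} (hC : 0 ≤ C)
    (hB : ∀ i ∈ S.params μ₁, ∀ J ∈ Icc (S.J₀ / 2) (3 * S.J₀ / 2), |g i.2 J| ≤ B)
    (hg : ∀ i ∈ S.params μ₁, ∀ J ∈ Icc (S.J₀ / 2) (3 * S.J₀ / 2),
      ∀ J' ∈ Icc (S.J₀ / 2) (3 * S.J₀ / 2), |g i.2 J - g i.2 J'| ≤ C * |J - J'|) :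
    IsUniformlyLipschitz (S.params μ₁)
      (fun i (e : ℝ × (ℝ × ℝ)) => g i.2 (S.impulse i.1 (truncateBox e.2))) ∧
    IsUniformlyLipschitz (S.params μ₁)
      (fun i (e : ℝ × (ℝ × ℝ)) =>
        (g i.2 (S.impulse i.1 (truncateBox e.2)) - g i.2 S.J₀) / i.1) := by
  have hmem : ∀ i ∈ S.params μ₁, ∀ e : ℝ × (ℝ × ℝ),
      S.impulse i.1 (truncateBox e.2) ∈ Icc (S.J₀ / 2) (3 * S.J₀ / 2) := fun i hi e =>
    impulse_mem hJ hi.1 (hi.2.1.trans h1) (abs_truncateBox_fst _)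
  have hJ₀ : S.J₀ ∈ Icc (S.J₀ / 2) (3 * S.J₀ / 2) := by constructor <;> linarith
  have hl : ∀ i ∈ S.params μ₁, ∀ x y : ℝ × (ℝ × ℝ),
      |g i.2 (S.impulse i.1 (truncateBox x.2)) - g i.2 (S.impulse i.1 (truncateBox y.2))| ≤
        C * (i.1 * dist x y) := fun i hi x y =>
    (hg i hi _ (hmem i hi x) _ (hmem i hi y)).trans (by gcongr; exact abs_impulse_sub hi.1 x y)
  constructor
  · refine intro (B := B) (C := C) (fun i hi x => hB i hi _ (hmem i hi x)) fun i hi x y => ?_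
    refine (hl i hi x y).trans ?_
    gcongr
    exact mul_le_of_le_one_left dist_nonneg (hi.2.1.trans h2)
  · refine intro (B := C) (C := C) (fun i hi x => ?_) fun i hi x y => ?_
    · rw [abs_div, abs_of_pos hi.1, div_le_iff₀ hi.1]
      refine (hg i hi _ (hmem i hi x) _ hJ₀).trans ?_
      gcongr
      exact abs_impulse_sub_J₀ hi.1 _
    · rw [← sub_div, sub_sub_sub_cancel_right, abs_div, abs_of_pos hi.1, div_le_iff₀ hi.1]
      refine (hl i hi x y).trans (le_of_eq ?_)
      ring

theorem IsRegular.abs_W_le (hS : S.IsRegular C) {J : ℝ}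
    (hJ : J ∈ Icc (S.J₀ / 2) (3 * S.J₀ / 2)) : |S.W J| ≤ S.k + C * S.J₀ := by
  have h1 := hS.W_lip J hJ S.J₀ (by constructor <;> linarith [hS.J₀_pos])
  have h2 : |J - S.J₀| ≤ S.J₀ :=
    abs_le.2 ⟨by linarith [hJ.1, hS.J₀_pos], by linarith [hJ.2, hS.J₀_pos]⟩
  have h3 : C * |J - S.J₀| ≤ C * S.J₀ := mul_le_mul_of_nonneg_left h2 hS.nonneg
  have h4 := abs_sub_abs_le_abs_sub (S.W J) (S.W S.J₀)
  rw [hS.W_J₀, abs_of_pos hS.k_pos] at h4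
  rw [hS.W_J₀] at h1
  linarith

theorem IsRegular.uniform_W_taylor (hS : S.IsRegular C) (h1 : μ₁ ≤ S.J₀ / 2) :
    IsUniformlyLipschitz (S.params μ₁) fun i (e : ℝ × (ℝ × ℝ)) =>
      (S.W (S.impulse i.1 (truncateBox e.2)) - S.k - i.1 * S.w * (truncateBox e.2).1) /
        i.1 ^ 2 := by
  have hC := hS.nonneg
  have hmem : ∀ i ∈ S.params μ₁, ∀ e : ℝ × (ℝ × ℝ),
      S.impulse i.1 (truncateBox e.2) ∈ Icc (S.J₀ / 2) (3 * S.J₀ / 2) := fun i hi e =>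
    impulse_mem hS.J₀_pos hi.1 (hi.2.1.trans h1) (abs_truncateBox_fst _)
  have hJ₀ : S.J₀ ∈ Icc (S.J₀ / 2) (3 * S.J₀ / 2) := by constructor <;> linarith [hS.J₀_pos]
  refine intro (B := C) (C := 2 * C) (fun i hi x => ?_) fun i hi x y => ?_
  · have hi0 := hi.1
    rw [abs_div, abs_of_pos (pow_pos hi.1 2), div_le_iff₀ (pow_pos hi.1 2)]
    have h := hS.W_taylor _ (hmem i hi x) _ hJ₀
    rw [hS.W_J₀, sub_self, abs_zero, add_zero] at h
    have e : S.impulse i.1 (truncateBox x.2) - S.J₀ = i.1 * (truncateBox x.2).1 := by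
      simp [impulse]
    have h2 := abs_impulse_sub_J₀ (S := S) hi.1 x.2
    calc _ = |S.W (S.impulse i.1 (truncateBox x.2)) - S.k -
          S.w * (S.impulse i.1 (truncateBox x.2) - S.J₀)| := by rw [e]; congr 1; ring
      _ ≤ _ := h
      _ ≤ C * i.1 * i.1 := by gcongr
      _ = _ := by ring
  · have hi0 := hi.1
    rw [← sub_div, abs_div, abs_of_pos (pow_pos hi.1 2), div_le_iff₀ (pow_pos hi.1 2)]
    have h := hS.W_taylor _ (hmem i hi x) _ (hmem i hi y)
    have e : S.impulse i.1 (truncateBox x.2) - S.impulse i.1 (truncateBox y.2) =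
        i.1 * (truncateBox x.2).1 - i.1 * (truncateBox y.2).1 := by
      simp [impulse]
    have h2 := abs_impulse_sub_J₀ (S := S) hi.1 x.2
    have h3 := abs_impulse_sub_J₀ (S := S) hi.1 y.2
    have h4 := abs_impulse_sub (S := S) hi.1 x y
    calc _ = |S.W (S.impulse i.1 (truncateBox x.2)) - S.W (S.impulse i.1 (truncateBox y.2)) -
          S.w * (S.impulse i.1 (truncateBox x.2) - S.impulse i.1 (truncateBox y.2))| := by
            rw [e]; congr 1; ring
      _ ≤ _ := h
      _ ≤ C * (i.1 + i.1) * (i.1 * dist x y) := by gcongr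
      _ = _ := by ring

theorem abs_time_sub (hk : 0 < S.k) (ψ : ℝ) (x y : ℝ × (ℝ × ℝ)) :
    |(ψ - (truncateBox x.2).2) / S.k - (ψ - (truncateBox y.2).2) / S.k| ≤ dist x y / S.k := by
  rw [← sub_div, sub_sub_sub_cancel_left, abs_div, abs_of_pos hk]
  gcongr
  rw [abs_sub_comm]
  exact abs_truncateBox_snd_sub x y

theorem IsRegular.uniform_force₀ (hS : S.IsRegular C) :
    IsUniformlyLipschitz (S.params μ₁) fun i (e : ℝ × (ℝ × ℝ)) =>
      S.f ((i.2 - (truncateBox e.2).2) / S.k) e.1 := by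
  have hC := hS.nonneg
  refine intro (B := C) (C := C * (1 / S.k + 1)) (fun i hi x => hS.f_bound _ _) fun i hi x y => ?_
  refine (hS.f_lip _ _ _ _).trans ?_
  calc _ ≤ C * (dist x y / S.k + dist x y) := by
        gcongr
        · exact abs_time_sub hS.k_pos _ x y
        · exact abs_fst_sub_le x y
    _ = _ := by ring

theorem IsRegular.uniform_force_sub (hS : S.IsRegular C) (h2 : μ₁ ≤ 1) :
    IsUniformlyLipschitz (S.params μ₁) fun i (e : ℝ × (ℝ × ℝ)) =>
      (S.force i.1 e.1 i.2 (truncateBox e.2) -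
        S.f ((i.2 - (truncateBox e.2).2) / S.k) e.1) / i.1 := by
  have hC := hS.nonneg
  have hk := hS.k_pos
  have ht : ∀ i ∈ S.params μ₁, ∀ e : ℝ × (ℝ × ℝ),
      |i.1 ^ 2 * ((i.2 - (truncateBox e.2).2) / S.k)| ≤ i.1 * ((S.L + 8) / S.k) := by
    intro i hi e
    have hi0 := hi.1
    have h3 : |i.2 - (truncateBox e.2).2| ≤ S.L + 8 := by
      refine (abs_sub _ _).trans (add_le_add ?_ (abs_truncateBox_snd _))
      rw [abs_of_nonneg hi.2.2.1]; exact hi.2.2.2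
    rw [abs_mul, abs_of_pos (pow_pos hi.1 2), abs_div, abs_of_pos hk]
    gcongr
    rw [sq]
    exact mul_le_of_le_one_left hi.1.le (hi.2.1.trans h2)
  refine intro (B := C * ((S.L + 8) / S.k))
    (C := C * (1 / S.k) + C * ((S.L + 8) / S.k) * (1 / S.k + 1)) (fun i hi x => ?_)
    fun i hi x y => ?_
  · rw [abs_div, abs_of_pos hi.1, div_le_iff₀ hi.1]
    refine (hS.f_lip _ _ _ _).trans ?_
    rw [sub_self, abs_zero, zero_add, add_sub_cancel_left]
    calc _ ≤ C * (i.1 * ((S.L + 8) / S.k)) := by gcongr; exact ht i hi x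
      _ = _ := by ring
  · have hi0 := hi.1
    have hd := abs_time_sub hk i.2 x y
    rw [← sub_div, abs_div, abs_of_pos hi.1, div_le_iff₀ hi.1]
    have := hS.f_diff ((i.2 - (truncateBox x.2).2) / S.k) x.1 ((i.2 - (truncateBox y.2).2) / S.k)
      y.1 0 (i.1 ^ 2 * ((i.2 - (truncateBox x.2).2) / S.k)) 0
      (i.1 ^ 2 * ((i.2 - (truncateBox y.2).2) / S.k))
    rw [add_zero, add_zero, sub_self, abs_zero, zero_add, zero_add, ← mul_sub, abs_mul,
      abs_of_pos (pow_pos hi.1 2)] at this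
    refine this.trans ?_
    calc _ ≤ C * (i.1 * (dist x y / S.k)) +
          C * (i.1 * ((S.L + 8) / S.k)) * (dist x y / S.k + dist x y) := by
          gcongr
          · rw [sq]
            exact mul_le_of_le_one_left hi.1.le (hi.2.1.trans h2)
          · have := hS.L_pos
            positivity
          · exact ht i hi x
          · exact abs_fst_sub_le x y
      _ = _ := by ring

/-- Remainder of the field after its leading term. -/
def remainder (S : PhaseModel) (μ τ ψ : ℝ) (x : ℝ × ℝ) : ℝ × ℝ :=
  (((S.truncField μ τ ψ x).1 - μ * (S.lead τ ψ (truncateBox x)).1) / μ ^ 2,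
    ((S.truncField μ τ ψ x).2 - μ * (S.lead τ ψ (truncateBox x)).2) / μ ^ 2)

theorem field_fst_identity {μ W n g g₀ K K₀ : ℝ} (hμ : μ ≠ 0) (hD : W + μ ^ 2 * n ≠ 0) :
    (μ * (-4 * W * g * K) / (W + μ ^ 2 * n) - μ * (-4 * g₀ * K₀)) / μ ^ 2 =
      -4 * ((g - g₀) / μ * K + g₀ * ((K - K₀) / μ) - μ * n * g * K * (W + μ ^ 2 * n)⁻¹) := by
  field_simp
  ring

theorem field_snd_identity {μ W n k w z : ℝ} (hμ : μ ≠ 0) (hk : k ≠ 0)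
    (hD : W + μ ^ 2 * n ≠ 0) :
    ((W + μ ^ 2 * n - k) / (W + μ ^ 2 * n) - μ * (w / k * z)) / μ ^ 2 =
      k⁻¹ * ((W - k - μ * w * z) / μ ^ 2) + k⁻¹ * n -
        k⁻¹ * (((W - k) / μ + μ * n) * ((W - k) / μ + μ * n) * (W + μ ^ 2 * n)⁻¹) := by
  field_simp
  ring

theorem damped_identity {μ F F₀ γ z W K K₀ k J₀ : ℝ} (hμ : μ ≠ 0) :
    (F + γ * (J₀ + μ * z) * W * K - (F₀ + γ * J₀ * k * K₀)) / μ =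
      (F - F₀) / μ + γ * (z * W * K + J₀ * (((W - k) / μ) * K) + J₀ * k * ((K - K₀) / μ)) := by
  field_simp
  ring

/-- The leading term and the remainder are uniformly bounded and Lipschitz, and the phase speed
stays near `k`. -/
theorem IsRegular.uniform_remainder (hS : S.IsRegular C) :
    ∃ μ₁ > 0, μ₁ ≤ S.J₀ / 2 ∧ μ₁ ≤ 1 ∧
      (∀ i ∈ S.params μ₁, ∀ e : ℝ × (ℝ × ℝ),
        |S.phaseSpeed i.1 e.1 i.2 (truncateBox e.2) - S.k| ≤ S.k / 2) ∧
      IsUniformlyLipschitz (S.params μ₁)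
        (fun i (e : ℝ × (ℝ × ℝ)) => (S.remainder i.1 e.1 i.2 e.2).1) ∧
      IsUniformlyLipschitz (S.params μ₁)
        (fun i (e : ℝ × (ℝ × ℝ)) => (S.remainder i.1 e.1 i.2 e.2).2) ∧
      IsUniformlyLipschitz (S.params μ₁)
        (fun i (e : ℝ × (ℝ × ℝ)) => (S.lead e.1 i.2 (truncateBox e.2)).1) ∧
      IsUniformlyLipschitz (S.params μ₁)
        (fun i (e : ℝ × (ℝ × ℝ)) => (S.lead e.1 i.2 (truncateBox e.2)).2) := by
  have hC := hS.nonneg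
  have hk := hS.k_pos
  have hJ := hS.J₀_pos
  obtain ⟨m, hm0, hm1, hm2⟩ : ∃ m : ℝ, 0 < m ∧ m ≤ S.J₀ / 2 ∧ m ≤ 1 :=
    ⟨min (S.J₀ / 2) 1, by positivity, min_le_left _ _, min_le_right _ _⟩
  have hJ₀ : S.J₀ ∈ Icc (S.J₀ / 2) (3 * S.J₀ / 2) := by constructor <;> linarith
  obtain ⟨uW, uW'⟩ := uniform_comp_impulse (S := S) (μ₁ := m) hJ hm1 hm2 (g := fun _ J => S.W J) hC
    (fun i _ J hJ => hS.abs_W_le hJ) (fun i _ J hJ J' hJ' => hS.W_lip J hJ J' hJ')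
  obtain ⟨uK, uK'⟩ := uniform_comp_impulse (S := S) (μ₁ := m) hJ hm1 hm2
    (g := fun ψ J => S.K₁ (angle ψ) J) hC
    (fun i _ J hJ => hS.K₁_bound _ (angle_mem _) _ hJ)
    (fun i _ J hJ J' hJ' => hS.K₁_lip _ (angle_mem _) J hJ J' hJ')
  obtain ⟨uK₂, -⟩ := uniform_comp_impulse (S := S) (μ₁ := m) hJ hm1 hm2
    (g := fun ψ J => S.K₂ (angle ψ) J) hC
    (fun i _ J hJ => hS.K₂_bound _ (angle_mem _) _ hJ)
    (fun i _ J hJ J' hJ' => hS.K₂_lip _ (angle_mem _) J hJ J' hJ')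
  obtain ⟨uJ, -⟩ := uniform_comp_impulse (S := S) (μ₁ := m) hJ hm1 hm2
    (g := fun _ J => J) (B := 3 * S.J₀ / 2) (C := 1) zero_le_one
    (fun i _ J hJ => abs_le.2 ⟨by linarith [hJ.1], hJ.2⟩) (by simp)
  have uJinv := uJ.inv (δ := S.J₀ / 2) (by positivity) fun i hi e =>
    (impulse_mem hJ hi.1 (hi.2.1.trans hm1) (abs_truncateBox_fst _)).1
  have uK₀ : IsUniformlyLipschitz (S.params m)
      fun i (_ : ℝ × (ℝ × ℝ)) => S.K₁ (angle i.2) S.J₀ :=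
    const (C := C) fun i _ => hS.K₁_bound _ (angle_mem _) _ hJ₀
  have uF₀ := hS.uniform_force₀ (μ₁ := m)
  have uF' := hS.uniform_force_sub hm2
  have uμ : IsUniformlyLipschitz (S.params m) fun i (_ : ℝ × (ℝ × ℝ)) => i.1 := uniform_μ
  have uz : IsUniformlyLipschitz (S.params m) fun _ (e : ℝ × (ℝ × ℝ)) => (truncateBox e.2).1 :=
    uniform_z
  have uT := hS.uniform_W_taylor hm1
  rw [hS.W_J₀] at uW'
  have uF : IsUniformlyLipschitz (S.params m) fun i (e : ℝ × (ℝ × ℝ)) =>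
      S.force i.1 e.1 i.2 (truncateBox e.2) :=
    (uF₀.add (uμ.mul uF')).congr fun i hi e => by
      have := hi.1.ne'
      field_simp
      ring
  have ug : IsUniformlyLipschitz (S.params m) fun i (e : ℝ × (ℝ × ℝ)) =>
      S.damped i.1 e.1 i.2 (truncateBox e.2) :=
    (uF.add (((uJ.const_mul S.γ).mul uW).mul uK)).congr fun i hi e => rfl
  have ug₀ := uF₀.add (uK₀.const_mul (S.γ * S.J₀ * S.k))
  have ug' : IsUniformlyLipschitz (S.params m) fun i (e : ℝ × (ℝ × ℝ)) =>
      (S.damped i.1 e.1 i.2 (truncateBox e.2) - (S.f ((i.2 - (truncateBox e.2).2) / S.k) e.1 +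
        S.γ * S.J₀ * S.k * S.K₁ (angle i.2) S.J₀)) / i.1 :=
    (uF'.add ((((uz.mul uW).mul uK).add
      (((uW'.mul uK).const_mul S.J₀).add (uK'.const_mul (S.J₀ * S.k)))).const_mul S.γ)).congr
      fun i hi e => by
        have := damped_identity (F := S.force i.1 e.1 i.2 (truncateBox e.2))
          (F₀ := S.f ((i.2 - (truncateBox e.2).2) / S.k) e.1) (γ := S.γ)
          (z := (truncateBox e.2).1) (W := S.W (S.impulse i.1 (truncateBox e.2)))
          (K := S.K₁ (angle i.2) (S.impulse i.1 (truncateBox e.2)))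
          (K₀ := S.K₁ (angle i.2) S.J₀) (k := S.k) (J₀ := S.J₀) hi.1.ne'
        rw [add_assoc (_ * _ * _)] at this
        exact this
  have un : IsUniformlyLipschitz (S.params m) fun i (e : ℝ × (ℝ × ℝ)) =>
      S.correction i.1 e.1 i.2 (truncateBox e.2) :=
    ((((uW.const_mul (-4)).mul uJinv).mul ug).mul uK₂).congr fun i hi e => rfl
  have uD' := uW'.add (uμ.mul un)
  have uD : IsUniformlyLipschitz (S.params m) fun i (e : ℝ × (ℝ × ℝ)) =>
      S.phaseSpeed i.1 e.1 i.2 (truncateBox e.2) :=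
    (uW.add ((uμ.mul uμ).mul un)).congr fun i hi e => by rw [phaseSpeed, sq]
  obtain ⟨B, hB⟩ := uD'
  obtain ⟨m', hm'0, hm', hm'B⟩ : ∃ m' : ℝ, 0 < m' ∧ m' ≤ m ∧ m' * B ≤ S.k / 2 := by
    refine ⟨min m (S.k / (2 * (|B| + 1))), by positivity, min_le_left _ _, ?_⟩
    have h1 : B ≤ |B| + 1 := (le_abs_self B).trans (by linarith)
    calc min m (S.k / (2 * (|B| + 1))) * B ≤ min m (S.k / (2 * (|B| + 1))) * (|B| + 1) := by gcongr
      _ ≤ S.k / (2 * (|B| + 1)) * (|B| + 1) := by gcongr; exact min_le_right _ _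
      _ = _ := by field_simp
  have hsub : S.params m' ⊆ S.params m := fun i hi => ⟨hi.1, hi.2.1.trans hm', hi.2.2⟩
  have hspeed : ∀ i ∈ S.params m', ∀ e : ℝ × (ℝ × ℝ),
      |S.phaseSpeed i.1 e.1 i.2 (truncateBox e.2) - S.k| ≤ S.k / 2 := by
    intro i hi e
    have h1 := (hB i (hsub hi) e e).1
    have h2 : S.phaseSpeed i.1 e.1 i.2 (truncateBox e.2) - S.k =
        i.1 * ((S.W (S.impulse i.1 (truncateBox e.2)) - S.k) / i.1 +
          i.1 * S.correction i.1 e.1 i.2 (truncateBox e.2)) := by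
      have := hi.1.ne'
      rw [phaseSpeed]
      field_simp
      ring
    have hB0 : 0 ≤ B := (abs_nonneg _).trans h1
    rw [h2, abs_mul, abs_of_pos hi.1]
    calc _ ≤ m' * B := mul_le_mul hi.2.1 h1 (abs_nonneg _) hm'0.le
      _ ≤ _ := hm'B
  have hlow : ∀ i ∈ S.params m', ∀ e : ℝ × (ℝ × ℝ),
      S.k / 2 ≤ S.phaseSpeed i.1 e.1 i.2 (truncateBox e.2) := fun i hi e => by
    have := (abs_le.1 (hspeed i hi e)).1
    linarith
  have uDinv := (uD.mono hsub).inv (half_pos hk) hlow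
  have uD' : IsUniformlyLipschitz (S.params m) fun i (e : ℝ × (ℝ × ℝ)) =>
      (S.W (S.impulse i.1 (truncateBox e.2)) - S.k) / i.1 +
          i.1 * S.correction i.1 e.1 i.2 (truncateBox e.2) := ⟨B, hB⟩
  refine ⟨m', hm'0, hm'.trans hm1, hm'.trans hm2, hspeed, ?_, ?_, ?_, ?_⟩
  · refine ((((((ug'.mul uK).add (ug₀.mul uK')).mono hsub).sub
      ((((uμ.mul un).mul ug).mul uK).mono hsub |>.mul uDinv)).const_mul (-4))).congr
      fun i hi e => ?_
    have hD : S.phaseSpeed i.1 e.1 i.2 (truncateBox e.2) ≠ 0 := by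
      have := hlow i hi e
      intro h
      linarith
    exact field_fst_identity hi.1.ne' hD
  · refine ((((uT.mono hsub).const_mul S.k⁻¹).add ((un.mono hsub).const_mul S.k⁻¹)).sub
      ((((uD'.mul uD').mono hsub).mul uDinv).const_mul S.k⁻¹)).congr fun i hi e => ?_
    have hD : S.phaseSpeed i.1 e.1 i.2 (truncateBox e.2) ≠ 0 := by
      have := hlow i hi e
      intro h
      linarith
    exact field_snd_identity hi.1.ne' hk.ne' hD
  · exact (((ug₀.const_mul (-4)).mul uK₀).mono hsub).congr fun i hi e => rfl
  · exact ((uz.const_mul (S.w / S.k)).mono hsub).congr fun i hi e => rfl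

end Uniform

end

end PhaseModel

end ImpactOscillator

namespace ImpactOscillator

open MeasureTheory Filter Topology

/-- The phases of the impacts. -/
def impactPhases : Set ℝ := range fun n : ℤ => (n : ℝ) * (2 * π)

theorem countable_impactPhases : impactPhases.Countable := countable_range _

theorem isClosed_impactPhases : IsClosed impactPhases := by
  have h : impactPhases = (fun x : ℝ => x / (2 * π)) ⁻¹' range ((↑) : ℤ → ℝ) := by
    ext x
    simp only [impactPhases, mem_range, mem_preimage]
    refine exists_congr fun n => ?_
    rw [eq_div_iff two_pi_pos.ne']
  rw [h]
  exact Int.isClosedEmbedding_coe_real.isClosed_range.preimage (by fun_prop)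

theorem not_modEq_of_notMem_impactPhases {ψ : ℝ} (h : ψ ∉ impactPhases) :
    ¬ψ ≡ 0 [PMOD (2 * π)] := by
  intro h'
  obtain ⟨n, hn⟩ := (AddCommGroup.modEq_iff_zsmul).1 h'
  refine h ⟨-n, ?_⟩
  rw [zsmul_eq_mul] at hn
  push_cast
  linarith

theorem aestronglyMeasurable_of_continuousAt {E : Type*} [TopologicalSpace E]
    [TopologicalSpace.PseudoMetrizableSpace E] [SecondCountableTopologyEither ℝ E]
    {g : ℝ → E} {s : Set ℝ} (hs : s.Countable) (hg : ∀ x ∉ s, ContinuousAt g x) :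
    AEStronglyMeasurable g volume := by
  have h1 : AEStronglyMeasurable g (volume.restrict sᶜ) :=
    ContinuousOn.aestronglyMeasurable (fun x hx => (hg x hx).continuousWithinAt)
      hs.measurableSet.compl
  rwa [Measure.restrict_eq_self_of_ae_mem (by
    exact compl_mem_ae_iff.2 (hs.measure_zero _))] at h1

namespace PhaseModel

noncomputable section

variable {S : PhaseModel} {C : ℝ}

theorem continuousAt_angle {ψ : ℝ} (h : ψ ∉ impactPhases) : ContinuousAt angle ψ :=
  continuousAt_toIcoMod two_pi_pos 0 (not_modEq_of_notMem_impactPhases h)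

theorem IsRegular.continuous_f (hS : S.IsRegular C) : Continuous fun y : ℝ × ℝ => S.f y.1 y.2 := by
  have hC := hS.nonneg
  have : LipschitzWith (2 * C).toNNReal fun y : ℝ × ℝ => S.f y.1 y.2 := by
    refine LipschitzWith.of_dist_le_mul fun x y => ?_
    rw [Real.coe_toNNReal _ (by positivity), Real.dist_eq]
    refine (hS.f_lip _ _ _ _).trans ?_
    have h1 : |x.1 - y.1| ≤ dist x y := le_max_left _ _
    have h2 : |x.2 - y.2| ≤ dist x y := le_max_right _ _
    nlinarith
  exact this.continuous

theorem IsRegular.continuousAt_phaseSpeed (hS : S.IsRegular C) {μ τ ψ : ℝ} {X : ℝ → ℝ × ℝ}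
    (hψ : ψ ∉ impactPhases) (hX : ContinuousAt X ψ) (hpos : 0 < S.impulse μ (X ψ)) :
    ContinuousAt (fun s => S.phaseSpeed μ τ s (X s)) ψ ∧
      ContinuousAt (fun s => -4 * S.W (S.impulse μ (X s)) * S.damped μ τ s (X s) *
        S.K₁ (angle s) (S.impulse μ (X s))) ψ := by
  have hJ : ContinuousAt (fun s => S.impulse μ (X s)) ψ := by
    unfold impulse
    exact continuousAt_const.add (continuousAt_const.mul hX.fst)
  have hopen : IsOpen ((univ : Set ℝ) ×ˢ Ioi (0 : ℝ)) := isOpen_univ.prod isOpen_Ioi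
  have hW : ContinuousAt (fun s => S.W (S.impulse μ (X s))) ψ :=
    ContinuousAt.comp (f := fun s => S.impulse μ (X s))
      (hS.W_cont.continuousAt (Ioi_mem_nhds hpos)) hJ
  have hpair := (continuousAt_angle hψ).prodMk hJ
  have hK₁ : ContinuousAt (fun s => S.K₁ (angle s) (S.impulse μ (X s))) ψ :=
    ContinuousAt.comp (f := fun s => (angle s, S.impulse μ (X s)))
      (hS.K₁_cont.continuousAt (hopen.mem_nhds ⟨mem_univ _, hpos⟩)) hpair
  have hK₂ : ContinuousAt (fun s => S.K₂ (angle s) (S.impulse μ (X s))) ψ :=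
    ContinuousAt.comp (f := fun s => (angle s, S.impulse μ (X s)))
      (hS.K₂_cont.continuousAt (hopen.mem_nhds ⟨mem_univ _, hpos⟩)) hpair
  have ht : ContinuousAt (fun s => (s - (X s).2) / S.k) ψ :=
    (continuousAt_id.sub hX.snd).div_const _
  have hF : ContinuousAt (fun s => S.force μ τ s (X s)) ψ :=
    ContinuousAt.comp (f := fun s => ((s - (X s).2) / S.k, τ + μ ^ 2 * ((s - (X s).2) / S.k)))
      hS.continuous_f.continuousAt (ht.prodMk (continuousAt_const.add (continuousAt_const.mul ht)))
  have hg : ContinuousAt (fun s => S.damped μ τ s (X s)) ψ :=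
    hF.add (((continuousAt_const.mul hJ).mul hW).mul hK₁)
  have hn : ContinuousAt (fun s => S.correction μ τ s (X s)) ψ :=
    ((((continuousAt_const.mul hW).mul (hJ.inv₀ hpos.ne')).mul hg).mul hK₂)
  exact ⟨hW.add (continuousAt_const.mul hn), ((continuousAt_const.mul hW).mul hg).mul hK₁⟩

theorem IsRegular.continuousAt_field (hS : S.IsRegular C) {μ τ ψ : ℝ} {X : ℝ → ℝ × ℝ}
    (hψ : ψ ∉ impactPhases) (hX : ContinuousAt X ψ) (hpos : 0 < S.impulse μ (X ψ))
    (hD : S.phaseSpeed μ τ ψ (X ψ) ≠ 0) :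
    ContinuousAt (fun s => S.field μ τ s (X s)) ψ := by
  obtain ⟨h1, h2⟩ := hS.continuousAt_phaseSpeed (τ := τ) hψ hX hpos
  exact ((continuousAt_const.mul h2).div h1 hD).prodMk ((h1.sub continuousAt_const).div h1 hD)

/-- Estimates for the truncated field that hold for all small `μ`. -/
structure HasBounds (S : PhaseModel) (μ C : ℝ) : Prop where
  pos : 0 < μ
  le_J₀ : μ ≤ S.J₀ / 2
  nonneg : 0 ≤ C
  speed : ∀ τ ψ x, |S.phaseSpeed μ τ ψ (truncateBox x) - S.k| ≤ S.k / 2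
  caratheodory : ∀ τ, IsCaratheodory (S.truncField μ τ) (μ * C) (μ * C)
  lip_τ : ∀ τ τ' ψ x, ‖S.truncField μ τ ψ x - S.truncField μ τ' ψ x‖ ≤ μ * C * |τ - τ'|
  lead_lip : ∀ τ s x y, ‖S.lead τ s x - S.lead τ s y‖ ≤ C * ‖x - y‖
  lead_diff : ∀ τ s x y ξ ζ, ‖S.lead τ s (x + ξ) - S.lead τ s x - (S.lead τ s (y + ζ) -
    S.lead τ s y)‖ ≤ C * ‖ξ - ζ‖ + C * ‖ξ‖ * ‖x - y‖
  remainder_bound : ∀ τ, ∀ s ∈ Icc 0 S.L, ∀ x, ‖S.remainder μ τ s x‖ ≤ C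
  remainder_lip : ∀ τ, ∀ s ∈ Icc 0 S.L, ∀ x y,
    ‖S.remainder μ τ s x - S.remainder μ τ s y‖ ≤ C * ‖x - y‖

theorem truncField_eq {μ : ℝ} (hμ : μ ≠ 0) (τ s : ℝ) (x : ℝ × ℝ) :
    S.truncField μ τ s x =
      μ • S.lead τ s (truncateBox x) + μ ^ 2 • S.remainder μ τ s x := by
  refine Prod.ext ?_ ?_ <;>
    simp only [remainder, Prod.fst_add, Prod.snd_add, Prod.smul_fst, Prod.smul_snd,
      smul_eq_mul] <;> field_simp <;> ring

theorem IsRegular.leadZ_diff (hS : S.IsRegular C) (τ s a b ξ ζ : ℝ) :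
    |S.leadZ τ s (a + ξ) - S.leadZ τ s a - (S.leadZ τ s (b + ζ) - S.leadZ τ s b)| ≤
      4 * C * (C * (1 / S.k) * |ξ - ζ| + C * (1 / S.k) ^ 2 * |ξ| * |a - b|) := by
  have hk := hS.k_pos
  have hC := hS.nonneg
  have hJ₀ : S.J₀ ∈ Icc (S.J₀ / 2) (3 * S.J₀ / 2) := by constructor <;> linarith [hS.J₀_pos]
  have hK := hS.K₁_bound _ (angle_mem s) _ hJ₀
  have h := hS.f_diff ((s - a) / S.k) τ ((s - b) / S.k) τ (-ξ / S.k) 0 (-ζ / S.k) 0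
  simp only [add_zero, sub_self, abs_zero, ← add_div, ← sub_div] at h
  have e1 : ∀ a ξ, s - a + -ξ = s - (a + ξ) := fun a ξ => by ring
  rw [e1, e1, sub_sub_sub_cancel_left, abs_div, abs_div, abs_div, abs_of_pos hk, abs_neg,
    neg_sub_neg, abs_sub_comm ζ ξ, abs_sub_comm b a] at h
  have e2 : S.leadZ τ s (a + ξ) - S.leadZ τ s a - (S.leadZ τ s (b + ζ) - S.leadZ τ s b) =
      -4 * S.K₁ (angle s) S.J₀ * (S.f ((s - (a + ξ)) / S.k) τ - S.f ((s - a) / S.k) τ -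
        (S.f ((s - (b + ζ)) / S.k) τ - S.f ((s - b) / S.k) τ)) := by
    simp only [leadZ]; ring
  rw [e2, abs_mul, abs_mul]
  have h4 : |(-4 : ℝ)| = 4 := by norm_num
  rw [h4]
  have h5 : C * (|ξ - ζ| / S.k) + C * (|ξ| / S.k) * (|a - b| / S.k) =
    C * (1 / S.k) * |ξ - ζ| + C * (1 / S.k) ^ 2 * |ξ| * |a - b| := by ring
  rw [← h5]
  gcongr

theorem IsRegular.exists_bounds (hS : S.IsRegular C) :
    ∃ μ₁ > 0, ∃ C', ∀ μ, 0 < μ → μ ≤ μ₁ → S.HasBounds μ C' := by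
  obtain ⟨μ₁, hμ₁, hμJ, hμ1, hspeed, ⟨C₁, h₁⟩, ⟨C₂, h₂⟩, ⟨C₃, h₃⟩, ⟨C₄, h₄⟩⟩ := hS.uniform_remainder
  have hk := hS.k_pos
  have hC := hS.nonneg
  set B₁ := 4 * C * (C * (1 / S.k)) with hB₁
  set B₂ := 4 * C * (C * (1 / S.k) ^ 2) with hB₂
  have hi0 : ((μ₁, 0) : ℝ × ℝ) ∈ S.params μ₁ := ⟨hμ₁, le_rfl, le_rfl, hS.L_pos.le⟩
  have n₁ : 0 ≤ C₁ := (abs_nonneg _).trans (h₁ _ hi0 0 0).1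
  have n₂ : 0 ≤ C₂ := (abs_nonneg _).trans (h₂ _ hi0 0 0).1
  have n₃ : 0 ≤ C₃ := (abs_nonneg _).trans (h₃ _ hi0 0 0).1
  have n₄ : 0 ≤ C₄ := (abs_nonneg _).trans (h₄ _ hi0 0 0).1
  have n₅ : 0 ≤ B₁ := by positivity
  have n₆ : 0 ≤ B₂ := by positivity
  have n₇ := abs_nonneg (S.w / S.k)
  set A := C₁ + C₂ + C₃ + C₄ + B₁ + B₂ + |S.w / S.k| with hA
  have hA0 : 0 ≤ A := by positivity
  refine ⟨μ₁, hμ₁, A, fun μ hμ hμ' => ?_⟩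
  have hi : ∀ s ∈ Icc 0 S.L, ((μ, s) : ℝ × ℝ) ∈ S.params μ₁ := fun s hs => ⟨hμ, hμ', hs⟩
  have hred : ∀ ψ : ℝ, ∃ s ∈ Icc 0 S.L, ∃ n : ℤ, ψ = s + n * S.L := fun ψ => by
    have h := toIcoMod_mem_Ico hS.L_pos 0 ψ
    rw [zero_add] at h
    refine ⟨toIcoMod hS.L_pos 0 ψ, ⟨h.1, h.2.le⟩, toIcoDiv hS.L_pos 0 ψ, ?_⟩
    have := toIcoMod_add_toIcoDiv_zsmul hS.L_pos 0 ψ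
    rw [zsmul_eq_mul] at this
    exact this.symm
  have hsp : ∀ τ ψ x, |S.phaseSpeed μ τ ψ (truncateBox x) - S.k| ≤ S.k / 2 := by
    intro τ ψ x
    obtain ⟨s, hs, n, rfl⟩ := hred ψ
    rw [hS.phaseSpeed_add]
    exact hspeed _ (hi s hs) (_, x)
  have hfield : ∀ ψ, ∀ τ τ' x y, ‖S.truncField μ τ ψ x‖ ≤ μ * A ∧
      ‖S.truncField μ τ ψ x - S.truncField μ τ' ψ y‖ ≤
        μ * A * dist (τ, x) (τ', y) := by
    intro ψ τ τ' x y
    obtain ⟨s, hs, n, rfl⟩ := hred ψ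
    rw [hS.truncField_add, hS.truncField_add]
    have hd : dist ((τ, x) : ℝ × ℝ × ℝ) (τ', y) =
        dist ((τ + μ ^ 2 * (n * (S.L / S.k)), x) : ℝ × ℝ × ℝ)
          (τ' + μ ^ 2 * (n * (S.L / S.k)), y) := by
      simp [Prod.dist_eq]
    rw [hd]
    generalize τ + μ ^ 2 * (n * (S.L / S.k)) = σ
    generalize τ' + μ ^ 2 * (n * (S.L / S.k)) = σ'
    have g₁ := h₁ _ (hi s hs) (σ, x) (σ', y)
    have g₂ := h₂ _ (hi s hs) (σ, x) (σ', y)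
    have g₃ := h₃ _ (hi s hs) (σ, x) (σ', y)
    have g₄ := h₄ _ (hi s hs) (σ, x) (σ', y)
    simp only at g₁ g₂ g₃ g₄
    set d := dist ((σ, x) : ℝ × ℝ × ℝ) (σ', y) with hd'
    have hd0 : 0 ≤ d := dist_nonneg
    have hμ2 : μ ^ 2 ≤ μ := by rw [sq]; exact mul_le_of_le_one_left hμ.le (hμ'.trans hμ1)
    have comb : ∀ a b p q D, 0 ≤ D → 0 ≤ p → 0 ≤ q → |a| ≤ p * D → |b| ≤ q * D → p + q ≤ A →
        |μ * a + μ ^ 2 * b| ≤ μ * A * D := by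
      intro a b p q D hD hp hq ha hb hpq
      calc |μ * a + μ ^ 2 * b| ≤ μ * |a| + μ ^ 2 * |b| := by
            refine (abs_add_le _ _).trans (le_of_eq ?_)
            rw [abs_mul, abs_mul, abs_of_pos hμ, abs_of_pos (pow_pos hμ 2)]
        _ ≤ μ * (p * D) + μ * (q * D) := by gcongr
        _ = μ * (p + q) * D := by ring
        _ ≤ _ := by gcongr
    rw [truncField_eq hμ.ne', truncField_eq hμ.ne', norm_prod_le_iff, norm_prod_le_iff]
    simp only [Prod.fst_add, Prod.snd_add, Prod.smul_fst, Prod.smul_snd, smul_eq_mul, Prod.fst_sub,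
      Prod.snd_sub]
    refine ⟨⟨?_, ?_⟩, ?_, ?_⟩
    · have := comb _ _ C₃ C₁ 1 zero_le_one n₃ n₁ (by simpa using g₃.1) (by simpa using g₁.1)
        (by linarith)
      rwa [mul_one] at this
    · have := comb _ _ C₄ C₂ 1 zero_le_one n₄ n₂ (by simpa using g₄.1) (by simpa using g₂.1)
        (by linarith)
      rwa [mul_one] at this
    · rw [add_sub_add_comm, ← mul_sub, ← mul_sub]
      exact comb _ _ C₃ C₁ d hd0 n₃ n₁ g₃.2 g₁.2 (by linarith)
    · rw [add_sub_add_comm, ← mul_sub, ← mul_sub]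
      exact comb _ _ C₄ C₂ d hd0 n₄ n₂ g₄.2 g₂.2 (by linarith)
  have hdiff : ∀ τ s x y ξ ζ, ‖S.lead τ s (x + ξ) - S.lead τ s x - (S.lead τ s (y + ζ) -
      S.lead τ s y)‖ ≤ A * ‖ξ - ζ‖ + A * ‖ξ‖ * ‖x - y‖ := by
    intro τ s x y ξ ζ
    have d1 := norm_prod_le_iff.1 (le_refl ‖ξ - ζ‖)
    have d2 := norm_prod_le_iff.1 (le_refl ‖ξ‖)
    have d3 := norm_prod_le_iff.1 (le_refl ‖x - y‖)
    have h0 : 0 ≤ A * ‖ξ‖ * ‖x - y‖ := by positivity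
    rw [norm_prod_le_iff]
    constructor
    · refine (hS.leadZ_diff τ s x.2 y.2 ξ.2 ζ.2).trans ?_
      calc _ = B₁ * |ξ.2 - ζ.2| + B₂ * |ξ.2| * |x.2 - y.2| := by rw [hB₁, hB₂]; ring
        _ ≤ A * ‖ξ - ζ‖ + A * ‖ξ‖ * ‖x - y‖ := by
          gcongr
          · linarith
          · exact d1.2
          · linarith
          · exact d2.2
          · exact d3.2
    · have e : (S.lead τ s (x + ξ) - S.lead τ s x - (S.lead τ s (y + ζ) - S.lead τ s y)).2 =
          S.w / S.k * (ξ - ζ).1 := by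
        simp only [lead, Prod.snd_sub, Prod.fst_add, Prod.fst_sub]; ring
      rw [e, abs_mul]
      calc _ ≤ A * ‖ξ - ζ‖ := by
            gcongr
            · linarith
            · exact d1.1
        _ ≤ _ := by linarith
  refine ⟨hμ, hμ'.trans hμJ, hA0, hsp, fun τ => ⟨fun X hX => ?_, fun s x => (hfield s τ τ x x).1,
    fun s x y => ?_⟩, fun τ τ' ψ x => ?_, fun τ s x y => ?_, hdiff, fun τ s hs x => ?_,
    fun τ s hs x y => ?_⟩
  · refine aestronglyMeasurable_of_continuousAt countable_impactPhases fun ψ hψ => ?_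
    refine hS.continuousAt_field (X := fun s => truncateBox (X s)) hψ ?_ ?_ ?_
    · exact ((continuous_truncate 1).comp hX.fst).continuousAt.prodMk
        ((continuous_truncate 8).comp hX.snd).continuousAt
    · have := (impulse_mem hS.J₀_pos hμ (hμ'.trans hμJ) (abs_truncateBox_fst (X ψ))).1
      linarith [hS.J₀_pos]
    · have := (abs_le.1 (hsp τ ψ (X ψ))).1
      intro h
      rw [h] at this
      linarith
  · have := (hfield s τ τ x y).2
    rwa [Prod.dist_eq, dist_self, max_eq_right dist_nonneg, dist_eq_norm x y] at this
  · have := (hfield ψ τ τ' x x).2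
    rwa [Prod.dist_eq, dist_self, max_eq_left dist_nonneg, Real.dist_eq] at this
  · have := hdiff τ s y y (x - y) 0
    simpa using this
  · rw [norm_prod_le_iff]
    exact ⟨(h₁ _ (hi s hs) (τ, x) (τ, x)).1.trans (by linarith),
      (h₂ _ (hi s hs) (τ, x) (τ, x)).1.trans (by linarith)⟩
  · have hd : dist ((τ, x) : ℝ × ℝ × ℝ) (τ, y) = ‖x - y‖ := by
      rw [Prod.dist_eq, dist_self, max_eq_right dist_nonneg, dist_eq_norm]
    have g₁ := (h₁ _ (hi s hs) (τ, x) (τ, y)).2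
    have g₂ := (h₂ _ (hi s hs) (τ, x) (τ, y)).2
    rw [hd] at g₁ g₂
    rw [norm_prod_le_iff]
    refine ⟨g₁.trans ?_, g₂.trans ?_⟩ <;> gcongr <;> linarith

end

end PhaseModel

end ImpactOscillator

namespace ImpactOscillator

open MeasureTheory Filter Topology

namespace PhaseModel

noncomputable section

/-- The map `x ↦ X(L)` along solutions of `X' = H(s, X)`, `X(0) = x`. -/
def stepMap (H : ℝ → ℝ × ℝ → ℝ × ℝ) (L : ℝ) (x : ℝ × ℝ) : ℝ × ℝ :=
  open Classical in
  if h : ∃ X, IsIntegralSolution H X ∧ X 0 = x then h.choose L else 0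

theorem stepMap_eq {H : ℝ → ℝ × ℝ → ℝ × ℝ} {L B K : ℝ} (hH : IsCaratheodory H B K) (hK : 0 ≤ K)
    (hL : 0 ≤ L) (hKL : K * L ≤ 1 / 2) {X : ℝ → ℝ × ℝ} (hX : IsIntegralSolution H X) :
    stepMap H L (X 0) = X L := by
  have h : ∃ Y, IsIntegralSolution H Y ∧ Y 0 = X 0 := ⟨X, hX, rfl⟩
  rw [stepMap, dif_pos h]
  have h1 := h.choose_spec.1.norm_sub_le_two_mul hH hK hL hKL hX (a := 0) (s := L)
    (by rw [sub_zero, abs_of_nonneg hL])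
  rw [h.choose_spec.2, sub_self, norm_zero, mul_zero] at h1
  exact sub_eq_zero.1 (norm_le_zero_iff.1 h1)

/-- Slow time at the beginning of the `n`-th period. -/
def slowTime (S : PhaseModel) (μ : ℝ) (n : ℤ) : ℝ := μ ^ 2 * (n * (S.L / S.k))

/-- The averaged equation has a hyperbolic slowly varying equilibrium `η₀`. -/
structure IsHyperbolic (S : PhaseModel) (η₀ : ℝ → ℝ) (ς m M ρ Λ δ : ℝ) : Prop where
  sign : ς = 1 ∨ ς = -1
  m_pos : 0 < m
  ρ_pos : 0 < ρ
  ρ_le : ρ ≤ 1 / 4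
  δ_pos : 0 < δ
  Λ_nonneg : 0 ≤ Λ
  range : ∀ τ, 0 < η₀ τ ∧ η₀ τ < 2 * π
  zero : ∀ τ, ∫ s in (0 : ℝ)..S.L, S.leadZ τ s (η₀ τ) = 0
  slope : ∀ τ φ φ', |φ - η₀ τ| ≤ ρ → |φ' - η₀ τ| ≤ ρ → ∃ b ∈ Icc m M,
    ς * ((∫ s in (0 : ℝ)..S.L, S.leadZ τ s φ) - ∫ s in (0 : ℝ)..S.L, S.leadZ τ s φ') = b * (φ - φ')
  slope_w : ς * (S.L * (S.w / S.k)) ∈ Icc m M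
  lip : ∀ τ τ', |τ - τ'| ≤ δ → |η₀ τ - η₀ τ'| ≤ Λ * |τ - τ'|
  periodic : ∃ P > 0, Function.Periodic η₀ P
  f_periodic : ∃ P > 0, ∀ t τ, S.f t (τ + P) = S.f t τ

variable {S : PhaseModel} {C : ℝ}

theorem IsRegular.intervalIntegrable_leadZ (hS : S.IsRegular C) (τ φ a b : ℝ) :
    IntervalIntegrable (fun s => S.leadZ τ s φ) volume a b := by
  have hJ₀ : S.J₀ ∈ Icc (S.J₀ / 2) (3 * S.J₀ / 2) := by constructor <;> linarith [hS.J₀_pos]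
  have hopen : IsOpen ((univ : Set ℝ) ×ˢ Ioi (0 : ℝ)) := isOpen_univ.prod isOpen_Ioi
  have hC := hS.nonneg
  refine (intervalIntegrable_const (c := 4 * (C + |S.γ * S.J₀ * S.k| * C) * C)).mono_fun ?_
    (Eventually.of_forall fun s => ?_)
  · refine (aestronglyMeasurable_of_continuousAt countable_impactPhases fun ψ hψ => ?_).restrict
    have hK : ContinuousAt (fun s => S.K₁ (angle s) S.J₀) ψ :=
      ContinuousAt.comp (f := fun s => (angle s, S.J₀))
        (hS.K₁_cont.continuousAt (hopen.mem_nhds ⟨mem_univ _, hS.J₀_pos⟩))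
        ((continuousAt_angle hψ).prodMk continuousAt_const)
    have hf : ContinuousAt (fun s => S.f ((s - φ) / S.k) τ) ψ :=
      (hS.continuous_f.comp (f := fun s : ℝ => ((s - φ) / S.k, τ)) (by fun_prop)).continuousAt
    exact (continuousAt_const.mul (hf.add (continuousAt_const.mul hK))).mul hK
  · have hK := hS.K₁_bound _ (angle_mem s) _ hJ₀
    have hf := hS.f_bound ((s - φ) / S.k) τ
    refine le_trans ?_ (le_abs_self _)
    beta_reduce
    rw [Real.norm_eq_abs, leadZ, abs_mul, abs_mul]
    have h4 : |(-4 : ℝ)| = 4 := by norm_num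
    rw [h4]
    gcongr
    refine (abs_add_le _ _).trans ?_
    rw [abs_mul (S.γ * S.J₀ * S.k)]
    gcongr

theorem IsRegular.integral_lead (hS : S.IsRegular C) (τ : ℝ) (x : ℝ × ℝ) :
    IntervalIntegrable (fun s => S.lead τ s x) volume 0 S.L ∧
    ∫ s in (0 : ℝ)..S.L, S.lead τ s x =
      (∫ s in (0 : ℝ)..S.L, S.leadZ τ s x.2, S.L * (S.w / S.k) * x.1) := by
  have h1 := hS.intervalIntegrable_leadZ τ x.2 0 S.L
  have h2 : IntervalIntegrable (fun s => S.lead τ s x) volume 0 S.L := by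
    rw [intervalIntegrable_iff] at h1 ⊢
    exact Integrable.prodMk h1 (by rw [← IntegrableOn, ← intervalIntegrable_iff]; simp)
  refine ⟨h2, Prod.ext ?_ ?_⟩
  · have := (ContinuousLinearMap.fst ℝ ℝ ℝ).intervalIntegral_comp_comm h2
    simpa [lead] using this.symm
  · have := (ContinuousLinearMap.snd ℝ ℝ ℝ).intervalIntegral_comp_comm h2
    simp only [lead, ContinuousLinearMap.coe_snd', intervalIntegral.integral_const, sub_zero,
      smul_eq_mul] at this
    exact this.symm.trans (by ring)

variable {η₀ : ℝ → ℝ} {ς m M ρ Λ δ : ℝ}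

theorem IsHyperbolic.abs_le_seven (hη : S.IsHyperbolic η₀ ς m M ρ Λ δ) {τ φ r : ℝ}
    (h : |φ - η₀ τ| ≤ r) : |φ| ≤ 6.3 + r := by
  have h1 := hη.range τ
  have h2 := pi_lt_d2
  rw [abs_le] at *
  constructor <;> norm_num at * <;> linarith [h.1, h.2, h1.1, h1.2]

theorem exists_saddle (hS : S.IsRegular C) (hη : S.IsHyperbolic η₀ ς m M ρ Λ δ) {C' : ℝ}
    (hC' : 0 ≤ C') : ∃ μ₁ > 0, ∃ K, ∀ μ, 0 < μ → μ ≤ μ₁ → S.HasBounds μ C' →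
      IsSaddleSequence (fun n => stepMap (S.truncField μ (S.slowTime μ n)) S.L)
        (fun n => η₀ (S.slowTime μ n)) ς μ m M K ρ ∧ μ * C' * S.L ≤ 1 / 4 := by
  have hL := hS.L_pos
  have hk := hS.k_pos
  have hm := hη.m_pos
  have hmM : m ≤ M := hη.slope_w.1.trans hη.slope_w.2
  have hΛ := hη.Λ_nonneg
  have hδ := hη.δ_pos
  set K := 2 * (S.L * (C' + C' * C' * S.L)) + S.L * (3 * C' * C' * S.L + 2 * C') +
    Λ * (S.L / S.k) with hK
  have hK0 : 0 ≤ K := by positivity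
  refine ⟨min (min (1 / (4 * (C' * S.L + 1))) (1 / (M + 1))) (min (m / (4 * (K + 1)))
    (min 1 (δ / (S.L / S.k)))), ?_, K, fun μ hμ hμ₁ hb => ?_⟩
  · have : 0 < M + 1 := by linarith
    positivity
  simp only [le_min_iff] at hμ₁
  obtain ⟨⟨hμ1, hμ2⟩, hμ3, hμ4, hμ5⟩ := hμ₁
  rw [le_div_iff₀ (by positivity)] at hμ1 hμ3 hμ5
  rw [le_div_iff₀ (by linarith)] at hμ2
  have hsmall : μ * C' * S.L ≤ 1 / 4 := by nlinarith
  have hsmall2 : μ * C' * S.L ≤ 1 / 2 := by linarith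
  refine ⟨?_, hsmall⟩
  have hstep : ∀ n : ℤ, |S.slowTime μ n - S.slowTime μ (n + 1)| = μ ^ 2 * (S.L / S.k) := by
    intro n
    have : S.slowTime μ n - S.slowTime μ (n + 1) = -(μ ^ 2 * (S.L / S.k)) := by
      simp only [slowTime]; push_cast; ring
    rw [this, abs_neg, abs_of_nonneg (by positivity)]
  have havg : ∀ n : ℤ, ∀ x y : ℝ × ℝ, |x.1| ≤ ρ → |x.2 - η₀ (S.slowTime μ n)| ≤ ρ → |y.1| ≤ ρ →
      |y.2 - η₀ (S.slowTime μ n)| ≤ ρ →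
      ‖stepMap (S.truncField μ (S.slowTime μ n)) S.L x - x -
        μ • ∫ s in (0 : ℝ)..S.L, S.lead (S.slowTime μ n) s x‖ ≤
          μ ^ 2 * (S.L * (C' + C' * C' * S.L)) ∧
      ‖(stepMap (S.truncField μ (S.slowTime μ n)) S.L x - x -
        μ • ∫ s in (0 : ℝ)..S.L, S.lead (S.slowTime μ n) s x) -
        (stepMap (S.truncField μ (S.slowTime μ n)) S.L y - y -
        μ • ∫ s in (0 : ℝ)..S.L, S.lead (S.slowTime μ n) s y)‖ ≤
          μ ^ 2 * (S.L * (3 * C' * C' * S.L + 2 * C')) * ‖x - y‖ := by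
    intro n x y hx hx' hy hy'
    set τ := S.slowTime μ n
    have hcar := hb.caratheodory τ
    have hρ := hη.ρ_le
    have hbox : ∀ X : ℝ → ℝ × ℝ, IsIntegralSolution (S.truncField μ τ) X → |(X 0).1| ≤ ρ →
        |(X 0).2 - η₀ τ| ≤ ρ → ∀ s ∈ Icc 0 S.L, X s ∈ {x : ℝ × ℝ | |x.1| ≤ 1 ∧ |x.2| ≤ 8} := by
      intro X hX h1 h2 s hs
      have h3 := hX.norm_sub_le hcar 0 s
      have h4 : μ * C' * |s - 0| ≤ μ * C' * S.L := by
        rw [sub_zero, abs_of_nonneg hs.1]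
        gcongr
        exact hs.2
      have h5 := norm_prod_le_iff.1 (h3.trans (h4.trans hsmall))
      have h6 := hη.abs_le_seven h2
      simp only [Prod.fst_sub, Prod.snd_sub] at h5
      have h7 := abs_le.1 h5.1
      have h8 := abs_le.1 h5.2
      rw [abs_le] at h1 h6
      constructor <;> rw [abs_le] <;> constructor <;>
        linarith [h7.1, h7.2, h8.1, h8.2, h6.1, h6.2, h1.1, h1.2]
    obtain ⟨X, hX, rfl⟩ := hcar.exists_solution (by positivity) 0 x
    obtain ⟨Y, hY, rfl⟩ := hcar.exists_solution (by positivity) 0 y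
    rw [stepMap_eq hcar (by positivity) hL.le hsmall2 hX,
      stepMap_eq hcar (by positivity) hL.le hsmall2 hY]
    refine IsIntegralSolution.averaging (A := S.lead τ) (R := S.remainder μ τ) hμ.le hC' hL.le
      hsmall2 hcar (fun s _ x hx => ?_) (fun x => (hS.integral_lead τ x).1) (hb.lead_lip τ)
      (hb.lead_diff τ) (hb.remainder_bound τ) (hb.remainder_lip τ) hX hY (hbox X hX hx hx')
      (hbox Y hY hy hy')
    rw [truncField_eq hμ.ne', truncateBox_eq_self hx.1 hx.2]
  refine ⟨hη.sign, hμ, hm, by linarith, by linarith, hK0, fun n => ?_,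
    fun n x y hx hx' hy hy' => ?_⟩
  · set τ := S.slowTime μ n
    have hρ := hη.ρ_pos.le
    have h1 := (havg n (0, η₀ τ) (0, η₀ τ) (by simpa using hρ) (by simpa [τ] using hρ)
      (by simpa using hρ) (by simpa [τ] using hρ)).1
    rw [(hS.integral_lead _ _).2] at h1
    simp only at h1
    rw [hη.zero, mul_zero, ← Prod.zero_eq_mk, smul_zero, sub_zero, norm_prod_le_iff] at h1
    simp only [Prod.fst_sub, Prod.snd_sub, sub_zero] at h1
    have h2 := hη.lip τ (S.slowTime μ (n + 1)) (by
      rw [hstep]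
      calc μ ^ 2 * (S.L / S.k) ≤ μ * (S.L / S.k) := by
            gcongr; rw [sq]; exact mul_le_of_le_one_left hμ.le hμ4
        _ ≤ δ := hμ5)
    rw [hstep] at h2
    have h3 := abs_sub_le (stepMap (S.truncField μ τ) S.L (0, η₀ τ)).2 (η₀ τ)
      (η₀ (S.slowTime μ (n + 1)))
    have h4 : 0 ≤ μ ^ 2 * (S.L * (3 * C' * C' * S.L + 2 * C')) := by positivity
    rw [hK]
    linarith [h1.1, h1.2]
  · set τ := S.slowTime μ n
    obtain ⟨b, hbm, hbe⟩ := hη.slope τ x.2 y.2 hx' hy'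
    refine ⟨b, hbm, _, hη.slope_w, ?_⟩
    have h1 := (havg n x y hx hx' hy hy').2
    have hss : ς * ς = 1 := by rcases hη.sign with h | h <;> rw [h] <;> norm_num
    have hsa : ∀ a, |ς * a| = |a| := fun a => by rcases hη.sign with h | h <;> rw [h] <;> simp
    have h2 : μ ^ 2 * (S.L * (3 * C' * C' * S.L + 2 * C')) * ‖x - y‖ ≤
        K * μ ^ 2 * (|x.1 - y.1| + |x.2 - y.2|) := by
      have h3 : ‖x - y‖ ≤ |x.1 - y.1| + |x.2 - y.2| := norm_prod_le_iff.2
        ⟨le_add_of_nonneg_right (abs_nonneg _), le_add_of_nonneg_left (abs_nonneg _)⟩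
      have h4 : S.L * (3 * C' * C' * S.L + 2 * C') ≤ K := by
        have : 0 ≤ 2 * (S.L * (C' + C' * C' * S.L)) + Λ * (S.L / S.k) := by positivity
        linarith
      calc _ ≤ μ ^ 2 * K * (|x.1 - y.1| + |x.2 - y.2|) := by gcongr
        _ = _ := by ring
    have h3 := norm_prod_le_iff.1 (h1.trans h2)
    rw [(hS.integral_lead _ _).2, (hS.integral_lead _ _).2] at h3
    simp only [Prod.fst_sub, Prod.snd_sub, Prod.smul_fst, Prod.smul_snd, smul_eq_mul] at h3
    constructor
    · refine le_trans (le_of_eq ?_) h3.1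
      conv_rhs => rw [← hsa]
      congr 1
      linear_combination μ * hbe
    · refine le_trans (le_of_eq ?_) h3.2
      congr 1
      linear_combination (-μ * (S.L * (S.w / S.k)) * (x.1 - y.1)) * hss

end

end PhaseModel

end ImpactOscillator

namespace ImpactOscillator

open MeasureTheory Filter Topology

/-- Common return times of a linear flow on a two-dimensional torus are relatively dense. -/
theorem exists_return_time {P Q T a b ε : ℝ} (hP : 0 < P) (hQ : 0 < Q) (hT : 0 < T)
    (hε : 0 < ε) : ∃ l > 0, ∀ c : ℝ, ∃ j : ℤ, j * T ∈ Icc c (c + l) ∧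
      (∃ n : ℤ, |j * a - n * P| < ε) ∧ ∃ n : ℤ, |j * b - n * Q| < ε := by
  have : Fact (0 < P) := ⟨hP⟩
  have : Fact (0 < Q) := ⟨hQ⟩
  let g : ℤ → AddCircle P × AddCircle Q := fun j =>
    (((j * a : ℝ) : AddCircle P), ((j * b : ℝ) : AddCircle Q))
  have htb : TotallyBounded (range g) :=
    (isCompact_univ (X := AddCircle P × AddCircle Q)).totallyBounded.subset (subset_univ _)
  obtain ⟨t, htr, htf, hcov⟩ := totallyBounded_iff_subset.1 htb _ (Metric.dist_mem_uniformity hε)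
  have hfin : ∃ N : ℕ, ∀ y ∈ t, ∃ j : ℤ, g j = y ∧ |j| ≤ N := by
    have hsel : ∀ y ∈ t, ∃ j : ℤ, g j = y := fun y hy => htr hy
    choose! s hs using hsel
    obtain ⟨N, hN⟩ := (htf.image fun y => (s y).natAbs).bddAbove
    refine ⟨N, fun y hy => ⟨s y, hs y hy, ?_⟩⟩
    have := hN (mem_image_of_mem _ hy)
    rw [Int.abs_eq_natAbs]
    exact_mod_cast this
  obtain ⟨N, hN⟩ := hfin
  have hdist : ∀ {p : ℝ} [Fact (0 < p)] (x y : ℝ), dist (x : AddCircle p) (y : AddCircle p) < ε →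
      ∃ n : ℤ, |x - y - n * p| < ε := by
    intro p _ x y h
    rw [dist_eq_norm, ← AddCircle.coe_sub, AddCircle.norm_eq] at h
    exact ⟨_, h⟩
  refine ⟨(2 * N + 1) * T, by positivity, fun c => ?_⟩
  set i : ℤ := ⌈c / T⌉ + N with hi
  have hmem : g i ∈ ⋃ y ∈ t, {x | (x, y) ∈ {p : _ × _ | dist p.1 p.2 < ε}} := hcov ⟨i, rfl⟩
  simp only [mem_iUnion] at hmem
  obtain ⟨y, hy, hd⟩ := hmem
  obtain ⟨j, rfl, hj⟩ := hN y hy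
  have hd' : dist (g i) (g j) < ε := hd
  rw [Prod.dist_eq, max_lt_iff] at hd'
  have h1 : c / T ≤ ⌈c / T⌉ := Int.le_ceil _
  have h2 : (⌈c / T⌉ : ℝ) < c / T + 1 := Int.ceil_lt_add_one _
  have hj' : |(j : ℝ)| ≤ N := by exact_mod_cast hj
  rw [abs_le] at hj'
  refine ⟨i - j, ⟨?_, ?_⟩, ?_, ?_⟩
  · rw [← div_le_iff₀ hT]
    push_cast [hi]
    linarith [hj'.2]
  · have : ((i - j : ℤ) : ℝ) ≤ c / T + (2 * N + 1) := by
      push_cast [hi]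
      linarith [hj'.1]
    calc ((i - j : ℤ) : ℝ) * T ≤ (c / T + (2 * N + 1)) * T := by gcongr
      _ = _ := by field_simp
  · obtain ⟨n, hn⟩ := hdist _ _ hd'.1
    refine ⟨n, ?_⟩
    push_cast
    rwa [sub_mul]
  · obtain ⟨n, hn⟩ := hdist _ _ hd'.2
    refine ⟨n, ?_⟩
    push_cast
    rwa [sub_mul]

namespace PhaseModel

noncomputable section

/-- All the hypotheses and estimates near the resonance, for a given small `μ`. -/
structure IsNearResonance (S : PhaseModel) (η₀ : ℝ → ℝ) (ς m M ρ Λ δ C C' K μ : ℝ) : Prop where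
  regular : S.IsRegular C
  hyperbolic : S.IsHyperbolic η₀ ς m M ρ Λ δ
  bounds : S.HasBounds μ C'
  saddle : IsSaddleSequence (fun n => stepMap (S.truncField μ (S.slowTime μ n)) S.L)
    (fun n => η₀ (S.slowTime μ n)) ς μ m M K ρ
  small : μ * C' * S.L ≤ 1 / 4

variable {S : PhaseModel} {η₀ : ℝ → ℝ} {ς m M ρ Λ δ C C' K μ : ℝ}

theorem exists_isNearResonance (hS : S.IsRegular C) (hη : S.IsHyperbolic η₀ ς m M ρ Λ δ) :
    ∃ C' K, ∃ μ₁ > 0, ∀ μ, 0 < μ → μ ≤ μ₁ → S.IsNearResonance η₀ ς m M ρ Λ δ C C' K μ := by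
  obtain ⟨μ₁, hμ₁, C', hC'⟩ := hS.exists_bounds
  obtain ⟨μ₂, hμ₂, K, hK⟩ := exists_saddle hS hη (hC' μ₁ hμ₁ le_rfl).nonneg
  refine ⟨C', K, min μ₁ μ₂, by positivity, fun μ hμ hμ' => ?_⟩
  have hb := hC' μ hμ (hμ'.trans (min_le_left _ _))
  obtain ⟨h1, h2⟩ := hK μ hμ (hμ'.trans (min_le_right _ _)) hb
  exact ⟨hS, hη, hb, h1, h2⟩

theorem slowTime_add (i j : ℤ) : S.slowTime μ (i + j) = S.slowTime μ i + S.slowTime μ j := by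
  simp only [slowTime]; push_cast; ring

theorem IsRegular.solution_shift (hS : S.IsRegular C) {τ : ℝ} {X : ℝ → ℝ × ℝ}
    (hX : IsIntegralSolution (S.truncField μ τ) X) (n : ℤ) :
    IsIntegralSolution (S.truncField μ (τ + S.slowTime μ n)) fun s => X (s + n * S.L) := by
  have h := hX.shift (n * S.L)
  have e : (fun s => S.truncField μ τ (s + n * S.L)) = S.truncField μ (τ + S.slowTime μ n) := by
    funext s x
    exact hS.truncField_add _ _ _ _ _
  rwa [e] at h

namespace IsNearResonance

theorem small' (h : S.IsNearResonance η₀ ς m M ρ Λ δ C C' K μ) :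
    μ * C' * S.L ≤ 1 / 2 := h.small.trans (by norm_num)

theorem rate_nonneg (h : S.IsNearResonance η₀ ς m M ρ Λ δ C C' K μ) :
    0 ≤ μ * C' := mul_nonneg h.bounds.pos.le h.bounds.nonneg

theorem six_le_L (h : S.IsNearResonance η₀ ς m M ρ Λ δ C C' K μ) : 6 ≤ S.L := by
  obtain ⟨N, hN⟩ := h.regular.L_eq
  have hL := h.regular.L_pos
  have hπ := pi_gt_three
  rw [hN] at hL ⊢
  have h1 : (0 : ℝ) < N := by
    by_contra hneg
    push Not at hneg
    nlinarith
  have h2 : (1 : ℝ) ≤ N := by exact_mod_cast (by exact_mod_cast h1 : (0 : ℤ) < N)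
  nlinarith

theorem rate_le (h : S.IsNearResonance η₀ ς m M ρ Λ δ C C' K μ) : μ * C' ≤ 1 / 4 := by
  have h1 := h.six_le_L
  have h2 := h.small
  have h3 := h.rate_nonneg
  nlinarith

theorem solution_orbit (h : S.IsNearResonance η₀ ς m M ρ Λ δ C C' K μ)
    {X : ℝ → ℝ × ℝ} (hX : IsIntegralSolution (S.truncField μ 0) X) (n : ℤ) :
    X ((n + 1 : ℤ) * S.L) = stepMap (S.truncField μ (S.slowTime μ n)) S.L (X (n * S.L)) := by
  have h1 := h.regular.solution_shift hX n
  rw [zero_add] at h1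
  have h2 := stepMap_eq (h.bounds.caratheodory _) h.rate_nonneg h.regular.L_pos.le h.small' h1
  rw [zero_add] at h2
  rw [h2]
  congr 1
  push_cast
  ring

theorem eq_of_eq (h : S.IsNearResonance η₀ ς m M ρ Λ δ C C' K μ)
    {X Y : ℝ → ℝ × ℝ} {τ : ℝ} (hX : IsIntegralSolution (S.truncField μ τ) X)
    (hY : IsIntegralSolution (S.truncField μ τ) Y) {a s : ℝ} (ha : X a = Y a)
    (hs : |s - a| ≤ S.L) : X s = Y s := by
  have h1 := hX.norm_sub_le_two_mul (h.bounds.caratheodory τ) h.rate_nonneg h.regular.L_pos.le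
    h.small' hY hs
  rw [ha, sub_self, norm_zero, mul_zero] at h1
  exact sub_eq_zero.1 (norm_le_zero_iff.1 h1)

theorem exists_floor (h : S.IsNearResonance η₀ ς m M ρ Λ δ C C' K μ)
    (ψ : ℝ) : ∃ n : ℤ, ψ - n * S.L ∈ Ico 0 S.L := by
  have hL := h.regular.L_pos
  refine ⟨⌊ψ / S.L⌋, ?_, ?_⟩
  · have := Int.floor_le (ψ / S.L)
    rw [le_div_iff₀ hL] at this
    linarith
  · have := Int.lt_floor_add_one (ψ / S.L)
    rw [div_lt_iff₀ hL] at this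
    linarith

/-- Solutions that agree at all sections coincide. -/
theorem eq_of_sections (h : S.IsNearResonance η₀ ς m M ρ Λ δ C C' K μ)
    {X Y : ℝ → ℝ × ℝ} (hX : IsIntegralSolution (S.truncField μ 0) X)
    (hY : IsIntegralSolution (S.truncField μ 0) Y)
    (hXY : ∀ n : ℤ, X (n * S.L) = Y (n * S.L)) : X = Y := by
  funext ψ
  obtain ⟨n, hn⟩ := h.exists_floor ψ
  refine h.eq_of_eq hX hY (hXY n) ?_
  rw [abs_of_nonneg hn.1]
  exact hn.2.le

/-- Every orbit of the step maps comes from a solution. -/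
theorem exists_solution_of_orbit (h : S.IsNearResonance η₀ ς m M ρ Λ δ C C' K μ) {x : ℤ → ℝ × ℝ}
    (hx : ∀ n, x (n + 1) = stepMap (S.truncField μ (S.slowTime μ n)) S.L (x n)) :
    ∃ X, IsIntegralSolution (S.truncField μ 0) X ∧ ∀ n : ℤ, X (n * S.L) = x n := by
  have hcar := h.bounds.caratheodory 0
  obtain ⟨X, hX, hX0⟩ := hcar.exists_solution h.rate_nonneg 0 (x 0)
  refine ⟨X, hX, fun n => ?_⟩
  induction n using Int.induction_on with
  | zero => simpa using hX0
  | succ n ih =>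
    have := h.solution_orbit hX n
    rw [ih, ← hx] at this
    exact this
  | pred n ih =>
    obtain ⟨Y, hY, hY0⟩ := hcar.exists_solution h.rate_nonneg ((-n - 1 : ℤ) * S.L) (x (-n - 1))
    have h1 := h.solution_orbit hY (-n - 1)
    rw [hY0, ← hx, sub_add_cancel, ← ih] at h1
    rw [← hY0]
    refine h.eq_of_eq hX hY h1.symm ?_
    push_cast
    rw [show ((-n - 1 : ℝ) * S.L - -n * S.L) = -S.L by ring, abs_neg,
      abs_of_pos h.regular.L_pos]

/-- Uniqueness of solutions near the equilibrium. -/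
theorem unique (h : S.IsNearResonance η₀ ς m M ρ Λ δ C C' K μ)
    {X Y : ℝ → ℝ × ℝ} (hX : IsIntegralSolution (S.truncField μ 0) X)
    (hY : IsIntegralSolution (S.truncField μ 0) Y)
    (hXρ : ∀ n : ℤ, |(X (n * S.L)).1| ≤ ρ / 2 ∧ |(X (n * S.L)).2 - η₀ (S.slowTime μ n)| ≤ ρ / 2)
    (hYρ : ∀ n : ℤ, |(Y (n * S.L)).1| ≤ ρ / 2 ∧ |(Y (n * S.L)).2 - η₀ (S.slowTime μ n)| ≤ ρ / 2) :
    X = Y := by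
  refine h.eq_of_sections hX hY fun n => ?_
  have := h.saddle.norm_sub_le_of_pseudoOrbit (x := fun n => X (n * S.L))
    (y := fun n => Y (n * S.L)) (e := 0)
    (fun n => by rw [h.solution_orbit hX, sub_self, norm_zero])
    (fun n => by rw [h.solution_orbit hY, sub_self, norm_zero]) hXρ hYρ n
  rw [mul_zero, zero_div] at this
  exact sub_eq_zero.1 (norm_le_zero_iff.1 this)

theorem η₀_near (h : S.IsNearResonance η₀ ς m M ρ Λ δ C C' K μ)
    {ε : ℝ} (hε : 0 < ε) : ∃ d > 0, ∀ τ τ', |τ - τ'| < d → |η₀ τ - η₀ τ'| ≤ ε := by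
  have hδ := h.hyperbolic.δ_pos
  have hΛ := h.hyperbolic.Λ_nonneg
  refine ⟨min δ (ε / (Λ + 1)), by positivity, fun τ τ' hd => ?_⟩
  rw [lt_min_iff, lt_div_iff₀ (by positivity)] at hd
  refine (h.hyperbolic.lip τ τ' hd.1.le).trans ?_
  have h0 := abs_nonneg (τ - τ')
  nlinarith

/-- Solutions near the equilibrium have relatively dense almost periods. -/
theorem almostPeriods (h : S.IsNearResonance η₀ ς m M ρ Λ δ C C' K μ)
    {X : ℝ → ℝ × ℝ} (hX : IsIntegralSolution (S.truncField μ 0) X)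
    (hXρ : ∀ n : ℤ, |(X (n * S.L)).1| ≤ ρ / 4 ∧ |(X (n * S.L)).2 - η₀ (S.slowTime μ n)| ≤ ρ / 4)
    {ε : ℝ} (hε : 0 < ε) : ∃ l > 0, ∀ a : ℝ, ∃ j : ℤ, j * (S.L / S.k) ∈ Icc a (a + l) ∧
      ∀ ψ, ‖X (ψ + j * S.L) - X ψ‖ ≤ ε := by
  obtain ⟨P, hP, hηP⟩ := h.hyperbolic.periodic
  obtain ⟨Q, hQ, hfQ⟩ := h.hyperbolic.f_periodic
  have hL := h.regular.L_pos
  have hk := h.regular.k_pos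
  have hρ := h.hyperbolic.ρ_pos
  have hμ := h.bounds.pos
  have hm := h.hyperbolic.m_pos
  have hr := h.rate_nonneg
  obtain ⟨d, hd, hηd⟩ := h.η₀_near (ε := ρ / 4) (by positivity)
  set A := 2 * (16 * (2 * (S.L * (μ * C'))) / (μ * m) + S.L * (μ * C')) with hA
  have hA0 : 0 ≤ A := by positivity
  obtain ⟨ε', hε', hε'd, hεA⟩ : ∃ ε' : ℝ, 0 < ε' ∧ ε' ≤ d ∧ A * ε' ≤ ε := by
    refine ⟨min d (ε / (A + 1)), by positivity, min_le_left _ _, ?_⟩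
    calc A * min d (ε / (A + 1)) ≤ A * (ε / (A + 1)) := by gcongr; exact min_le_right _ _
      _ = A / (A + 1) * ε := by ring
      _ ≤ 1 * ε := by
        gcongr
        rw [div_le_one (by positivity)]
        linarith
      _ = ε := one_mul _
  obtain ⟨l, hl, hret⟩ := exists_return_time (a := μ ^ 2 * (S.L / S.k)) (b := μ ^ 2 * (S.L / S.k))
    hP hQ (div_pos hL hk) hε'
  refine ⟨l, hl, fun a => ?_⟩
  obtain ⟨j, hj, ⟨n₁, hn₁⟩, n₂, hn₂⟩ := hret a
  refine ⟨j, hj, ?_⟩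
  have hsj : S.slowTime μ j = j * (μ ^ 2 * (S.L / S.k)) := by simp only [slowTime]; ring
  rw [← hsj] at hn₁ hn₂
  have hfield : ∀ τ s x, ‖S.truncField μ (τ + S.slowTime μ j) s x - S.truncField μ τ s x‖ ≤
      μ * C' * ε' := by
    intro τ s x
    have e : S.truncField μ τ s x = S.truncField μ (τ + n₂ * Q) s x := by
      have hf : ∀ t σ, S.f t (σ + n₂ * Q) = S.f t σ := fun t σ => by
        have : Function.Periodic (S.f t) Q := fun τ => hfQ t τ
        exact (this.int_mul n₂) σ
      have hF : ∀ y, S.force μ (τ + n₂ * Q) s y = S.force μ τ s y := fun y => by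
        simp only [force]
        rw [add_right_comm, hf]
      simp only [truncField, field, phaseSpeed, correction, damped, hF]
    rw [e]
    refine (h.bounds.lip_τ _ _ _ _).trans ?_
    rw [add_sub_add_left_eq_sub]
    gcongr
  have hshift := h.regular.solution_shift hX j
  set Y : ℝ → ℝ × ℝ := fun s => X (s + j * S.L) with hY
  have hYsec : ∀ n : ℤ, Y (n * S.L) = X ((n + j : ℤ) * S.L) := fun n => by
    simp only [hY]; congr 1; push_cast; ring
  have hYη : ∀ n : ℤ, |η₀ (S.slowTime μ (n + j)) - η₀ (S.slowTime μ n)| ≤ ρ / 4 := fun n => by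
    have e : η₀ (S.slowTime μ n) = η₀ (S.slowTime μ n + n₁ * P) := ((hηP.int_mul n₁) _).symm
    rw [e, slowTime_add]
    refine hηd _ _ ?_
    rw [add_sub_add_left_eq_sub]
    exact hn₁.trans_le hε'd
  have hsec : ∀ n : ℤ, ‖Y (n * S.L) - X (n * S.L)‖ ≤
      16 * (2 * (S.L * (μ * C' * ε'))) / (μ * m) := by
    intro n
    refine h.saddle.norm_sub_le_of_pseudoOrbit (x := fun n => Y (n * S.L))
      (y := fun n => X (n * S.L)) (fun n => ?_) (fun n => ?_) (fun n => ?_) (fun n => ?_) n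
    · have h1 := h.regular.solution_shift hshift n
      obtain ⟨Z, hZ, hZ0⟩ := (h.bounds.caratheodory (S.slowTime μ n)).exists_solution h.rate_nonneg
        0 (Y (n * S.L))
      have h2 := stepMap_eq (h.bounds.caratheodory _) h.rate_nonneg hL.le h.small' hZ
      rw [hZ0] at h2
      rw [h2]
      have h3 := h1.norm_sub_le_of_close (h.bounds.caratheodory _)
        (h.bounds.caratheodory (S.slowTime μ n)) h.rate_nonneg hL.le h.small' (e := μ * C' * ε')
        (fun s x => by
          rw [zero_add, add_comm (S.slowTime μ j)]
          exact hfield _ _ _) hZ (a := 0) (s := S.L) (by rw [sub_zero, abs_of_pos hL])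
      rw [zero_add, hZ0, sub_self, norm_zero, zero_add] at h3
      refine le_trans (le_of_eq ?_) h3
      congr 3
      push_cast
      ring
    · rw [h.solution_orbit hX, sub_self, norm_zero]
      positivity
    · rw [hYsec]
      have h1 := hXρ (n + j)
      refine ⟨h1.1.trans (by linarith), ?_⟩
      have h2 := abs_sub_le (X ((n + j : ℤ) * S.L)).2 (η₀ (S.slowTime μ (n + j)))
        (η₀ (S.slowTime μ n))
      linarith [h1.2, hYη n]
    · have h1 := hXρ n
      exact ⟨h1.1.trans (by linarith), h1.2.trans (by linarith)⟩
  intro ψ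
  obtain ⟨n, hn⟩ := h.exists_floor ψ
  have h3 := hshift.norm_sub_le_of_close (h.bounds.caratheodory _)
    (h.bounds.caratheodory 0) h.rate_nonneg hL.le h.small' (e := μ * C' * ε')
    (fun s x => hfield _ _ _) hX (a := n * S.L) (s := ψ) (by
      rw [abs_of_nonneg hn.1]; exact hn.2.le)
  refine h3.trans ?_
  calc _ ≤ 2 * (16 * (2 * (S.L * (μ * C' * ε'))) / (μ * m) + S.L * (μ * C' * ε')) := by
        gcongr
        exact hsec n
    _ = A * ε' := by rw [hA]; ring
    _ ≤ ε := hεA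

/-- Solutions that start arbitrarily close to a solution near the equilibrium and leave it. -/
theorem escape (h : S.IsNearResonance η₀ ς m M ρ Λ δ C C' K μ)
    {X : ℝ → ℝ × ℝ} (hX : IsIntegralSolution (S.truncField μ 0) X)
    (hXρ : ∀ n : ℤ, |(X (n * S.L)).1| ≤ ρ / 4 ∧ |(X (n * S.L)).2 - η₀ (S.slowTime μ n)| ≤ ρ / 4)
    (n₀ : ℤ) {d ε : ℝ} (hd : 0 < d) (hdε : 8 * d < ε) (hε : ε ≤ ρ / 4) :
    ∃ Y, IsIntegralSolution (S.truncField μ 0) Y ∧ ∃ N : ℕ, 4 ≤ N ∧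
      (∀ ψ ∈ Icc (n₀ * S.L) ((n₀ + 3) * S.L), ‖Y ψ - X ψ‖ ≤ 8 * d) ∧
      (∀ ψ ∈ Icc (n₀ * S.L) ((n₀ + N) * S.L), ‖Y ψ - X ψ‖ ≤ 2 * ε) ∧
      ε ≤ ‖Y ((n₀ + N) * S.L) - X ((n₀ + N) * S.L)‖ := by
  have hL := h.regular.L_pos
  have hμ := h.bounds.pos
  have hm := h.hyperbolic.m_pos
  have hcar := h.bounds.caratheodory 0
  obtain ⟨Y, hY, hY0⟩ := hcar.exists_solution h.rate_nonneg (n₀ * S.L) (X (n₀ * S.L) + (0, d))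
  have hsec : ∀ n : ℕ, ∀ ψ ∈ Icc ((n₀ + n) * S.L) ((n₀ + n + 1) * S.L),
      ‖Y ψ - X ψ‖ ≤ 2 * ‖Y ((n₀ + n) * S.L) - X ((n₀ + n) * S.L)‖ := fun n ψ hψ => by
    refine hY.norm_sub_le_two_mul hcar h.rate_nonneg hL.le h.small' hX ?_
    rw [abs_of_nonneg (by linarith [hψ.1])]
    linarith [hψ.2]
  have hn0 : ‖Y (n₀ * S.L) - X (n₀ * S.L)‖ = d := by
    rw [hY0, add_sub_cancel_left, Prod.norm_def]
    simp [abs_of_pos hd, hd.le]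
  set D : ℕ → ℝ := fun n => ‖Y ((n₀ + n) * S.L) - X ((n₀ + n) * S.L)‖ with hD
  have hD0 : D 0 = d := by simpa [hD] using hn0
  have hDs : ∀ n, D (n + 1) ≤ 2 * D n := fun n => by
    have := hsec n ((n₀ + n + 1) * S.L) ⟨by nlinarith, le_rfl⟩
    simp only [hD]
    push_cast
    rw [← add_assoc]
    exact this
  have hex : ∃ n, ε ≤ D n := by
    by_contra hcon
    push Not at hcon
    have hgrow : ∀ n : ℕ, |saddleV ς (Y ((n₀ + n) * S.L) - X ((n₀ + n) * S.L))| ≤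
        |saddleU ς (Y ((n₀ + n) * S.L) - X ((n₀ + n) * S.L))| ∧
        (1 + μ * m / 2) ^ n * d ≤ |saddleU ς (Y ((n₀ + n) * S.L) - X ((n₀ + n) * S.L))| := by
      intro n
      induction n with
      | zero =>
        simp only [Nat.cast_zero, add_zero, hY0, add_sub_cancel_left, saddleU, saddleV, mul_zero,
          zero_add, zero_sub, abs_neg, le_refl, pow_zero, one_mul, true_and]
        exact le_abs_self d
      | succ n ih =>
        have hXn := hXρ (n₀ + n)
        have hclose := norm_prod_le_iff.1 (hcon n).le
        simp only [Prod.fst_sub, Prod.snd_sub] at hclose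
        push_cast at hXn
        have h1 := h.saddle.cone (n := n₀ + n) (x := Y ((n₀ + n) * S.L)) (y := X ((n₀ + n) * S.L))
          (by
            have := abs_sub_abs_le_abs_sub (Y ((n₀ + n) * S.L)).1 (X ((n₀ + n) * S.L)).1
            linarith [hXn.1, hclose.1])
          (by
            have := abs_sub_le (Y ((n₀ + n) * S.L)).2 (X ((n₀ + n) * S.L)).2
              (η₀ (S.slowTime μ (n₀ + n)))
            linarith [hXn.2, hclose.2])
          (by linarith [hXn.1, h.hyperbolic.ρ_pos]) (by linarith [hXn.2, h.hyperbolic.ρ_pos])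
          ih.1
        have e1 := h.solution_orbit hY (n₀ + n)
        have e2 := h.solution_orbit hX (n₀ + n)
        push_cast at e1 e2
        rw [← e1, ← e2] at h1
        push_cast
        rw [← add_assoc]
        refine ⟨h1.1, le_trans ?_ h1.2⟩
        rw [pow_succ]
        calc (1 + μ * m / 2) ^ n * (1 + μ * m / 2) * d
            = (1 + μ * m / 2) * ((1 + μ * m / 2) ^ n * d) := by ring
          _ ≤ _ := by gcongr; exact ih.2
    have hunb := tendsto_pow_atTop_atTop_of_one_lt (r := 1 + μ * m / 2) (by
      have := mul_pos hμ hm; linarith)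
    obtain ⟨n, hn⟩ := (hunb.eventually_ge_atTop (2 * ε / d)).exists
    have h1 := (hgrow n).2
    rw [div_le_iff₀ hd] at hn
    have h3 : |saddleU ς (Y ((n₀ + n) * S.L) - X ((n₀ + n) * S.L))| ≤ 
        |(Y ((n₀ + n) * S.L) - X ((n₀ + n) * S.L)).1| +
        |(Y ((n₀ + n) * S.L) - X ((n₀ + n) * S.L)).2| := by
      refine (abs_add_le _ _).trans (le_of_eq ?_)
      congr 1
      rcases h.saddle.sign with e | e <;> rw [e] <;> simp [abs_sub_comm]
    have h4 := hcon n
    have h5 := norm_prod_le_iff.1 (le_refl (D n))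
    linarith [h5.1, h5.2]
  classical
  have hN := Nat.find_spec hex
  have hmin := fun {n : ℕ} (hn : n < Nat.find hex) => not_le.1 (Nat.find_min hex hn)
  set N := Nat.find hex
  have hsmall : ∀ n ≤ 3, D n ≤ 8 * d ∧ (n ≤ 2 → D n ≤ 4 * d) := by
    have h0 := hD0
    have h1 := hDs 0
    have h2 := hDs 1
    have h3 := hDs 2
    intro n hn
    interval_cases n <;> constructor <;> intros <;> norm_num at * <;> linarith
  refine ⟨Y, hY, N, ?_, fun ψ hψ => ?_, fun ψ hψ => ?_, ?_⟩
  · by_contra hlt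
    have := (hsmall N (by omega)).1
    linarith
  · have hlt : ∃ n : ℕ, n ≤ 2 ∧ ψ ∈ Icc ((n₀ + n) * S.L) ((n₀ + n + 1) * S.L) := by
      obtain ⟨h1, h2⟩ := hψ
      rcases le_total ψ ((n₀ + 1) * S.L) with h3 | h3
      · exact ⟨0, by norm_num, by simpa using h1, by simpa using h3⟩
      rcases le_total ψ ((n₀ + 2) * S.L) with h4 | h4
      · exact ⟨1, by norm_num, by simpa using h3, by push_cast; linarith⟩
      · exact ⟨2, by norm_num, by simpa using h4, by push_cast; linarith⟩
    obtain ⟨n, hn, hψn⟩ := hlt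
    have h1 := hsec n ψ hψn
    have h2 : D n ≤ 4 * d := (hsmall n (by omega)).2 hn
    linarith
  · have hε0 : 0 < ε := by linarith
    rcases eq_or_lt_of_le hψ.2 with heq | hlt
    · have hN1 : 0 < N := by
        by_contra h0
        have : N = 0 := by omega
        rw [this, hD0] at hN
        linarith
      have h1 := hsec (N - 1) ψ (by
        rw [heq]
        have : ((N - 1 : ℕ) : ℝ) = N - 1 := by rw [Nat.cast_sub hN1]; simp
        rw [this]
        constructor <;> nlinarith)
      have h2 := hmin (n := N - 1) (by omega)
      linarith
    · obtain ⟨n, hn⟩ := h.exists_floor (ψ - n₀ * S.L)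
      have hn' : 0 ≤ n := by
        by_contra hneg
        have : (n : ℝ) ≤ -1 := by exact_mod_cast (by omega : n ≤ -1)
        have h2 := hn.2
        have h3 := hψ.1
        nlinarith
      obtain ⟨p, rfl⟩ := Int.eq_ofNat_of_zero_le hn'
      have hn1 := hn.1
      have hn2 := hn.2
      push_cast at hn1 hn2
      have h1 := hsec p ψ ⟨by linarith, by linarith⟩
      have hpN : p < N := by
        have : (p : ℝ) * S.L < N * S.L := by linarith
        exact_mod_cast lt_of_mul_lt_mul_right this hL.le
      have h2 := hmin hpN
      linarith
  · exact hN

end IsNearResonance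

end

end PhaseModel

end ImpactOscillator

namespace ImpactOscillator

open MeasureTheory Filter Topology

/-- A continuous function with slopes bounded below by a positive constant has a continuous
inverse. -/
theorem exists_continuous_inverse {g : ℝ → ℝ} (hg : Continuous g) {c : ℝ} (hc : 0 < c)
    (h : ∀ a b, a ≤ b → c * (b - a) ≤ g b - g a) :
    ∃ e : ℝ → ℝ, Continuous e ∧ StrictMono e ∧ (∀ x, e (g x) = x) ∧ ∀ y, g (e y) = y := by
  have hmono : StrictMono g := fun a b hab => by
    have := h a b hab.le
    nlinarith
  have htop : Tendsto g atTop atTop := by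
    refine tendsto_atTop_mono' atTop (f₁ := fun x => g 0 + c * x) ?_
      (tendsto_atTop_add_const_left _ _ (tendsto_id.const_mul_atTop hc))
    filter_upwards [eventually_ge_atTop 0] with x hx
    have := h 0 x hx
    rw [sub_zero] at this
    linarith
  have hbot : Tendsto g atBot atBot := by
    have hle : ∀ᶠ x in atBot, g x ≤ g 0 + c * x := by
      filter_upwards [eventually_le_atBot 0] with x hx
      have := h x 0 hx
      linarith
    exact tendsto_atBot_mono' atBot hle
      (tendsto_atBot_add_const_left _ _ (tendsto_id.const_mul_atBot hc))
  let e := StrictMono.orderIsoOfSurjective g hmono (hg.surjective htop hbot)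
  exact ⟨e.symm, e.symm.continuous, e.symm.strictMono, fun x => e.symm_apply_apply x,
    fun y => e.apply_symm_apply y⟩

section

variable {E : Type*} [NormedAddCommGroup E] [NormedSpace ℝ E] [CompleteSpace E]

/-- The integrated form of a differential equation that holds off a countable set. -/
theorem integral_eq_of_hasDerivAt_off {y g : ℝ → E} {a b B : ℝ} {s : Set ℝ} (hy : Continuous y)
    (hs : s.Countable) (hd : ∀ u ∈ Ioo a b, u ∉ s → HasDerivAt y (g u) u)
    (hB : ∀ u ∈ Ioo a b, u ∉ s → ‖g u‖ ≤ B) {c d : ℝ} (hc : c ∈ Icc a b) (hd' : d ∈ Icc a b) :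
    IntervalIntegrable g volume c d ∧ y d - y c = ∫ u in c..d, g u := by
  have hsub : Ioo (min c d) (max c d) ⊆ Ioo a b :=
    Ioo_subset_Ioo (le_min hc.1 hd'.1) (max_le hc.2 hd'.2)
  have hae : ∀ᵐ u ∂(volume.restrict (uIoc c d)), u ∈ Ioo a b ∧ u ∉ s := by
    rw [ae_restrict_iff' measurableSet_uIoc]
    have hcount : (s ∪ {max c d}).Countable := hs.union (countable_singleton _)
    filter_upwards [compl_mem_ae_iff.2 (hcount.measure_zero volume)] with u hu hu'
    simp only [mem_compl_iff, mem_union, mem_singleton_iff, not_or] at hu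
    exact ⟨hsub ⟨hu'.1, lt_of_le_of_ne hu'.2 hu.2⟩, hu.1⟩
  have hintg : IntervalIntegrable g volume c d := by
    refine (intervalIntegrable_const (c := B)).mono_fun ?_ ?_
    · refine (aestronglyMeasurable_deriv y _).congr ?_
      filter_upwards [hae] with u hu
      exact (hd u hu.1 hu.2).deriv
    · filter_upwards [hae] with u hu
      exact (hB u hu.1 hu.2).trans (le_abs_self B)
  exact ⟨hintg, (integral_eq_of_hasDerivAt_off_countable y g hs hy.continuousOn
    (fun u hu => hd u (hsub hu.1) hu.2) hintg).symm⟩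

theorem IsIntegralSolution.hasDerivAt {H : ℝ → E → E} {B K : ℝ} (hH : IsCaratheodory H B K)
    {X : ℝ → E} (hX : IsIntegralSolution H X) {ψ : ℝ}
    (hc : ContinuousAt (fun s => H s (X s)) ψ) : HasDerivAt X (H ψ (X ψ)) ψ := by
  have h := intervalIntegral.integral_hasDerivAt_right (hH.intervalIntegrable hX.1 0 ψ)
    (AEStronglyMeasurable.stronglyMeasurableAtFilter (hH.meas X hX.1)) hc
  have e : X = fun t => X 0 + ∫ s in (0 : ℝ)..t, H s (X s) := by
    funext t
    rw [← hX.2]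
    abel
  have h2 := h.const_add (X 0)
  rw [← e] at h2
  exact h2

end

namespace PhaseModel

noncomputable section

/-- The near-resonance system in the original time. -/
def timeField (S : PhaseModel) (μ t : ℝ) (x : ℝ × ℝ) : ℝ × ℝ :=
  (μ * (-4 * S.W (S.impulse μ x) * S.damped μ 0 (x.2 + S.k * t) x *
      S.K₁ (angle (x.2 + S.k * t)) (S.impulse μ x)),
    S.phaseSpeed μ 0 (x.2 + S.k * t) x - S.k)

/-- `V` is the near-resonance system, off the impacts. -/
structure IsTimeField (S : PhaseModel) (μ : ℝ) (V : ℝ → ℝ × ℝ → ℝ × ℝ) : Prop where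
  eq : ∀ t x, |x.1| ≤ 1 → |x.2| ≤ 8 → x.2 + S.k * t ∉ impactPhases → V t x = S.timeField μ t x
  bound : ∀ t x, |x.1| ≤ 1 → |x.2| ≤ 8 → |(V t x).2| ≤ S.k / 2

variable {S : PhaseModel} {C C' μ : ℝ} {V : ℝ → ℝ × ℝ → ℝ × ℝ}

theorem HasBounds.phaseSpeed_pos (hb : S.HasBounds μ C') (hS : S.IsRegular C) (τ ψ : ℝ) {x : ℝ × ℝ}
    (h₁ : |x.1| ≤ 1) (h₂ : |x.2| ≤ 8) : 0 < S.phaseSpeed μ τ ψ x := by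
  have := hb.speed τ ψ x
  rw [truncateBox_eq_self h₁ h₂, abs_le] at this
  linarith [hS.k_pos]

theorem HasBounds.impulse_pos (hb : S.HasBounds μ C') (hS : S.IsRegular C) {x : ℝ × ℝ}
    (h₁ : |x.1| ≤ 1) : 0 < S.impulse μ x := by
  have := (impulse_mem hS.J₀_pos hb.pos hb.le_J₀ h₁).1
  linarith [hS.J₀_pos]

theorem timeField_eq_smul (hb : S.HasBounds μ C') (hS : S.IsRegular C) {t : ℝ} {x : ℝ × ℝ}
    (h₁ : |x.1| ≤ 1) (h₂ : |x.2| ≤ 8) :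
    S.timeField μ t x = S.phaseSpeed μ 0 (x.2 + S.k * t) x •
      S.truncField μ 0 (x.2 + S.k * t) x := by
  have hD := (hb.phaseSpeed_pos hS 0 (x.2 + S.k * t) h₁ h₂).ne'
  rw [truncField, truncateBox_eq_self h₁ h₂]
  refine Prod.ext ?_ ?_ <;> simp only [timeField, field, Prod.smul_fst, Prod.smul_snd, smul_eq_mul]
  · field_simp
  · field_simp

theorem HasBounds.hasDerivAt (hb : S.HasBounds μ C') (hS : S.IsRegular C) {X : ℝ → ℝ × ℝ}
    (hX : IsIntegralSolution (S.truncField μ 0) X) {ψ : ℝ} (hψ : ψ ∉ impactPhases) :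
    HasDerivAt X (S.truncField μ 0 ψ (X ψ)) ψ := by
  refine hX.hasDerivAt (hb.caratheodory 0) ?_
  refine hS.continuousAt_field (X := fun s => truncateBox (X s)) hψ ?_ ?_ ?_
  · exact ((continuous_truncate 1).comp hX.1.fst).continuousAt.prodMk
      ((continuous_truncate 8).comp hX.1.snd).continuousAt
  · exact hb.impulse_pos hS (abs_truncateBox_fst _)
  · exact ne_of_gt (hb.phaseSpeed_pos hS _ _ (abs_truncateBox_fst _) (abs_truncateBox_snd _))

/-- From solutions with independent variable `ψ` to solutions in the original time. -/
theorem exists_time_solution (hb : S.HasBounds μ C') (hS : S.IsRegular C) (hμ : μ * C' ≤ 1 / 4)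
    (hV : S.IsTimeField μ V) {X : ℝ → ℝ × ℝ} (hX : IsIntegralSolution (S.truncField μ 0) X) :
    ∃ e : ℝ → ℝ, Continuous e ∧ StrictMono e ∧ (∀ ψ, e ((ψ - (X ψ).2) / S.k) = ψ) ∧
      (∀ t, e t = (X (e t)).2 + S.k * t) ∧
      ∀ a b, (∀ t ∈ Icc a b, |(X (e t)).1| ≤ 1 ∧ |(X (e t)).2| ≤ 8) →
        ∀ s ∈ Icc a b, ∀ t ∈ Icc a b, IntervalIntegrable (fun u => V u (X (e u))) volume s t ∧
          X (e t) - X (e s) = ∫ u in s..t, V u (X (e u)) := by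
  have hk := hS.k_pos
  have hlip : ∀ a b, a ≤ b → |(X b).2 - (X a).2| ≤ 1 / 4 * (b - a) := fun a b hab => by
    have h1 := hX.norm_sub_le (hb.caratheodory 0) a b
    rw [abs_of_nonneg (sub_nonneg.2 hab)] at h1
    refine ((norm_prod_le_iff.1 h1).2).trans ?_
    have := sub_nonneg.2 hab
    gcongr
  have hcont : Continuous fun ψ => (ψ - (X ψ).2) / S.k := by
    have := hX.1
    fun_prop
  obtain ⟨e, he, hemono, hleft, hright⟩ := exists_continuous_inverse hcont
    (c := 1 / (2 * S.k)) (by positivity) fun a b hab => by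
      have h1 := (abs_le.1 (hlip a b hab)).2
      rw [← sub_div, one_div_mul_eq_div, div_le_div_iff₀ (by positivity) hk]
      nlinarith [sub_nonneg.2 hab]
  have het : ∀ t, e t = (X (e t)).2 + S.k * t := fun t => by
    have := hright t
    rw [div_eq_iff hk.ne'] at this
    linarith
  refine ⟨e, he, hemono, hleft, het, fun a b hbox s hs t ht => ?_⟩
  have hd : ∀ u ∈ Ioo a b, e u ∉ impactPhases →
      HasDerivAt (fun u => X (e u)) (V u (X (e u))) u := by
    intro u hu hne
    obtain ⟨h₁, h₂⟩ := hbox u (Ioo_subset_Icc_self hu)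
    have hXd := hb.hasDerivAt hS hX hne
    have hDpos := hb.phaseSpeed_pos hS 0 (e u) h₁ h₂
    have hed : HasDerivAt e (S.phaseSpeed μ 0 (e u) (X (e u))) u := by
      have h1 : HasDerivAt (fun ψ => (ψ - (X ψ).2) / S.k)
          ((1 - (S.truncField μ 0 (e u) (X (e u))).2) / S.k) (e u) :=
        ((hasDerivAt_id _).sub hXd.snd).div_const _
      have h2 : (1 - (S.truncField μ 0 (e u) (X (e u))).2) / S.k =
          (S.phaseSpeed μ 0 (e u) (X (e u)))⁻¹ := by
        rw [truncField, truncateBox_eq_self h₁ h₂]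
        simp only [field]
        have := hDpos.ne'
        field_simp
        ring
      rw [h2] at h1
      have := HasDerivAt.of_local_left_inverse he.continuousAt h1 (inv_ne_zero hDpos.ne')
        (Eventually.of_forall hright)
      rwa [inv_inv] at this
    have h3 := HasDerivAt.scomp u hXd hed
    have h4 : V u (X (e u)) = S.phaseSpeed μ 0 (e u) (X (e u)) •
        S.truncField μ 0 (e u) (X (e u)) := by
      rw [hV.eq u _ h₁ h₂ (by rwa [← het]), timeField_eq_smul hb hS h₁ h₂, ← het]
    rw [h4]
    exact h3
  refine integral_eq_of_hasDerivAt_off (B := 3 * S.k / 2 * (μ * C')) (s := e ⁻¹' impactPhases)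
    (hX.1.comp he) (countable_impactPhases.preimage_of_injOn hemono.injective.injOn) hd
    (fun u hu hne => ?_) hs ht
  obtain ⟨h₁, h₂⟩ := hbox u (Ioo_subset_Icc_self hu)
  rw [hV.eq u _ h₁ h₂ (by rw [← het]; exact hne), timeField_eq_smul hb hS h₁ h₂, norm_smul]
  have h5 := hb.speed 0 ((X (e u)).2 + S.k * u) (X (e u))
  rw [truncateBox_eq_self h₁ h₂, abs_le] at h5
  gcongr
  · rw [Real.norm_eq_abs, abs_le]
    constructor <;> linarith [h5.1, h5.2]
  · exact (hb.caratheodory 0).bound _ _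

/-- From solutions in the original time to solutions with independent variable `ψ`. -/
theorem exists_phase_solution (hb : S.HasBounds μ C') (hS : S.IsRegular C)
    (hV : S.IsTimeField μ V) {y : ℝ → ℝ × ℝ} (hbox : ∀ t, |(y t).1| ≤ 1 ∧ |(y t).2| ≤ 8)
    (hy : ∀ s t, IntervalIntegrable (fun u => V u (y u)) volume s t ∧
      y t - y s = ∫ u in s..t, V u (y u)) :
    ∃ X, IsIntegralSolution (S.truncField μ 0) X ∧ (∀ t, y t = X ((y t).2 + S.k * t)) ∧
      ∀ ψ, ∃ t, (y t).2 + S.k * t = ψ := by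
  have hk := hS.k_pos
  have hycont : Continuous y := by
    have h1 : y = fun t => y 0 + ∫ u in (0 : ℝ)..t, V u (y u) := by
      funext t
      rw [← (hy 0 t).2]
      abel
    rw [h1]
    exact continuous_const.add
      (intervalIntegral.continuous_primitive (fun a b => (hy a b).1) 0)
  have hsnd : ∀ a b, a ≤ b → |(y b).2 - (y a).2| ≤ S.k / 2 * (b - a) := fun a b hab => by
    have h1 := congrArg Prod.snd (hy a b).2
    rw [Prod.snd_sub] at h1
    have h2 := (ContinuousLinearMap.snd ℝ ℝ ℝ).intervalIntegral_comp_comm (hy a b).1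
    simp only [ContinuousLinearMap.coe_snd'] at h2
    rw [h1, ← h2]
    have h3 := intervalIntegral.norm_integral_le_of_norm_le_const (a := a) (b := b)
      (f := fun u => (V u (y u)).2) (C := S.k / 2)
      fun u _ => hV.bound u _ (hbox u).1 (hbox u).2
    rwa [abs_of_nonneg (sub_nonneg.2 hab)] at h3
  have hgcont : Continuous fun t => (y t).2 + S.k * t := by fun_prop
  obtain ⟨e, he, hemono, hleft, hright⟩ := exists_continuous_inverse hgcont
    (c := S.k / 2) (by positivity) fun a b hab => by
      have h1 := (abs_le.1 (hsnd a b hab)).1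
      nlinarith
  have hXcont : Continuous fun ψ => y (e ψ) := hycont.comp he
  refine ⟨fun ψ => y (e ψ), ⟨hXcont, fun a b => ?_⟩, fun t => by
    have := hleft t
    simp only at this ⊢
    rw [this], fun ψ => ⟨e ψ, hright ψ⟩⟩
  have hd : ∀ ψ ∈ Ioo (min a b) (max a b), ψ ∉ impactPhases →
      HasDerivAt (fun ψ => y (e ψ)) (S.truncField μ 0 ψ (y (e ψ))) ψ := by
    intro ψ _ hψ
    obtain ⟨h₁, h₂⟩ := hbox (e ψ)
    have hpsi : (y (e ψ)).2 + S.k * e ψ = ψ := hright ψ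
    have hDpos := hb.phaseSpeed_pos hS 0 ψ h₁ h₂
    have hyd : HasDerivAt y (S.timeField μ (e ψ) (y (e ψ))) (e ψ) := by
      have hev : ∀ᶠ u in 𝓝 (e ψ), V u (y u) = S.timeField μ u (y u) := by
        have hopen : IsOpen ((fun t => (y t).2 + S.k * t) ⁻¹' impactPhasesᶜ) :=
          isClosed_impactPhases.isOpen_compl.preimage hgcont
        filter_upwards [hopen.mem_nhds (show (y (e ψ)).2 + S.k * e ψ ∈ impactPhasesᶜ by
          rw [hpsi]; exact hψ)] with u hu
        exact hV.eq u _ (hbox u).1 (hbox u).2 hu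
      obtain ⟨c1, c2⟩ := hS.continuousAt_phaseSpeed (μ := μ) (τ := 0) (X := fun ψ => y (e ψ)) hψ
        hXcont.continuousAt (hb.impulse_pos hS h₁)
      have hQ : ContinuousAt (fun s => ((μ * (-4 * S.W (S.impulse μ (y (e s))) *
          S.damped μ 0 s (y (e s)) * S.K₁ (angle s) (S.impulse μ (y (e s)))),
          S.phaseSpeed μ 0 s (y (e s)) - S.k) : ℝ × ℝ)) ψ :=
        (continuousAt_const.mul c2).prodMk (c1.sub continuousAt_const)
      have hcomp := ContinuousAt.comp_of_eq (f := fun t => (y t).2 + S.k * t) hQ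
        (hgcont.continuousAt (x := e ψ)) hpsi
      have hc : ContinuousAt (fun u => V u (y u)) (e ψ) := by
        refine hcomp.congr ?_
        filter_upwards [hev] with u hu
        have := hleft u
        simp only [Function.comp_apply] at this ⊢
        rw [this, hu]
        rfl
      have h := intervalIntegral.integral_hasDerivAt_right (hy 0 (e ψ)).1
        (by
          have hm : StronglyMeasurableAtFilter (fun u => V u (y u)) (𝓝 (e ψ)) volume := by
            refine ⟨Ioc (e ψ - 1) (e ψ + 1), Ioc_mem_nhds (by linarith) (by linarith), ?_⟩
            have := (hy (e ψ - 1) (e ψ + 1)).1.1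
            exact this.aestronglyMeasurable
          exact hm) hc
      have e1 : y = fun t => y 0 + ∫ s in (0 : ℝ)..t, V s (y s) := by
        funext t
        rw [← (hy 0 t).2]
        abel
      have h2 := h.const_add (y 0)
      rw [← e1, hev.self_of_nhds] at h2
      exact h2
    have hed : HasDerivAt e (S.phaseSpeed μ 0 ψ (y (e ψ)))⁻¹ ψ := by
      have h1 : HasDerivAt (fun t => (y t).2 + S.k * t)
          (S.phaseSpeed μ 0 ψ (y (e ψ))) (e ψ) := by
        have hs : HasDerivAt (fun t => (y t).2) (S.timeField μ (e ψ) (y (e ψ))).2 (e ψ) := hyd.snd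
        have := hs.add ((hasDerivAt_id (e ψ)).const_mul S.k)
        simp only [timeField, hpsi, mul_one, sub_add_cancel] at this
        exact this
      exact HasDerivAt.of_local_left_inverse he.continuousAt h1 hDpos.ne'
        (Eventually.of_forall hright)
    have h3 := HasDerivAt.scomp ψ hyd hed
    rw [timeField_eq_smul hb hS h₁ h₂, hpsi, smul_smul, inv_mul_cancel₀ hDpos.ne', one_smul] at h3
    exact h3
  exact (integral_eq_of_hasDerivAt_off hXcont countable_impactPhases hd
    (fun u _ _ => (hb.caratheodory 0).bound _ _) ⟨min_le_left _ _, le_max_left _ _⟩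
    ⟨min_le_right _ _, le_max_right _ _⟩).2

end

end PhaseModel

end ImpactOscillator

namespace ImpactOscillator

open MeasureTheory Filter Topology

namespace PhaseModel

namespace IsNearResonance

variable {S : PhaseModel} {η₀ : ℝ → ℝ} {ς m M ρ Λ δ C C' K μ r : ℝ} {V : ℝ → ℝ × ℝ → ℝ × ℝ}

theorem norm_sub_le (h : S.IsNearResonance η₀ ς m M ρ Λ δ C C' K μ) {X : ℝ → ℝ × ℝ}
    (hX : IsIntegralSolution (S.truncField μ 0) X) (a b : ℝ) : ‖X b - X a‖ ≤ 1 / 4 * |b - a| :=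
  (hX.norm_sub_le (h.bounds.caratheodory 0) a b).trans (by gcongr; exact h.rate_le)

/-- A solution near the equilibrium at the sections stays near it. -/
theorem stays (h : S.IsNearResonance η₀ ς m M ρ Λ δ C C' K μ) (hr : r ≤ ρ / 8)
    (hμr : μ * C' * S.L ≤ r / 8) {X : ℝ → ℝ × ℝ} (hX : IsIntegralSolution (S.truncField μ 0) X)
    (hXr : ∀ n : ℤ, |(X (n * S.L)).1| ≤ r / 4 ∧ |(X (n * S.L)).2 - η₀ (S.slowTime μ n)| ≤ r / 4)
    (ψ : ℝ) : ∃ n : ℤ, ψ - n * S.L ∈ Ico 0 S.L ∧ |(X ψ).1| ≤ 3 * r / 8 ∧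
      |(X ψ).2 - η₀ (S.slowTime μ n)| ≤ 3 * r / 8 ∧ |(X ψ).1| ≤ 1 / 2 ∧ |(X ψ).2| ≤ 7 := by
  obtain ⟨n, hn⟩ := h.exists_floor ψ
  have h1 := hX.norm_sub_le (h.bounds.caratheodory 0) (n * S.L) ψ
  have h2 : μ * C' * |ψ - n * S.L| ≤ r / 8 := by
    refine le_trans ?_ hμr
    rw [abs_of_nonneg hn.1]
    exact mul_le_mul_of_nonneg_left hn.2.le h.rate_nonneg
  obtain ⟨h3, h4⟩ := norm_prod_le_iff.1 (h1.trans h2)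
  rw [Prod.fst_sub] at h3
  rw [Prod.snd_sub] at h4
  obtain ⟨h5, h6⟩ := hXr n
  have hρ := h.hyperbolic.ρ_le
  have hz : |(X ψ).1| ≤ 3 * r / 8 := by
    have := abs_sub_abs_le_abs_sub (X ψ).1 (X (n * S.L)).1
    linarith
  have hp : |(X ψ).2 - η₀ (S.slowTime μ n)| ≤ 3 * r / 8 := by
    have := abs_sub_le (X ψ).2 (X (n * S.L)).2 (η₀ (S.slowTime μ n))
    linarith
  refine ⟨n, hn, hz, hp, by linarith, ?_⟩
  have := h.hyperbolic.abs_le_seven hp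
  linarith

theorem η₀_slow (h : S.IsNearResonance η₀ ς m M ρ Λ δ C C' K μ) (hμ1 : μ ≤ 1)
    (hμδ : μ * ((S.L + 8) / S.k) ≤ δ) (hμΛ : Λ * (μ * ((S.L + 8) / S.k)) ≤ r / 4)
    {ψ φ t : ℝ} {n : ℤ} (hn : ψ - n * S.L ∈ Ico 0 S.L) (hφ : |φ| ≤ 8) (hψ : ψ = φ + S.k * t) :
    |η₀ (S.slowTime μ n) - η₀ (μ ^ 2 * t)| ≤ r / 4 := by
  have hk := h.regular.k_pos
  have hμ := h.bounds.pos
  have hd : |S.slowTime μ n - μ ^ 2 * t| ≤ μ * ((S.L + 8) / S.k) := by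
    have e : S.slowTime μ n - μ ^ 2 * t = -(μ ^ 2 * ((ψ - n * S.L - φ) / S.k)) := by
      have : t = (ψ - φ) / S.k := by rw [hψ]; field_simp; ring
      rw [this, slowTime]
      field_simp
      ring
    rw [e, abs_neg, abs_mul, abs_of_pos (pow_pos hμ 2), abs_div, abs_of_pos hk]
    have h1 : |ψ - n * S.L - φ| ≤ S.L + 8 := by
      refine (abs_sub _ _).trans (add_le_add ?_ hφ)
      rw [abs_of_nonneg hn.1]
      exact hn.2.le
    gcongr
    rw [sq]
    exact mul_le_of_le_one_left hμ.le hμ1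
  refine (h.hyperbolic.lip _ _ (hd.trans hμδ)).trans (le_trans ?_ hμΛ)
  have := h.hyperbolic.Λ_nonneg
  gcongr

/-- Existence, uniqueness and instability for a given small `μ`. -/
theorem exists_unique_unstable {Ω Δ γ k Jpq : ℝ} {f : ℝ → ℝ → ℝ}
    (h : S.IsNearResonance η₀ ς m M ρ Λ δ C C' K μ) (hr0 : 0 < r) (hr : r ≤ ρ / 8)
    (hμr : μ * C' * S.L ≤ r / 8) (hμK : 4 * K * μ ≤ m * (r / 4)) (hμ1 : μ ≤ 1)
    (hμδ : μ * ((S.L + 8) / S.k) ≤ δ) (hμΛ : Λ * (μ * ((S.L + 8) / S.k)) ≤ r / 4)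
    (hV : S.IsTimeField μ (resonanceField Ω Δ γ k f Jpq μ)) (hJ : S.J₀ = Jpq) :
    ∃ x : ℝ → ℝ × ℝ,
      (IsSolutionOn Ω Δ γ k f Jpq μ univ x ∧ IsAlmostPeriodic x ∧ StaysNear η₀ μ r x) ∧
      (∀ y : ℝ → ℝ × ℝ, IsSolutionOn Ω Δ γ k f Jpq μ univ y → IsAlmostPeriodic y →
        StaysNear η₀ μ r y → y = x) ∧
      IsUnstable Ω Δ γ k f Jpq μ x := by
  have hk := h.regular.k_pos
  have hL := h.regular.L_pos
  have hL6 := h.six_le_L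
  have hρ := h.hyperbolic.ρ_le
  have hρ0 := h.hyperbolic.ρ_pos
  have hpos : ∀ x : ℝ × ℝ, |x.1| ≤ 1 → 0 < Jpq + μ * x.1 := fun x hx => by
    have := h.bounds.impulse_pos h.regular hx
    rwa [impulse, hJ] at this
  obtain ⟨o, ho, hoc⟩ := h.saddle.exists_orbit (r := r / 4) (by linarith) hμK
  obtain ⟨X, hX, hXo⟩ := h.exists_solution_of_orbit ho
  have hXr : ∀ n : ℤ, |(X (n * S.L)).1| ≤ r / 4 ∧
      |(X (n * S.L)).2 - η₀ (S.slowTime μ n)| ≤ r / 4 := fun n => by rw [hXo]; exact hoc n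
  have hXρ : ∀ n : ℤ, |(X (n * S.L)).1| ≤ ρ / 4 ∧
      |(X (n * S.L)).2 - η₀ (S.slowTime μ n)| ≤ ρ / 4 := fun n =>
    ⟨(hXr n).1.trans (by linarith), (hXr n).2.trans (by linarith)⟩
  have hstay := h.stays hr hμr hX hXr
  have hbox : ∀ ψ, |(X ψ).1| ≤ 1 / 2 ∧ |(X ψ).2| ≤ 7 := fun ψ => by
    obtain ⟨n, -, -, -, h1, h2⟩ := hstay ψ
    exact ⟨h1, h2⟩
  obtain ⟨e, he, hemono, hleft, het, hsol⟩ :=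
    exists_time_solution h.bounds h.regular h.rate_le hV hX
  refine ⟨fun t => X (e t), ⟨⟨fun t _ => hpos _ ((hbox _).1.trans (by norm_num)),
    fun s _ t _ => ?_⟩, ⟨hX.1.comp he, fun ε hε => ?_⟩, fun t => ?_⟩, fun y hy _ hynear => ?_,
    fun t₀ => ?_⟩
  · exact hsol (min s t) (max s t)
      (fun u _ => ⟨(hbox _).1.trans (by norm_num), (hbox _).2.trans (by norm_num)⟩)
      s ⟨min_le_left _ _, le_max_left _ _⟩ t ⟨min_le_right _ _, le_max_right _ _⟩
  · obtain ⟨l, hl, hap⟩ := h.almostPeriods hX hXρ (ε := ε / 2) (by positivity)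
    refine ⟨l, hl, fun a => ?_⟩
    obtain ⟨j, hj, hjX⟩ := hap a
    refine ⟨j * (S.L / S.k), hj, fun t => ?_⟩
    rw [dist_eq_norm]
    set T := (j : ℝ) * (S.L / S.k) with hT
    have hkT : S.k * T = j * S.L := by rw [hT]; field_simp
    have h1 := hjX (e t)
    have h2 := h.norm_sub_le hX (e t + j * S.L) (e (t + T))
    have h3 : e (t + T) - (e t + j * S.L) = (X (e (t + T)) - X (e t)).2 := by
      have e1 := het (t + T)
      have e2 := het t
      rw [Prod.snd_sub]
      linarith
    rw [h3] at h2
    have h4 := (norm_prod_le_iff.1 (le_refl ‖X (e (t + T)) - X (e t)‖)).2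
    have h5 := norm_add_le (X (e (t + T)) - X (e t + j * S.L)) (X (e t + j * S.L) - X (e t))
    rw [sub_add_sub_cancel] at h5
    linarith
  · obtain ⟨n, hn, h1, h2, -, h3⟩ := hstay (e t)
    have h4 := h.η₀_slow hμ1 hμδ hμΛ hn (h3.trans (by norm_num)) (het t)
    have h5 := abs_sub_le (X (e t)).2 (η₀ (S.slowTime μ n)) (η₀ (μ ^ 2 * t))
    simp only
    constructor <;> linarith
  · have hybox : ∀ t, |(y t).1| ≤ 1 ∧ |(y t).2| ≤ 8 := fun t => by
      obtain ⟨h1, h2⟩ := hynear t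
      have := h.hyperbolic.abs_le_seven h2.le
      constructor <;> linarith
    obtain ⟨Y, hY, hyY, hsurj⟩ := exists_phase_solution h.bounds h.regular hV hybox
      fun s t => hy.2 s (mem_univ _) t (mem_univ _)
    have hYX : Y = X := by
      refine h.unique hY hX (fun n => ?_) fun n =>
        ⟨(hXρ n).1.trans (by linarith), (hXρ n).2.trans (by linarith)⟩
      obtain ⟨t, ht⟩ := hsurj (n * S.L)
      rw [← ht, ← hyY t]
      obtain ⟨h1, h2⟩ := hynear t
      have h3 := h.η₀_slow (n := n) hμ1 hμδ hμΛ (by rw [ht, sub_self]; exact ⟨le_rfl, hL⟩)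
        (hybox t).2 rfl
      have h4 := abs_sub_le (y t).2 (η₀ (μ ^ 2 * t)) (η₀ (S.slowTime μ n))
      rw [abs_sub_comm] at h3
      constructor <;> linarith
    funext t
    have h1 := hyY t
    rw [hYX] at h1
    have h2 := hleft ((y t).2 + S.k * t)
    rw [← h1, add_sub_cancel_left, mul_div_cancel_left₀ _ hk.ne'] at h2
    rw [h2]
    exact h1
  · set ε₁ := ρ / 16 with hε₁
    have hε₁0 : 0 < ε₁ := by positivity
    refine ⟨ε₁ / 2, by positivity, fun d' hd' => ?_⟩
    obtain ⟨d, hd, hdε, hdd⟩ : ∃ d : ℝ, 0 < d ∧ 8 * d < ε₁ ∧ 64 * d ≤ d' :=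
      ⟨min (ε₁ / 16) (d' / 64), by positivity,
        by linarith [min_le_left (ε₁ / 16) (d' / 64)],
        by linarith [min_le_right (ε₁ / 16) (d' / 64)]⟩
    obtain ⟨n, hn⟩ := h.exists_floor (e t₀)
    obtain ⟨Y, hY, N, hN, hclose, hfar, hend⟩ := h.escape hX hXρ (n - 1) hd hdε (by linarith)
    obtain ⟨e', he', hemono', hleft', het', hsol'⟩ :=
      exists_time_solution h.bounds h.regular h.rate_le hV hY
    push_cast at hclose hfar hend
    set a : ℝ := ((n : ℝ) - 1) * S.L with ha
    have hn1 := hn.1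
    have hn2 := hn.2
    have hN' : (4 : ℝ) ≤ N := by exact_mod_cast hN
    have hmem : ∀ b ∈ Icc a (((n : ℝ) - 1 + 3) * S.L), |b - e t₀| ≤ 2 * S.L →
        |(Y b).2 - (X (e t₀)).2| ≤ 1 := by
      intro b hb hbe
      have h1 := (norm_prod_le_iff.1 (hclose b hb)).2
      have h2 := hX.norm_sub_le (h.bounds.caratheodory 0) (e t₀) b
      have h3 : μ * C' * |b - e t₀| ≤ 1 / 2 := by
        calc μ * C' * |b - e t₀| ≤ μ * C' * (2 * S.L) :=
              mul_le_mul_of_nonneg_left hbe h.rate_nonneg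
          _ = 2 * (μ * C' * S.L) := by ring
          _ ≤ _ := by linarith [h.small]
      have h4 := (norm_prod_le_iff.1 (h2.trans h3)).2
      rw [Prod.snd_sub] at h1 h4
      have := abs_sub_le (Y b).2 (X b).2 (X (e t₀)).2
      linarith
    have het₀ := het t₀
    have hlow : a ≤ e' t₀ := by
      have h1 := hmem a ⟨le_rfl, by rw [ha]; nlinarith⟩ (by
        rw [abs_le]; constructor <;> rw [ha] <;> linarith)
      rw [← hleft' a]
      refine hemono'.monotone ?_
      rw [div_le_iff₀ hk]
      have := (abs_le.1 h1).1
      have : a = n * S.L - S.L := by rw [ha]; ring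
      linarith
    have hup : e' t₀ ≤ ((n : ℝ) - 1 + 3) * S.L := by
      have h1 := hmem (((n : ℝ) - 1 + 3) * S.L) ⟨by rw [ha]; nlinarith, le_rfl⟩ (by
        rw [abs_le]; constructor <;> linarith)
      rw [← hleft' (((n : ℝ) - 1 + 3) * S.L)]
      refine hemono'.monotone ?_
      rw [le_div_iff₀ hk]
      have := (abs_le.1 h1).2
      linarith
    set ψN : ℝ := ((n : ℝ) - 1 + N) * S.L with hψN
    set t₁ := (ψN - (Y ψN).2) / S.k with ht₁
    have het₁ : e' t₁ = ψN := hleft' ψN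
    have hlt : ((n : ℝ) - 1 + 3) * S.L ≤ ψN := by rw [hψN]; gcongr; linarith
    have ht01 : t₀ ≤ t₁ := by
      rw [← hemono'.le_iff_le, het₁]
      exact hup.trans hlt
    have hYbox : ∀ t ∈ Icc t₀ t₁, |(Y (e' t)).1| ≤ 1 ∧ |(Y (e' t)).2| ≤ 8 := by
      intro t ht
      have h1 := hfar (e' t) ⟨hlow.trans (hemono'.monotone ht.1), by
        rw [← het₁]; exact hemono'.monotone ht.2⟩
      obtain ⟨h2, h3⟩ := norm_prod_le_iff.1 h1
      rw [Prod.fst_sub] at h2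
      rw [Prod.snd_sub] at h3
      have h4 := abs_sub_abs_le_abs_sub (Y (e' t)).1 (X (e' t)).1
      have h5 := abs_sub_abs_le_abs_sub (Y (e' t)).2 (X (e' t)).2
      have h6 := hbox (e' t)
      constructor <;> linarith [h6.1, h6.2]
    refine ⟨t₁, ht01, fun t => Y (e' t), ⟨fun t ht => hpos _ (hYbox t ht).1,
      fun s hs t ht => hsol' t₀ t₁ hYbox s hs t ht⟩, ?_, ?_⟩
    · rw [dist_eq_norm]
      have h1 := hclose (e' t₀) ⟨hlow, hup⟩
      have h2 := h.norm_sub_le hX (e t₀) (e' t₀)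
      have h3 : e' t₀ - e t₀ = (Y (e' t₀) - X (e t₀)).2 := by
        have := het' t₀
        rw [Prod.snd_sub]
        linarith
      rw [h3] at h2
      have h4 := (norm_prod_le_iff.1 (le_refl ‖Y (e' t₀) - X (e t₀)‖)).2
      have h5 := norm_add_le (Y (e' t₀) - X (e' t₀)) (X (e' t₀) - X (e t₀))
      rw [sub_add_sub_cancel] at h5
      linarith
    · rw [dist_eq_norm]
      simp only
      have h2 := h.norm_sub_le hX ψN (e t₁)
      have h3 : ψN - e t₁ = (Y (e' t₁) - X (e t₁)).2 := by
        have e1 := het' t₁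
        have e2 := het t₁
        rw [Prod.snd_sub]
        linarith
      rw [abs_sub_comm, h3] at h2
      have h4 := (norm_prod_le_iff.1 (le_refl ‖Y (e' t₁) - X (e t₁)‖)).2
      have h5 := norm_add_le (Y (e' t₁) - X (e t₁)) (X (e t₁) - X ψN)
      rw [sub_add_sub_cancel, het₁] at h5
      rw [het₁] at h2 h4 ⊢
      linarith

end IsNearResonance

end PhaseModel

end ImpactOscillator

namespace ImpactOscillator

open MeasureTheory Filter Topology

noncomputable section

/-- The ratio `Ω₀ = Ω / ω₀(J)`. -/
def freqRatio (Ω Δ J : ℝ) : ℝ := Ω / omega0 Ω Δ J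

theorem freqRatio_eq {Ω Δ : ℝ} (hΩ : 0 < Ω) (hΔ : Δ ≠ 0) (J : ℝ) :
    freqRatio Ω Δ J = (if 0 < Δ then 1 else 0) - arctan (J / (2 * Ω * Δ)) / π := by
  have hπ := pi_pos
  rcases lt_or_gt_of_ne hΔ with h | h
  · rw [freqRatio, omega0, if_neg h.not_gt, if_pos h, if_neg h.not_gt]
    by_cases ha : arctan (J / (2 * Ω * Δ)) = 0
    · simp [ha]
    · field_simp
      ring
  · rw [freqRatio, omega0, if_pos h, if_pos h]
    have : π - arctan (J / (2 * Ω * Δ)) ≠ 0 := by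
      have := arctan_lt_pi_div_two (J / (2 * Ω * Δ))
      intro h0
      linarith
    field_simp

theorem omega0_eq {Ω Δ : ℝ} (hΩ : 0 < Ω) (J : ℝ) : omega0 Ω Δ J = Ω / freqRatio Ω Δ J := by
  rw [freqRatio, div_div_cancel₀ hΩ.ne']

theorem freqRatio_mem {Ω Δ : ℝ} (hΩ : 0 < Ω) (hΔ : Δ ≠ 0) {J : ℝ} (hJ : 0 < J) :
    0 < freqRatio Ω Δ J ∧ freqRatio Ω Δ J < 1 := by
  have hπ := pi_pos
  rw [freqRatio_eq hΩ hΔ]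
  have h1 := arctan_lt_pi_div_two (J / (2 * Ω * Δ))
  have h2 := neg_pi_div_two_lt_arctan (J / (2 * Ω * Δ))
  rcases lt_or_gt_of_ne hΔ with h | h
  · have h3 : arctan (J / (2 * Ω * Δ)) < 0 :=
      arctan_lt_zero.2 (div_neg_of_pos_of_neg hJ (by nlinarith))
    rw [if_neg h.not_gt]
    constructor
    · rw [zero_sub, neg_pos]
      exact div_neg_of_neg_of_pos h3 hπ
    · rw [zero_sub, ← neg_div, div_lt_one hπ]
      linarith
  · have h3 : 0 < arctan (J / (2 * Ω * Δ)) := arctan_pos.2 (by positivity)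
    rw [if_pos h]
    constructor
    · rw [sub_pos, div_lt_one hπ]
      linarith
    · rw [sub_lt_self_iff]
      positivity

theorem contDiff_freqRatio {Ω Δ : ℝ} (hΩ : 0 < Ω) (hΔ : Δ ≠ 0) {n : ℕ∞} :
    ContDiff ℝ n (freqRatio Ω Δ) := by
  have e : freqRatio Ω Δ = fun J => (if 0 < Δ then 1 else 0) - arctan (J / (2 * Ω * Δ)) / π :=
    funext fun J => freqRatio_eq hΩ hΔ J
  rw [e]
  exact contDiff_const.sub ((contDiff_id.div_const _).arctan.div_const _)

theorem sin_freqRatio_pos {Ω Δ : ℝ} (hΩ : 0 < Ω) (hΔ : Δ ≠ 0) {J : ℝ} (hJ : 0 < J) :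
    0 < sin (π * freqRatio Ω Δ J) := by
  obtain ⟨h1, h2⟩ := freqRatio_mem hΩ hΔ hJ
  exact sin_pos_of_pos_of_lt_pi (mul_pos pi_pos h1) (by nlinarith [pi_pos])

theorem contDiffOn_omega0 {Ω Δ : ℝ} (hΩ : 0 < Ω) (hΔ : Δ ≠ 0) {n : ℕ∞} :
    ContDiffOn ℝ n (omega0 Ω Δ) (Ioi 0) := by
  have e : omega0 Ω Δ = fun J => Ω / freqRatio Ω Δ J := funext fun J => omega0_eq hΩ J
  rw [e]
  exact contDiffOn_const.div (contDiff_freqRatio hΩ hΔ).contDiffOn fun J hJ =>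
    ne_of_gt (freqRatio_mem hΩ hΔ hJ).1

/-- `κ_ψ` on `[0, 2π]`, with one-sided derivatives at the ends. -/
def kernelPsi (Ω Δ θ J : ℝ) : ℝ :=
  -(freqRatio Ω Δ J * sin (freqRatio Ω Δ J * (θ - π))) / (2 * Ω * sin (π * freqRatio Ω Δ J))

/-- `-J κ` on `[0, 2π]`. -/
def displacement (Ω Δ : ℝ) (y : ℝ × ℝ) : ℝ :=
  -y.2 * (cos (freqRatio Ω Δ y.2 * (y.1 - π)) / (2 * Ω * sin (π * freqRatio Ω Δ y.2)))

/-- `(-J κ)_J` on `[0, 2π]`. -/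
def kernelJ (Ω Δ θ J : ℝ) : ℝ := deriv (fun K => displacement Ω Δ (θ, K)) J

theorem contDiffOn_kernelPsi {Ω Δ : ℝ} (hΩ : 0 < Ω) (hΔ : Δ ≠ 0) {n : ℕ∞} :
    ContDiffOn ℝ n (fun y : ℝ × ℝ => kernelPsi Ω Δ y.1 y.2) (univ ×ˢ Ioi 0) := by
  have hr : ContDiff ℝ n fun y : ℝ × ℝ => freqRatio Ω Δ y.2 :=
    (contDiff_freqRatio hΩ hΔ).comp contDiff_snd
  refine ContDiffOn.div ?_ ?_ fun y hy => ?_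
  · exact (hr.mul (hr.mul (contDiff_fst.sub contDiff_const)).sin).neg.contDiffOn
  · exact (contDiff_const.mul (contDiff_const.mul hr).sin).contDiffOn
  · have := sin_freqRatio_pos hΩ hΔ hy.2
    positivity

theorem contDiffOn_displacement {Ω Δ : ℝ} (hΩ : 0 < Ω) (hΔ : Δ ≠ 0) {n : ℕ∞} :
    ContDiffOn ℝ n (displacement Ω Δ) (univ ×ˢ Ioi 0) := by
  have hr : ContDiff ℝ n fun y : ℝ × ℝ => freqRatio Ω Δ y.2 :=
    (contDiff_freqRatio hΩ hΔ).comp contDiff_snd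
  refine contDiff_snd.neg.contDiffOn.mul (ContDiffOn.div ?_ ?_ fun y hy => ?_)
  · exact (hr.mul (contDiff_fst.sub contDiff_const)).cos.contDiffOn
  · exact (contDiff_const.mul (contDiff_const.mul hr).sin).contDiffOn
  · have := sin_freqRatio_pos hΩ hΔ hy.2
    positivity

theorem isOpen_posImpulse : IsOpen ((univ : Set ℝ) ×ˢ Ioi (0 : ℝ)) := isOpen_univ.prod isOpen_Ioi

theorem contDiffOn_kernelJ {Ω Δ : ℝ} (hΩ : 0 < Ω) (hΔ : Δ ≠ 0) :
    ContDiffOn ℝ 1 (fun y : ℝ × ℝ => kernelJ Ω Δ y.1 y.2) (univ ×ˢ Ioi 0) := by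
  have h2 : ContDiffOn ℝ 2 (displacement Ω Δ) (univ ×ˢ Ioi 0) :=
    contDiffOn_displacement (n := 2) hΩ hΔ
  have h1 := h2.fderiv_of_isOpen isOpen_posImpulse (m := 1) (by norm_num)
  have h3 : ContDiffOn ℝ 1 (fun y => fderiv ℝ (displacement Ω Δ) y ((0, 1) : ℝ × ℝ))
      (univ ×ˢ Ioi 0) := h1.clm_apply contDiffOn_const
  refine h3.congr fun y hy => ?_
  have hd : HasFDerivAt (displacement Ω Δ) (fderiv ℝ (displacement Ω Δ) y) (y.1, y.2) :=
    ((h2.contDiffAt (isOpen_posImpulse.mem_nhds hy)).differentiableAt (by norm_num)).hasFDerivAt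
  have hc : HasDerivAt (fun K : ℝ => (y.1, K)) ((0, 1) : ℝ × ℝ) y.2 :=
    (hasDerivAt_const _ _).prodMk (hasDerivAt_id _)
  exact (hd.comp_hasDerivAt y.2 hc).deriv

theorem deriv_mul_kappa (Ω Δ ψ J : ℝ) :
    deriv (fun K => -K * kappa Ω Δ ψ K) J = kernelJ Ω Δ (PhaseModel.angle ψ) J := rfl

theorem angle_eq_sub {s : ℝ} {n : ℤ} (h : s ∈ Ico (n * (2 * π)) ((n + 1) * (2 * π))) :
    PhaseModel.angle s = s - n * (2 * π) := by
  have h1 : PhaseModel.angle (s - n * (2 * π)) = s - n * (2 * π) :=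
    (toIcoMod_eq_self two_pi_pos).2 ⟨by linarith [h.1], by linarith [h.2]⟩
  rw [← h1, ← PhaseModel.angle_add_int (s - n * (2 * π)) n, sub_add_cancel]

theorem exists_mem_Ico (ψ : ℝ) : ∃ n : ℤ, ψ ∈ Ico (n * (2 * π)) ((n + 1) * (2 * π)) := by
  have hπ := two_pi_pos
  refine ⟨⌊ψ / (2 * π)⌋, ?_, ?_⟩
  · have := Int.floor_le (ψ / (2 * π))
    rwa [le_div_iff₀ hπ] at this
  · have := Int.lt_floor_add_one (ψ / (2 * π))
    rwa [div_lt_iff₀ hπ] at this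

theorem hasDerivAt_kernel (Ω Δ J c ψ : ℝ) :
    HasDerivAt (fun s => cos (freqRatio Ω Δ J * (s - c - π)) /
      (2 * Ω * sin (π * freqRatio Ω Δ J))) (kernelPsi Ω Δ (ψ - c) J) ψ := by
  have h1 : HasDerivAt (fun s => freqRatio Ω Δ J * (s - c - π)) (freqRatio Ω Δ J) ψ := by
    have := (((hasDerivAt_id ψ).sub_const c).sub_const π).const_mul (freqRatio Ω Δ J)
    rwa [mul_one] at this
  have h2 := h1.cos.div_const (2 * Ω * sin (π * freqRatio Ω Δ J))
  refine h2.congr_deriv ?_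
  rw [kernelPsi]
  ring

theorem hasDerivAt_kappa {Ω Δ J ψ : ℝ} (hψ : ψ ∉ impactPhases) :
    HasDerivAt (fun s => kappa Ω Δ s J) (kernelPsi Ω Δ (PhaseModel.angle ψ) J) ψ := by
  obtain ⟨n, hn⟩ := exists_mem_Ico ψ
  have hlt : (n : ℝ) * (2 * π) < ψ := lt_of_le_of_ne hn.1 fun h => hψ ⟨n, h⟩
  rw [angle_eq_sub hn]
  refine (hasDerivAt_kernel Ω Δ J (n * (2 * π)) ψ).congr_of_eventuallyEq ?_
  filter_upwards [Ioo_mem_nhds hlt hn.2] with s hs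
  change cos (freqRatio Ω Δ J * (PhaseModel.angle s - π)) / _ = _
  rw [angle_eq_sub (Ioo_subset_Ico_self hs)]
  rfl

theorem kappaPsi_eq {Ω Δ J ψ : ℝ} (hψ : ψ ∉ impactPhases) :
    kappaPsi Ω Δ ψ J = kernelPsi Ω Δ (PhaseModel.angle ψ) J := (hasDerivAt_kappa hψ).deriv

theorem kappaPsi_eq_or (Ω Δ ψ J : ℝ) :
    kappaPsi Ω Δ ψ J = kernelPsi Ω Δ (PhaseModel.angle ψ) J ∨ kappaPsi Ω Δ ψ J = 0 := by
  by_cases hd : DifferentiableAt ℝ (fun s => kappa Ω Δ s J) ψ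
  · left
    obtain ⟨n, hn⟩ := exists_mem_Ico ψ
    rw [angle_eq_sub hn]
    have h1 : HasDerivWithinAt (fun s => kappa Ω Δ s J)
        (kernelPsi Ω Δ (ψ - n * (2 * π)) J) (Ici ψ) ψ := by
      refine (hasDerivAt_kernel Ω Δ J (n * (2 * π)) ψ).hasDerivWithinAt.congr_of_eventuallyEq ?_ ?_
      · filter_upwards [self_mem_nhdsWithin, mem_nhdsWithin_of_mem_nhds (Iio_mem_nhds hn.2)]
          with s hs hs'
        change cos (freqRatio Ω Δ J * (PhaseModel.angle s - π)) / _ = _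
        rw [angle_eq_sub ⟨hn.1.trans hs, hs'⟩]
        rfl
      · change cos (freqRatio Ω Δ J * (PhaseModel.angle ψ - π)) / _ = _
        rw [angle_eq_sub hn]
        rfl
    exact (uniqueDiffWithinAt_Ici ψ).eq_deriv _ hd.hasDerivAt.hasDerivWithinAt h1
  · right
    exact deriv_zero_of_not_differentiableAt hd

/-- Bounds on a force that is smooth with bounded derivatives. -/
structure IsSmoothForce (f : ℝ → ℝ → ℝ) (C : ℝ) : Prop where
  bound : ∀ t τ, |f t τ| ≤ C
  diff : ∀ t τ t' τ' a b a' b', |f (t + a) (τ + b) - f t τ - (f (t' + a') (τ' + b') - f t' τ')| ≤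
    C * (|a - a'| + |b - b'|) + C * (|a| + |b|) * (|t - t'| + |τ - τ'|)

theorem abs_sin_diff_le (x y a b : ℝ) :
    |sin (x + a) - sin x - (sin (y + b) - sin y)| ≤ |a - b| + |a| * |x - y| := by
  have h1 : |sin (y + a) - sin (y + b)| ≤ |a - b| := by
    have := abs_sin_sub_sin_le (y + a) (y + b)
    rwa [add_sub_add_left_eq_sub] at this
  have h2 : |(sin (x + a) - sin x) - (sin (y + a) - sin y)| ≤ |a| * |x - y| := by
    have hd : ∀ z ∈ (univ : Set ℝ), HasDerivWithinAt (fun z => sin (z + a) - sin z)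
        (cos (z + a) - cos z) univ z := fun z _ =>
      ((((hasDerivAt_id z).add_const a).sin).sub (hasDerivAt_sin z)).hasDerivWithinAt.congr_deriv
        (by simp)
    have hb : ∀ z ∈ (univ : Set ℝ), ‖cos (z + a) - cos z‖ ≤ |a| := fun z _ => by
      have := abs_cos_sub_cos_le (z + a) z
      rwa [add_sub_cancel_left] at this
    exact convex_univ.norm_image_sub_le_of_norm_hasDerivWithin_le hd hb (mem_univ y) (mem_univ x)
  have e : sin (x + a) - sin x - (sin (y + b) - sin y) =
      (sin (y + a) - sin (y + b)) + ((sin (x + a) - sin x) - (sin (y + a) - sin y)) := by ring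
  rw [e]
  exact (abs_add_le _ _).trans (add_le_add h1 h2)

theorem isSmoothForce_sin (A α β θ : ℝ) :
    ∃ C, IsSmoothForce (fun t τ => A * sin (α * t + β * τ + θ)) C := by
  set k := |α| + |β| with hk
  have hk0 : 0 ≤ k := by positivity
  have hlin : ∀ a b, |α * a + β * b| ≤ k * (|a| + |b|) := fun a b => by
    refine (abs_add_le _ _).trans ?_
    rw [abs_mul, abs_mul, hk]
    nlinarith [abs_nonneg α, abs_nonneg β, abs_nonneg a, abs_nonneg b,
      mul_nonneg (abs_nonneg α) (abs_nonneg b), mul_nonneg (abs_nonneg β) (abs_nonneg a)]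
  refine ⟨|A| * (1 + k + k * k), fun t τ => ?_, fun t τ t' τ' a b a' b' => ?_⟩
  · rw [abs_mul]
    gcongr
    refine (abs_sin_le_one _).trans ?_
    nlinarith
  · have h := abs_sin_diff_le (α * t + β * τ + θ) (α * t' + β * τ' + θ) (α * a + β * b)
      (α * a' + β * b')
    have e : A * sin (α * (t + a) + β * (τ + b) + θ) - A * sin (α * t + β * τ + θ) -
        (A * sin (α * (t' + a') + β * (τ' + b') + θ) - A * sin (α * t' + β * τ' + θ)) =
        A * (sin (α * t + β * τ + θ + (α * a + β * b)) - sin (α * t + β * τ + θ) -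
        (sin (α * t' + β * τ' + θ + (α * a' + β * b')) - sin (α * t' + β * τ' + θ))) := by
      rw [show α * (t + a) + β * (τ + b) + θ = α * t + β * τ + θ + (α * a + β * b) by ring,
        show α * (t' + a') + β * (τ' + b') + θ = α * t' + β * τ' + θ + (α * a' + β * b') by ring]
      ring
    rw [e, abs_mul]
    have h1 : |α * a + β * b - (α * a' + β * b')| ≤ k * (|a - a'| + |b - b'|) := by
      have := hlin (a - a') (b - b')
      rwa [show α * (a - a') + β * (b - b') = α * a + β * b - (α * a' + β * b') by ring] at this
    have h2 : |α * t + β * τ + θ - (α * t' + β * τ' + θ)| ≤ k * (|t - t'| + |τ - τ'|) := by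
      have := hlin (t - t') (τ - τ')
      rwa [show α * (t - t') + β * (τ - τ') =
        α * t + β * τ + θ - (α * t' + β * τ' + θ) by ring] at this
    set p := |a - a'| + |b - b'|
    set q := |a| + |b| with hq
    set s := |t - t'| + |τ - τ'| with hs
    have hp0 : 0 ≤ p := by positivity
    have hq0 : 0 ≤ q := by positivity
    have hs0 : 0 ≤ s := by positivity
    calc _ ≤ |A| * (k * p + (k * q) * (k * s)) := by
          gcongr
          refine h.trans (add_le_add h1 ?_)
          exact mul_le_mul (hlin a b) h2 (abs_nonneg _) (by positivity)
      _ ≤ |A| * ((1 + k + k * k) * p + (1 + k + k * k) * (q * s)) := by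
          have h3 : k * p ≤ (1 + k + k * k) * p := by nlinarith
          have h4 : (k * q) * (k * s) ≤ (1 + k + k * k) * (q * s) := by
            nlinarith [mul_nonneg hq0 hs0, mul_nonneg hk0 (mul_nonneg hq0 hs0)]
          gcongr
      _ = _ := by ring

theorem IsSmoothForce.add {f g : ℝ → ℝ → ℝ} {C D : ℝ} (hf : IsSmoothForce f C)
    (hg : IsSmoothForce g D) : IsSmoothForce (fun t τ => f t τ + g t τ) (C + D) where
  bound t τ := (abs_add_le _ _).trans (add_le_add (hf.bound t τ) (hg.bound t τ))
  diff t τ t' τ' a b a' b' := by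
    have h1 := hf.diff t τ t' τ' a b a' b'
    have h2 := hg.diff t τ t' τ' a b a' b'
    have e : f (t + a) (τ + b) + g (t + a) (τ + b) - (f t τ + g t τ) -
        (f (t' + a') (τ' + b') + g (t' + a') (τ' + b') - (f t' τ' + g t' τ')) =
        (f (t + a) (τ + b) - f t τ - (f (t' + a') (τ' + b') - f t' τ')) +
        (g (t + a) (τ + b) - g t τ - (g (t' + a') (τ' + b') - g t' τ')) := by ring
    rw [e]
    refine (abs_add_le _ _).trans ((add_le_add h1 h2).trans (le_of_eq ?_))
    ring

theorem IsBiharmonicForce.isSmoothForce {ν : ℝ} {f : ℝ → ℝ → ℝ} (hf : IsBiharmonicForce ν f) :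
    ∃ C, IsSmoothForce f C := by
  rcases hf with ⟨a₁, a₂, Γ, -, -, -, -, -, rfl⟩ | ⟨A, B, Γ, θ, rfl⟩
  · obtain ⟨C, hC⟩ := isSmoothForce_sin a₁ ν 0 0
    obtain ⟨D, hD⟩ := isSmoothForce_sin a₂ ν Γ 0
    refine ⟨C + D, ?_⟩
    convert hC.add hD using 3
    simp [closeForce]
  · obtain ⟨C, hC⟩ := isSmoothForce_sin A ν 0 θ
    obtain ⟨D, hD⟩ := isSmoothForce_sin B 0 Γ 0
    refine ⟨C + D, ?_⟩
    convert hC.add hD using 3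
    simp [distantForce]

theorem IsBiharmonicForce.periodic {ν : ℝ} {f : ℝ → ℝ → ℝ} (hf : IsBiharmonicForce ν f)
    {T : ℝ} {n : ℤ} (hT : ν * T = n * (2 * π)) (t τ : ℝ) : f (t + T) τ = f t τ := by
  rcases hf with ⟨a₁, a₂, Γ, -, -, -, -, -, rfl⟩ | ⟨A, B, Γ, θ, rfl⟩
  · simp only [closeForce]
    rw [mul_add, hT, add_right_comm _ (_ * _) (Γ * τ), sin_add_int_mul_two_pi,
      sin_add_int_mul_two_pi]
  · simp only [distantForce]
    rw [mul_add, hT, add_right_comm, sin_add_int_mul_two_pi]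

theorem IsBiharmonicForce.slow_periodic {ν : ℝ} {f : ℝ → ℝ → ℝ} (hf : IsBiharmonicForce ν f) :
    ∃ P > 0, ∀ t τ, f t (τ + P) = f t τ := by
  rcases hf with ⟨a₁, a₂, Γ, -, -, -, -, hΓ, rfl⟩ | ⟨A, B, Γ, θ, rfl⟩
  · refine ⟨2 * π / Γ, by positivity, fun t τ => ?_⟩
    simp only [closeForce]
    rw [mul_add, mul_div_cancel₀ _ hΓ.ne', ← add_assoc, sin_add_two_pi]
  · by_cases hΓ : Γ = 0
    · exact ⟨1, one_pos, fun t τ => by simp [distantForce, hΓ]⟩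
    · refine ⟨2 * π / |Γ|, by positivity, fun t τ => ?_⟩
      simp only [distantForce]
      rcases abs_cases Γ with ⟨h, -⟩ | ⟨h, -⟩ <;> rw [h, mul_add]
      · rw [mul_div_cancel₀ _ hΓ, sin_add_two_pi]
      · rw [div_neg, mul_neg, mul_div_cancel₀ _ hΓ, ← sub_eq_add_neg, sin_sub_two_pi]

end

end ImpactOscillator

namespace ImpactOscillator

open MeasureTheory Filter Topology

noncomputable section

section Model

variable {Ω Δ : ℝ}

theorem exists_bound_lipschitz {g : ℝ × ℝ → ℝ} (hg : ContDiffOn ℝ 1 g (univ ×ˢ Ioi 0)) {a b : ℝ}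
    (ha : 0 < a) :
    ∃ C, ∀ θ ∈ Icc 0 (2 * π), ∀ J ∈ Icc a b, |g (θ, J)| ≤ C ∧
      ∀ J' ∈ Icc a b, |g (θ, J) - g (θ, J')| ≤ C * |J - J'| := by
  have hsub : Icc 0 (2 * π) ×ˢ Icc a b ⊆ univ ×ˢ Ioi 0 :=
    prod_mono (subset_univ _) fun J hJ => ha.trans_le hJ.1
  have hcpt : IsCompact (Icc 0 (2 * π) ×ˢ Icc a b) := isCompact_Icc.prod isCompact_Icc
  obtain ⟨B, hB⟩ := hcpt.exists_bound_of_continuousOn (hg.mono hsub).continuousOn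
  obtain ⟨K, hK⟩ := (hg.mono hsub).exists_lipschitzOnWith one_ne_zero
    ((convex_Icc _ _).prod (convex_Icc _ _)) hcpt
  refine ⟨max B K, fun θ hθ J hJ => ⟨(hB _ ⟨hθ, hJ⟩).trans (le_max_left _ _), fun J' hJ' => ?_⟩⟩
  have h := hK.dist_le_mul (θ, J) ⟨hθ, hJ⟩ (θ, J') ⟨hθ, hJ'⟩
  rw [Prod.dist_eq, dist_self, max_eq_right dist_nonneg, Real.dist_eq, Real.dist_eq] at h
  exact h.trans (mul_le_mul_of_nonneg_right (le_max_right _ _) (abs_nonneg _))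

theorem exists_taylor_bound {g : ℝ → ℝ} (hg : ContDiffOn ℝ 2 g (Ioi 0)) {a b c : ℝ} (ha : 0 < a)
    (hc : c ∈ Icc a b) :
    ∃ C, ∀ J ∈ Icc a b, ∀ J' ∈ Icc a b, |g J - g J'| ≤ C * |J - J'| ∧
      |g J - g J' - deriv g c * (J - J')| ≤ C * (|J - c| + |J' - c|) * |J - J'| := by
  have hsub : Icc a b ⊆ Ioi 0 := fun J hJ => ha.trans_le hJ.1
  obtain ⟨K, hK⟩ := (hg.mono hsub).exists_lipschitzOnWith (by norm_num) (convex_Icc _ _)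
    isCompact_Icc
  obtain ⟨D, hD⟩ := ((hg.deriv_of_isOpen (m := 1) isOpen_Ioi (by norm_num)).mono
    hsub).exists_lipschitzOnWith one_ne_zero (convex_Icc _ _) isCompact_Icc
  refine ⟨max K D, fun J hJ J' hJ' => ⟨?_, ?_⟩⟩
  · have h := hK.dist_le_mul J hJ J' hJ'
    rw [Real.dist_eq, Real.dist_eq] at h
    exact h.trans (mul_le_mul_of_nonneg_right (le_max_left _ _) (abs_nonneg _))
  · have hseg : uIcc J' J ⊆ Icc a b := (convex_Icc a b).ordConnected.uIcc_subset hJ' hJ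
    have hd : ∀ x ∈ uIcc J' J, HasDerivWithinAt (fun y => g y - deriv g c * y)
        (deriv g x - deriv g c) (uIcc J' J) x := fun x hx => by
      have h1 : HasDerivAt g (deriv g x) x :=
        ((hg.contDiffAt (isOpen_Ioi.mem_nhds (hsub (hseg hx)))).differentiableAt
          (by norm_num)).hasDerivAt
      have h2 := h1.sub ((hasDerivAt_id x).const_mul (deriv g c))
      rw [mul_one] at h2
      exact h2.hasDerivWithinAt
    have hb : ∀ x ∈ uIcc J' J, ‖deriv g x - deriv g c‖ ≤ max (K : ℝ) D * (|J - c| + |J' - c|) :=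
      fun x hx => by
        have h := hD.dist_le_mul x (hseg hx) c hc
        rw [Real.dist_eq, Real.dist_eq] at h
        have hx' : |x - c| ≤ |J - c| + |J' - c| := by
          rw [abs_le]
          rcases mem_uIcc.1 hx with h | h <;> constructor <;>
            linarith [neg_abs_le (J - c), neg_abs_le (J' - c), le_abs_self (J - c),
              le_abs_self (J' - c), h.1, h.2, abs_nonneg (J - c), abs_nonneg (J' - c)]
        exact h.trans (mul_le_mul (le_max_right _ _) hx' (abs_nonneg _)
          (le_max_of_le_left K.coe_nonneg))
    have h := Convex.norm_image_sub_le_of_norm_hasDerivWithin_le hd hb (convex_uIcc _ _)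
      left_mem_uIcc right_mem_uIcc
    rw [Real.norm_eq_abs, Real.norm_eq_abs] at h
    convert h using 2
    ring

/-- The model of the impact oscillator near the `p : q` resonance. -/
def impactModel (Ω Δ γ k : ℝ) (q : ℤ) (f : ℝ → ℝ → ℝ) (J : ℝ) : PhaseModel where
  W := omega0 Ω Δ
  K₁ := kernelPsi Ω Δ
  K₂ := kernelJ Ω Δ
  f := f
  k := k
  γ := γ
  J₀ := J
  w := deriv (omega0 Ω Δ) J
  L := 2 * π * |(q : ℝ)|

theorem ne_zero_of_deriv_omega0_ne_zero {J : ℝ} (h : deriv (omega0 Ω Δ) J ≠ 0) : Δ ≠ 0 := by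
  rintro rfl
  refine h ?_
  have : omega0 Ω 0 = fun _ => 2 * Ω := funext fun K => by simp [omega0]
  rw [this, deriv_const]

theorem omega0_pos (hΩ : 0 < Ω) (hΔ : Δ ≠ 0) {J : ℝ} (hJ : 0 < J) : 0 < omega0 Ω Δ J := by
  rw [omega0_eq hΩ]
  exact div_pos hΩ (freqRatio_mem hΩ hΔ hJ).1

theorem exists_isRegular (hΩ : 0 < Ω) (hΔ : Δ ≠ 0) (γ : ℝ) {ν J : ℝ} {p q : ℤ} (hp : p ≠ 0)
    {f : ℝ → ℝ → ℝ} (hf : IsBiharmonicForce ν f) (hJ : 0 < J)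
    (hres : omega0 Ω Δ J = q / p * ν) :
    ∃ C, (impactModel Ω Δ γ (q / p * ν) q f J).IsRegular C := by
  have hk : 0 < (q / p * ν : ℝ) := hres ▸ omega0_pos hΩ hΔ hJ
  have hp' : (p : ℝ) ≠ 0 := Int.cast_ne_zero.2 hp
  have hq : (q : ℝ) ≠ 0 := by
    intro h
    simp [h] at hk
  have hν : ν ≠ 0 := by
    rintro rfl
    simp at hk
  have hJ2 : 0 < J / 2 := by positivity
  obtain ⟨C₁, h₁⟩ := exists_taylor_bound (b := 3 * J / 2) (c := J)
    (contDiffOn_omega0 (n := 2) hΩ hΔ) hJ2 ⟨by linarith, by linarith⟩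
  obtain ⟨C₂, h₂⟩ := exists_bound_lipschitz (b := 3 * J / 2)
    (contDiffOn_kernelPsi (n := 1) hΩ hΔ) hJ2
  obtain ⟨C₃, h₃⟩ := exists_bound_lipschitz (b := 3 * J / 2) (contDiffOn_kernelJ hΩ hΔ) hJ2
  obtain ⟨C₄, h₄⟩ := hf.isSmoothForce
  set C := max (max C₁ C₂) (max C₃ C₄) with hC
  have e₁ : C₁ ≤ C := (le_max_left _ _).trans (le_max_left _ _)
  have e₂ : C₂ ≤ C := (le_max_right _ _).trans (le_max_left _ _)
  have e₃ : C₃ ≤ C := (le_max_left _ _).trans (le_max_right _ _)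
  have e₄ : C₄ ≤ C := (le_max_right _ _).trans (le_max_right _ _)
  refine ⟨C, {
    k_pos := hk
    J₀_pos := hJ
    L_pos := ?_
    L_eq := ?_
    W_J₀ := hres
    W_lip := fun K hK K' hK' => (h₁ K hK K' hK').1.trans (by gcongr)
    W_taylor := fun K hK K' hK' => (h₁ K hK K' hK').2.trans
      (mul_le_mul_of_nonneg_right (mul_le_mul_of_nonneg_right e₁ (by positivity)) (abs_nonneg _))
    K₁_bound := fun θ hθ K hK => (h₂ θ hθ K hK).1.trans e₂
    K₁_lip := fun θ hθ K hK K' hK' => ((h₂ θ hθ K hK).2 K' hK').trans (by gcongr)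
    K₂_bound := fun θ hθ K hK => (h₃ θ hθ K hK).1.trans e₃
    K₂_lip := fun θ hθ K hK K' hK' => ((h₃ θ hθ K hK).2 K' hK').trans (by gcongr)
    W_cont := (contDiffOn_omega0 (n := 2) hΩ hΔ).continuousOn
    K₁_cont := (contDiffOn_kernelPsi (n := 1) hΩ hΔ).continuousOn
    K₂_cont := (contDiffOn_kernelJ hΩ hΔ).continuousOn
    f_bound := fun t τ => (h₄.bound t τ).trans e₄
    f_diff := fun t τ t' τ' a b a' b' => (h₄.diff t τ t' τ' a b a' b').trans (by gcongr)
    f_periodic := ?_ }⟩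
  · change 0 < 2 * π * |(q : ℝ)|
    positivity
  · refine ⟨|q|, ?_⟩
    change 2 * π * |(q : ℝ)| = _
    push_cast
    ring
  · rcases abs_choice (q : ℝ) with h | h
    · refine hf.periodic (n := p) ?_
      change ν * (2 * π * |(q : ℝ)| / (q / p * ν)) = _
      rw [h]
      field_simp
    · refine hf.periodic (n := -p) ?_
      change ν * (2 * π * |(q : ℝ)| / (q / p * ν)) = _
      rw [h]
      push_cast
      field_simp

theorem resonanceField_eq (γ : ℝ) {k : ℝ} (hk : k ≠ 0) (q : ℤ) (f : ℝ → ℝ → ℝ) (J μ t : ℝ)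
    (x : ℝ × ℝ) (hx : x.2 + k * t ∉ impactPhases) :
    resonanceField Ω Δ γ k f J μ t x = (impactModel Ω Δ γ k q f J).timeField μ t x := by
  have ht : (x.2 + k * t - x.2) / k = t := by
    rw [add_sub_cancel_left, mul_div_cancel_left₀ _ hk]
  simp only [resonanceField, impulseRate, phaseRate, deriv_mul_kappa, kappaPsi_eq hx,
    PhaseModel.timeField, PhaseModel.damped, PhaseModel.force, PhaseModel.impulse,
    PhaseModel.phaseSpeed, PhaseModel.correction, impactModel, ht, zero_add]
  refine Prod.ext rfl ?_
  ring

theorem exists_isTimeField {γ k J : ℝ} {q : ℤ} {f : ℝ → ℝ → ℝ} {C : ℝ}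
    (hS : (impactModel Ω Δ γ k q f J).IsRegular C) :
    ∃ μ₁ > 0, ∀ μ, 0 < μ → μ ≤ μ₁ →
      (impactModel Ω Δ γ k q f J).IsTimeField μ (resonanceField Ω Δ γ k f J μ) := by
  have hk : 0 < k := hS.k_pos
  have hJ : 0 < J := hS.J₀_pos
  have hC := hS.nonneg
  set w := k + C * J with hw
  have hw0 : 0 ≤ w := by positivity
  set B := 4 * w * (2 / J) * (C + |γ| * (3 * J / 2) * w * C) * C with hB
  have hB0 : 0 ≤ B := by positivity
  refine ⟨min (min 1 (J / 2)) (k / 2 / (C + B + 1)), by positivity, fun μ hμ hμ₁ => ⟨?_, ?_⟩⟩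
  · exact fun t x _ _ hx => resonanceField_eq γ hk.ne' q f J μ t x hx
  · intro t x h1 _
    have hμ1 : μ ≤ 1 := hμ₁.trans ((min_le_left _ _).trans (min_le_left _ _))
    have hμJ : μ ≤ J / 2 := hμ₁.trans ((min_le_left _ _).trans (min_le_right _ _))
    have hμk : μ * (C + B + 1) ≤ k / 2 := by
      rw [← le_div_iff₀ (by positivity)]
      exact hμ₁.trans (min_le_right _ _)
    have hmem : J + μ * x.1 ∈ Icc (J / 2) (3 * J / 2) :=
      PhaseModel.impulse_mem (S := impactModel Ω Δ γ k q f J) hJ hμ hμJ h1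
    set K := J + μ * x.1 with hK
    have hK0 : 0 < K := lt_of_lt_of_le (by positivity) hmem.1
    have hW : |omega0 Ω Δ K| ≤ w := hS.abs_W_le hmem
    have hWk : |omega0 Ω Δ K - k| ≤ C * μ := by
      have h := hS.W_lip K hmem J ⟨by change J / 2 ≤ J; linarith, by change J ≤ 3 * J / 2; linarith⟩
      rw [show (impactModel Ω Δ γ k q f J).W J = k from hS.W_J₀, hK, add_sub_cancel_left, abs_mul,
        abs_of_pos hμ] at h
      refine h.trans ?_
      gcongr
      exact mul_le_of_le_one_right hμ.le h1
    have hκ : |kappaPsi Ω Δ (x.2 + k * t) K| ≤ C := by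
      rcases kappaPsi_eq_or Ω Δ (x.2 + k * t) K with h | h <;> rw [h]
      · exact hS.K₁_bound _ (PhaseModel.angle_mem _) _ hmem
      · rwa [abs_zero]
    have hκJ : |kernelJ Ω Δ (PhaseModel.angle (x.2 + k * t)) K| ≤ C :=
      hS.K₂_bound _ (PhaseModel.angle_mem _) _ hmem
    have hKinv : |K⁻¹| ≤ 2 / J := by
      rw [abs_of_pos (inv_pos.2 hK0), ← inv_div]
      exact inv_anti₀ (by positivity) hmem.1
    have hG : |phaseRate Ω Δ γ k f t (μ ^ 2 * t) x.2 K| ≤ B := by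
      rw [phaseRate, deriv_mul_kappa, abs_mul, abs_mul, abs_mul, abs_mul, hB]
      have h4 : |(-4 : ℝ)| = 4 := by norm_num
      rw [h4]
      have hd : |f t (μ ^ 2 * t) + γ * K * omega0 Ω Δ K * kappaPsi Ω Δ (x.2 + k * t) K| ≤
          C + |γ| * (3 * J / 2) * w * C := by
        refine (abs_add_le _ _).trans (add_le_add (hS.f_bound _ _) ?_)
        rw [abs_mul, abs_mul, abs_mul, abs_of_pos hK0]
        gcongr
        exact hmem.2
      gcongr
    change |omega0 Ω Δ K - k + μ ^ 2 * phaseRate Ω Δ γ k f t (μ ^ 2 * t) x.2 K| ≤ k / 2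
    refine (abs_add_le _ _).trans ?_
    rw [abs_mul, abs_of_pos (pow_pos hμ 2)]
    have h5 : μ ^ 2 * |phaseRate Ω Δ γ k f t (μ ^ 2 * t) x.2 K| ≤ μ * B := by
      refine mul_le_mul ?_ hG (abs_nonneg _) hμ.le
      nlinarith
    nlinarith

end Model

end

end ImpactOscillator

namespace ImpactOscillator

open MeasureTheory Filter Topology

theorem exists_modulus_of_periodic {g : ℝ → ℝ} (hg : Continuous g) {P : ℝ} (hP : 0 < P)
    (hper : Function.Periodic g P) {ε : ℝ} (hε : 0 < ε) :
    ∃ δ > 0, ∀ x y, |x - y| ≤ δ → |g x - g y| ≤ ε := by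
  have hu : UniformContinuousOn g (Icc (-P) (2 * P)) :=
    isCompact_Icc.uniformContinuousOn_of_continuous hg.continuousOn
  obtain ⟨δ, hδ, h⟩ := Metric.uniformContinuousOn_iff.1 hu ε hε
  refine ⟨min (δ / 2) P, by positivity, fun x y hxy => ?_⟩
  set n := ⌊x / P⌋
  have h1 : n * P ≤ x := by
    have := Int.floor_le (x / P)
    rwa [le_div_iff₀ hP] at this
  have h2 : x < (n + 1) * P := by
    have := Int.lt_floor_add_one (x / P)
    rwa [div_lt_iff₀ hP] at this
  have h3 := abs_le.1 (hxy.trans (min_le_right _ _))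
  have h4 := h (x - n * P) ⟨by linarith, by linarith⟩ (y - n * P) ⟨by linarith, by linarith⟩
    (by
      rw [Real.dist_eq, sub_sub_sub_cancel_right]
      exact (hxy.trans (min_le_left _ _)).trans_lt (by linarith))
  rw [hper.sub_int_mul_eq, hper.sub_int_mul_eq, Real.dist_eq] at h4
  exact h4.le

/-- If increments depend on the base point in a Lipschitz way, then a function differentiable at
one point is nearly linear around it. -/
theorem abs_sub_sub_deriv_mul_le {A : ℝ → ℝ} {D d η ρ φ φ' : ℝ} (hD0 : 0 ≤ D)
    (hD : ∀ a b ξ, |A (a + ξ) - A a - (A (b + ξ) - A b)| ≤ D * |ξ| * |a - b|)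
    (hd : HasDerivAt A d η) (hφ : |φ - η| ≤ ρ) (hφ' : |φ' - η| ≤ ρ) :
    |A φ - A φ' - d * (φ - φ')| ≤ D * ρ * |φ - φ'| := by
  set h := φ - φ' with hh
  have hlim : Tendsto (fun n : ℕ => (n : ℝ) * (A (η + (n : ℝ)⁻¹ * h) - A η)) atTop
      (𝓝 (d * h)) := by
    have := (hd.hasFDerivAt.lim_real h).comp tendsto_natCast_atTop_atTop
    simpa [Function.comp_def, mul_comm] using this
  have hle : ∀ᶠ n : ℕ in atTop,
      |A φ - A φ' - (n : ℝ) * (A (η + (n : ℝ)⁻¹ * h) - A η)| ≤ D * ρ * |h| := by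
    filter_upwards [eventually_gt_atTop 0] with n hn
    have hn0 : (0 : ℝ) < n := Nat.cast_pos.2 hn
    set x : ℕ → ℝ := fun i => φ' + i * ((n : ℝ)⁻¹ * h) with hx
    have hxs : ∀ i, x (i + 1) = x i + (n : ℝ)⁻¹ * h := fun i => by
      simp only [hx]; push_cast; ring
    have hxm : ∀ i ∈ Finset.range n, |x i - η| ≤ ρ := fun i hi => by
      have hi' : (i : ℝ) ≤ n := Nat.cast_le.2 (Finset.mem_range.1 hi).le
      have hs : (i : ℝ) * (n : ℝ)⁻¹ ∈ Icc (0 : ℝ) 1 :=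
        ⟨by positivity, by rw [← div_eq_mul_inv]; exact (div_le_one hn0).2 hi'⟩
      have e : x i - η = (1 - i * (n : ℝ)⁻¹) * (φ' - η) + i * (n : ℝ)⁻¹ * (φ - η) := by
        simp only [hx, hh]; ring
      rw [e]
      refine (abs_add_le _ _).trans ?_
      rw [abs_mul, abs_mul, abs_of_nonneg hs.1, abs_of_nonneg (sub_nonneg.2 hs.2)]
      nlinarith [mul_le_mul_of_nonneg_left hφ' (sub_nonneg.2 hs.2),
        mul_le_mul_of_nonneg_left hφ hs.1]
    have hsum : A φ - A φ' - (n : ℝ) * (A (η + (n : ℝ)⁻¹ * h) - A η) =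
        ∑ i ∈ Finset.range n, (A (x (i + 1)) - A (x i) - (A (η + (n : ℝ)⁻¹ * h) - A η)) := by
      rw [Finset.sum_sub_distrib, Finset.sum_range_sub (fun i => A (x i)), Finset.sum_const,
        Finset.card_range, nsmul_eq_mul]
      have e1 : x n = φ := by
        simp only [hx, hh]; field_simp; ring
      have e2 : x 0 = φ' := by simp [hx]
      rw [e1, e2]
    rw [hsum]
    calc _ ≤ ∑ i ∈ Finset.range n, D * |(n : ℝ)⁻¹ * h| * ρ := by
          refine (Finset.abs_sum_le_sum_abs _ _).trans (Finset.sum_le_sum fun i hi => ?_)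
          rw [hxs]
          exact (hD _ _ _).trans (mul_le_mul_of_nonneg_left (hxm i hi) (by positivity))
      _ = D * ρ * |h| := by
          rw [Finset.sum_const, Finset.card_range, nsmul_eq_mul, abs_mul, abs_inv,
            abs_of_pos hn0]
          field_simp
  exact le_of_tendsto ((tendsto_const_nhds.sub hlim).abs) hle

namespace PhaseModel

noncomputable section

variable {S : PhaseModel} {C : ℝ}

/-- The integral of the leading term over a period. -/
def leadIntegral (S : PhaseModel) (τ φ : ℝ) : ℝ := ∫ s in (0 : ℝ)..S.L, S.leadZ τ s φ

theorem IsRegular.abs_leadIntegral_diff_le (hS : S.IsRegular C) :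
    ∃ D, 0 < D ∧ (∀ τ a b ξ ζ, |S.leadIntegral τ (a + ξ) - S.leadIntegral τ a -
      (S.leadIntegral τ (b + ζ) - S.leadIntegral τ b)| ≤ D * |ξ - ζ| + D * |ξ| * |a - b|) ∧
      ∀ τ τ' φ, |S.leadIntegral τ φ - S.leadIntegral τ' φ| ≤ D * |τ - τ'| := by
  have hk := hS.k_pos
  have hC := hS.nonneg
  have hL := hS.L_pos
  have hi := hS.intervalIntegrable_leadZ
  have hJ₀ : S.J₀ ∈ Icc (S.J₀ / 2) (3 * S.J₀ / 2) := by constructor <;> linarith [hS.J₀_pos]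
  set d := 1 / S.k with hd
  have hd0 : 0 < d := by positivity
  have e1 : 4 * C * C * d * S.L ≤ 1 + 4 * C * C * S.L * (1 + d + d ^ 2) := by
    nlinarith [show 0 ≤ C * C * S.L by positivity, show 0 ≤ C * C * S.L * d ^ 2 by positivity]
  have e2 : 4 * C * C * d ^ 2 * S.L ≤ 1 + 4 * C * C * S.L * (1 + d + d ^ 2) := by
    nlinarith [show 0 ≤ C * C * S.L by positivity, show 0 ≤ C * C * S.L * d by positivity]
  have e3 : 4 * C * C * S.L ≤ 1 + 4 * C * C * S.L * (1 + d + d ^ 2) := by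
    nlinarith [show 0 ≤ C * C * S.L * d ^ 2 by positivity, show 0 ≤ C * C * S.L * d by positivity]
  refine ⟨1 + 4 * C * C * S.L * (1 + d + d ^ 2), by positivity, fun τ a b ξ ζ => ?_,
    fun τ τ' φ => ?_⟩
  · unfold leadIntegral
    rw [← intervalIntegral.integral_sub (hi _ _ _ _) (hi _ _ _ _),
      ← intervalIntegral.integral_sub (hi _ _ _ _) (hi _ _ _ _),
      ← intervalIntegral.integral_sub ((hi _ _ _ _).sub (hi _ _ _ _))
        ((hi _ _ _ _).sub (hi _ _ _ _))]
    have h := intervalIntegral.norm_integral_le_of_norm_le_const (a := 0) (b := S.L)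
      (f := fun s => S.leadZ τ s (a + ξ) - S.leadZ τ s a - (S.leadZ τ s (b + ζ) - S.leadZ τ s b))
      (fun s _ => hS.leadZ_diff τ s a b ξ ζ)
    rw [sub_zero, abs_of_pos hL, Real.norm_eq_abs] at h
    refine h.trans ?_
    have h1 := mul_le_mul_of_nonneg_right e1 (abs_nonneg (ξ - ζ))
    have h2 := mul_le_mul_of_nonneg_right e2 (mul_nonneg (abs_nonneg ξ) (abs_nonneg (a - b)))
    nlinarith
  · unfold leadIntegral
    rw [← intervalIntegral.integral_sub (hi _ _ _ _) (hi _ _ _ _)]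
    have h := intervalIntegral.norm_integral_le_of_norm_le_const (a := 0) (b := S.L)
      (C := 4 * (C * |τ - τ'|) * C) (f := fun s => S.leadZ τ s φ - S.leadZ τ' s φ) (fun s _ => by
        have hK := hS.K₁_bound _ (angle_mem s) _ hJ₀
        have hf := hS.f_lip ((s - φ) / S.k) τ ((s - φ) / S.k) τ'
        rw [sub_self, abs_zero, zero_add] at hf
        have e : S.leadZ τ s φ - S.leadZ τ' s φ = -4 * (S.f ((s - φ) / S.k) τ -
          S.f ((s - φ) / S.k) τ') * S.K₁ (angle s) S.J₀ := by unfold leadZ; ring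
        rw [e, Real.norm_eq_abs, abs_mul, abs_mul, abs_neg, abs_of_pos (four_pos (α := ℝ))]
        gcongr)
    rw [sub_zero, abs_of_pos hL, Real.norm_eq_abs] at h
    refine h.trans ?_
    have h3 := mul_le_mul_of_nonneg_right e3 (abs_nonneg (τ - τ'))
    nlinarith

theorem IsRegular.exists_isHyperbolic (hS : S.IsRegular C) {η₀ : ℝ → ℝ} {P P' σ : ℝ}
    (hw : S.w ≠ 0) (hcont : Continuous η₀) (hP : 0 < P) (hper : Function.Periodic η₀ P)
    (hP' : 0 < P') (hf : ∀ t τ, S.f t (τ + P') = S.f t τ)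
    (hrange : ∀ τ, 0 < η₀ τ ∧ η₀ τ < 2 * π) (hzero : ∀ τ, S.leadIntegral τ (η₀ τ) = 0)
    (hσ : 0 < σ) (hslope : ∀ τ, σ ≤ S.w * deriv (S.leadIntegral τ) (η₀ τ)) :
    ∃ ς m M ρ Λ δ, S.IsHyperbolic η₀ ς m M ρ Λ δ := by
  have hk := hS.k_pos
  have hL := hS.L_pos
  obtain ⟨D, hD, hdiff, hτ⟩ := hS.abs_leadIntegral_diff_le
  have hw0 : 0 < |S.w| := abs_pos.2 hw
  obtain ⟨ς, hς, hςw⟩ : ∃ ς : ℝ, (ς = 1 ∨ ς = -1) ∧ ς * S.w = |S.w| := by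
    rcases abs_choice S.w with h | h
    · exact ⟨1, Or.inl rfl, by rw [h, one_mul]⟩
    · exact ⟨-1, Or.inr rfl, by rw [h, neg_one_mul]⟩
  have hς2 : ς * ς = 1 := by rcases hς with rfl | rfl <;> norm_num
  have hςabs : |ς| = 1 := by rcases hς with rfl | rfl <;> norm_num
  have hwς : S.w = ς * |S.w| := by rw [← hςw, ← mul_assoc, hς2, one_mul]
  set m₀ := σ / |S.w| / 2 with hm₀
  have hm₀0 : 0 < m₀ := by positivity
  have hd : ∀ τ, ∃ d, HasDerivAt (S.leadIntegral τ) d (η₀ τ) ∧ 2 * m₀ ≤ ς * d := fun τ => by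
    have h := hslope τ
    have hne : deriv (S.leadIntegral τ) (η₀ τ) ≠ 0 := fun h0 => by
      rw [h0, mul_zero] at h
      linarith
    refine ⟨_, (differentiableAt_of_deriv_ne_zero hne).hasDerivAt, ?_⟩
    rw [hm₀, mul_div_cancel₀ _ two_ne_zero, div_le_iff₀ hw0]
    rw [hwς] at h
    linarith
  set w₀ := S.L * (|S.w| / S.k) with hw₀
  have hw₀0 : 0 < w₀ := by positivity
  set m := min m₀ w₀ with hm
  have hm0 : 0 < m := by positivity
  set M := max D w₀ with hM
  set ρ := min (1 / 4) (m₀ / D) with hρ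
  have hρ0 : 0 < ρ := by positivity
  have hDρ : D * ρ ≤ m₀ := by
    have : ρ ≤ m₀ / D := min_le_right _ _
    rwa [le_div_iff₀ hD, mul_comm] at this
  have hlip : ∀ τ φ φ', |S.leadIntegral τ φ - S.leadIntegral τ φ'| ≤ D * |φ - φ'| :=
    fun τ φ φ' => by
      have := hdiff τ φ' φ' (φ - φ') 0
      simpa using this
  have hsl : ∀ τ φ φ', |φ - η₀ τ| ≤ ρ → |φ' - η₀ τ| ≤ ρ → ∃ b ∈ Icc m M,
      ς * (S.leadIntegral τ φ - S.leadIntegral τ φ') = b * (φ - φ') := fun τ φ φ' h1 h2 => by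
    obtain ⟨d, hd1, hd2⟩ := hd τ
    have hinc : ∀ a b ξ, |S.leadIntegral τ (a + ξ) - S.leadIntegral τ a -
        (S.leadIntegral τ (b + ξ) - S.leadIntegral τ b)| ≤ D * |ξ| * |a - b| := fun a b ξ => by
      have := hdiff τ a b ξ ξ
      rwa [sub_self, abs_zero, mul_zero, zero_add] at this
    have hlin := abs_sub_sub_deriv_mul_le hD.le hinc hd1 h1 h2
    rcases eq_or_ne φ φ' with rfl | hne
    · exact ⟨w₀, ⟨min_le_right _ _, le_max_right _ _⟩, by simp⟩
    · set x := φ - φ' with hx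
      have hx0 : x ≠ 0 := sub_ne_zero.2 hne
      set y := S.leadIntegral τ φ - S.leadIntegral τ φ' with hy
      have hb : ς * y = ς * y / x * x := (div_mul_cancel₀ _ hx0).symm
      refine ⟨ς * y / x, ⟨(min_le_left _ _).trans ?_, le_trans ?_ (le_max_left _ _)⟩, hb⟩
      · have h3 : |ς * y / x - ς * d| ≤ m₀ := by
          have e : ς * y / x - ς * d = ς * (y - d * x) / x := by field_simp
          rw [e, abs_div, abs_mul, hςabs, one_mul, div_le_iff₀ (abs_pos.2 hx0)]
          exact hlin.trans (mul_le_mul_of_nonneg_right hDρ (abs_nonneg _))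
        linarith [(abs_le.1 h3).1]
      · refine (le_abs_self _).trans ?_
        rw [abs_div, abs_mul, hςabs, one_mul, div_le_iff₀ (abs_pos.2 hx0)]
        exact hlip τ φ φ'
  obtain ⟨δ, hδ, hmod⟩ := exists_modulus_of_periodic hcont hP hper hρ0
  refine ⟨ς, m, M, ρ, D / m, δ, {
    sign := hς
    m_pos := hm0
    ρ_pos := hρ0
    ρ_le := min_le_left _ _
    δ_pos := hδ
    Λ_nonneg := by positivity
    range := hrange
    zero := hzero
    slope := hsl
    slope_w := ?_
    lip := fun τ τ' h => ?_
    periodic := ⟨P, hP, hper⟩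
    f_periodic := ⟨P', hP', hf⟩ }⟩
  · have e : ς * (S.L * (S.w / S.k)) = w₀ := by rw [hw₀, ← hςw]; ring
    rw [e]
    exact ⟨min_le_right _ _, le_max_right _ _⟩
  · obtain ⟨b, hb, hb'⟩ := hsl τ' (η₀ τ) (η₀ τ') (hmod τ τ' h) (by simpa using hρ0.le)
    have h1 := hτ τ' τ (η₀ τ)
    rw [hzero, sub_zero, abs_sub_comm] at h1
    rw [hzero, sub_zero] at hb'
    have h2 : b * |η₀ τ - η₀ τ'| ≤ D * |τ - τ'| := by
      rw [← abs_of_pos (hm0.trans_le hb.1), ← abs_mul, ← hb', abs_mul, hςabs, one_mul]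
      exact h1
    rw [div_mul_eq_mul_div, le_div_iff₀ hm0, mul_comm]
    exact (mul_le_mul_of_nonneg_right hb.1 (abs_nonneg _)).trans h2

theorem IsRegular.periodic_leadZ (hS : S.IsRegular C) (τ φ : ℝ) :
    Function.Periodic (fun s => S.leadZ τ s φ) S.L := fun s => by
  have h1 : (s + S.L - φ) / S.k = (s - φ) / S.k + S.L / S.k := by ring
  have h2 := hS.angle_add s 1
  rw [Int.cast_one, one_mul] at h2
  simp only [leadZ, h1, h2, hS.f_periodic]

end

end PhaseModel

theorem averagedImpulseRate_eq {Ω Δ γ ν J : ℝ} {p q : ℤ} (hp : p ≠ 0) {f : ℝ → ℝ → ℝ}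
    (hres : omega0 Ω Δ J = q / p * ν) {C : ℝ}
    (hS : (impactModel Ω Δ γ (q / p * ν) q f J).IsRegular C) (η τ : ℝ) :
    averagedImpulseRate Ω Δ γ ν p q f J η τ =
      (q / p * ν) / (2 * π * |(q : ℝ)|) *
        (impactModel Ω Δ γ (q / p * ν) q f J).leadIntegral τ η := by
  set S := impactModel Ω Δ γ (q / p * ν) q f J with hSdef
  set k : ℝ := q / p * ν with hk
  have hk0 : 0 < k := hS.k_pos
  have hp' : (p : ℝ) ≠ 0 := Int.cast_ne_zero.2 hp
  have hq : (q : ℝ) ≠ 0 := by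
    intro h
    simp [hk, h] at hk0
  have hν : ν ≠ 0 := by
    rintro rfl
    simp [hk] at hk0
  set g : ℝ → ℝ := fun s => -4 * k * (f ((s - η) / k) τ + γ * J * k * kappaPsi Ω Δ s J) *
    kappaPsi Ω Δ s J with hg
  have h1 : ∀ t, impulseRate Ω Δ γ k f t τ η J = g (η + k * t) := fun t => by
    have : (η + k * t - η) / k = t := by rw [add_sub_cancel_left, mul_div_cancel_left₀ _ hk0.ne']
    simp only [hg, impulseRate, hres, this]
  have h2 : ∀ a b : ℝ, ∫ s in a..b, g s = ∫ s in a..b, k * S.leadZ τ s η := fun a b => by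
    refine intervalIntegral.integral_congr_ae ?_
    filter_upwards [compl_mem_ae_iff.2 (countable_impactPhases.measure_zero volume)] with s hs _
    simp only [hg, kappaPsi_eq hs, PhaseModel.leadZ]
    change _ = k * (-4 * (f ((s - η) / k) τ + γ * J * k * kernelPsi Ω Δ (PhaseModel.angle s) J) *
      kernelPsi Ω Δ (PhaseModel.angle s) J)
    ring
  have h3 : ∫ s in η..(η + 2 * π * q), S.leadZ τ s η =
      q / |(q : ℝ)| * S.leadIntegral τ η := by
    obtain ⟨n, hn1, hn2⟩ : ∃ n : ℤ, (2 * π * q : ℝ) = n • S.L ∧ (n : ℝ) = q / |(q : ℝ)| := by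
      rcases abs_choice (q : ℝ) with h | h
      · refine ⟨1, ?_, ?_⟩
        · change _ = (1 : ℤ) • (2 * π * |(q : ℝ)|)
          rw [h, one_smul]
        · rw [h, div_self hq, Int.cast_one]
      · refine ⟨-1, ?_, ?_⟩
        · change _ = (-1 : ℤ) • (2 * π * |(q : ℝ)|)
          rw [h, neg_one_smul]
          ring
        · rw [h, div_neg, div_self hq, Int.cast_neg, Int.cast_one]
    rw [hn1, (hS.periodic_leadZ τ η).intervalIntegral_add_zsmul_eq n η
      (hS.intervalIntegrable_leadZ τ η), (hS.periodic_leadZ τ η).intervalIntegral_add_eq η 0,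
      zero_add, zsmul_eq_mul, hn2]
    rfl
  have h4 : ∫ t in (0 : ℝ)..(2 * π * p / ν), impulseRate Ω Δ γ k f t τ η J =
      q / |(q : ℝ)| * S.leadIntegral τ η := by
    have e : k * (2 * π * p / ν) = 2 * π * q := by
      rw [hk]
      field_simp
    simp only [h1]
    rw [intervalIntegral.integral_comp_add_mul _ hk0.ne', h2, mul_zero, add_zero, e,
      intervalIntegral.integral_const_mul, h3, smul_eq_mul, inv_mul_cancel_left₀ hk0.ne']
  rw [averagedImpulseRate, h4, hk]
  have hq' : |(q : ℝ)| ≠ 0 := abs_ne_zero.2 hq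
  field_simp

end ImpactOscillator
theorem theorem1 (Ω Δ γ ν : ℝ) (hΩ : 0 < Ω) (hγ : 0 < γ)
    (f : ℝ → ℝ → ℝ) (hf : ImpactOscillator.IsBiharmonicForce ν f)
    (p q : ℤ) (hp : p ≠ 0) (hpq : IsCoprime p q)
    (Jpq : ℝ) (hJ : 0 < Jpq)
    (hres : ImpactOscillator.omega0 Ω Δ Jpq = q / p * ν)
    (hnd : deriv (ImpactOscillator.omega0 Ω Δ) Jpq ≠ 0)
    (η₀ : ℝ → ℝ) (hcont : Continuous η₀) (hper : ∃ P > 0, Function.Periodic η₀ P)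
    (hrange : ∀ τ, 0 < η₀ τ ∧ η₀ τ < 2 * Real.pi)
    (hzero : ∀ τ, ImpactOscillator.averagedImpulseRate Ω Δ γ ν p q f Jpq (η₀ τ) τ = 0)
    (σ₀ : ℝ) (hσ₀ : 0 < σ₀)
    (hhyp : ∀ τ, σ₀ < deriv (ImpactOscillator.omega0 Ω Δ) Jpq *
      deriv (fun η => ImpactOscillator.averagedImpulseRate Ω Δ γ ν p q f Jpq η τ) (η₀ τ)) :
    ∃ r₀ > 0, ∀ r : ℝ, 0 < r → r ≤ r₀ → ∃ μ₀ > 0, ∀ μ : ℝ, 0 < μ → μ < μ₀ →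
      ∃ x : ℝ → ℝ × ℝ,
        (ImpactOscillator.IsSolutionOn Ω Δ γ (q / p * ν) f Jpq μ Set.univ x ∧
          ImpactOscillator.IsAlmostPeriodic x ∧ ImpactOscillator.StaysNear η₀ μ r x) ∧
        (∀ y : ℝ → ℝ × ℝ,
          ImpactOscillator.IsSolutionOn Ω Δ γ (q / p * ν) f Jpq μ Set.univ y →
          ImpactOscillator.IsAlmostPeriodic y → ImpactOscillator.StaysNear η₀ μ r y → y = x) ∧
        ImpactOscillator.IsUnstable Ω Δ γ (q / p * ν) f Jpq μ x := by
  have hΔ := ImpactOscillator.ne_zero_of_deriv_omega0_ne_zero hnd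
  obtain ⟨C, hS⟩ := ImpactOscillator.exists_isRegular hΩ hΔ γ hp hf hJ hres
  set S := ImpactOscillator.impactModel Ω Δ γ (q / p * ν) q f Jpq with hSdef
  have hk : 0 < (q / p * ν : ℝ) := hS.k_pos
  have hL : 0 < 2 * π * |(q : ℝ)| := hS.L_pos
  have havg := ImpactOscillator.averagedImpulseRate_eq hp hres hS
  set c : ℝ := q / p * ν / (2 * π * |(q : ℝ)|) with hc
  have hc0 : 0 < c := by positivity
  obtain ⟨P, hP, hper⟩ := hper
  obtain ⟨P', hP', hfper⟩ := hf.slow_periodic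
  obtain ⟨ς, m, M, ρ, Λ, δ, hη⟩ := hS.exists_isHyperbolic hnd hcont hP hper hP' hfper hrange
    (fun τ => (mul_eq_zero.1 ((havg _ _).symm.trans (hzero τ))).resolve_left hc0.ne')
    (div_pos hσ₀ hc0) (fun τ => by
      have h := (hhyp τ).le
      have e : (fun η => ImpactOscillator.averagedImpulseRate Ω Δ γ ν p q f Jpq η τ) =
          fun η => c * S.leadIntegral τ η := funext fun η => havg η τ
      rw [e, deriv_const_mul_field] at h
      rw [div_le_iff₀ hc0]
      refine h.trans (le_of_eq ?_)
      change _ = deriv (ImpactOscillator.omega0 Ω Δ) Jpq * _ * c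
      ring)
  obtain ⟨C', K, μ₁, hμ₁, hnear⟩ := ImpactOscillator.PhaseModel.exists_isNearResonance hS hη
  obtain ⟨μ₂, hμ₂, hfield⟩ := ImpactOscillator.exists_isTimeField hS
  have hρ := hη.ρ_pos
  have hδ := hη.δ_pos
  have hm := hη.m_pos
  refine ⟨ρ / 8, by positivity, fun r hr hr' => ?_⟩
  have hsmall : ∀ a b : ℝ, 0 < b → ∀ᶠ μ in nhdsWithin (0 : ℝ) (Ioi 0), a * μ ≤ b := fun a b hb => by
    have h : Filter.Tendsto (fun μ : ℝ => a * μ) (nhdsWithin 0 (Ioi 0)) (nhds (a * 0)) :=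
      ((continuous_const_mul a).tendsto 0).mono_left nhdsWithin_le_nhds
    rw [mul_zero] at h
    exact h.eventually_le_const hb
  have hev := ((hsmall 1 μ₁ hμ₁).and (hsmall 1 μ₂ hμ₂)).and
    (((hsmall (C' * S.L) (r / 8) (by positivity)).and
      (hsmall (4 * K) (m * (r / 4)) (by positivity))).and
    (((hsmall 1 1 one_pos).and (hsmall ((S.L + 8) / S.k) δ hδ)).and
      (hsmall (Λ * ((S.L + 8) / S.k)) (r / 4) (by positivity))))
  obtain ⟨μ₀, hμ₀, hμ⟩ := mem_nhdsGT_iff_exists_Ioo_subset.1 hev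
  refine ⟨μ₀, hμ₀, fun μ h0 h1 => ?_⟩
  obtain ⟨⟨a₁, a₂⟩, ⟨a₃, a₄⟩, ⟨a₅, a₆⟩, a₇⟩ := hμ ⟨h0, h1⟩
  rw [one_mul] at a₁ a₂ a₅
  exact (hnear μ h0 a₁).exists_unique_unstable hr hr' (by linarith) a₄ a₅ (by linarith)
    (by linarith) (hfield μ h0 a₂) rfl
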